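/- Let $\mathbb{H}$ be a separable infinite-dimensional real Hilbert space and $p\ge 0$ an integer. Let $H^p([0,2\pi])$ be the Sobolev space of real functions on $[0,2\pi]$ whose derivatives up to order $p$ lie in $L^2$, and let $H^p(\mathbb{S}^1)\subset H^p([0,2\pi])$ be the closed subspace of those $u$ with $u^{(j)}(0)=u^{(j)}(2\pi)$ for $0\le j<p$. Let $\Pi: G=\widetilde{SL(2,\mathbb{R})}\to SL(2,\mathbb{R})$ be the universal cover. For $q\in L^2([0,2\pi])$ let $\Phi:[0,2\pi]\to SL(2,\mathbb{R})$ be the fundamental matrix of $-v''+qv=0$, i.e. $\Phi(0)=I$ and $\Phi'(t)=\begin{pmatrix}0&1\\ q(t)&0\end{pmatrix}\Phi(t)$. Let $\tilde\Phi:[0,2\pi]\to G$ be its continuous lift with $\tilde\Phi(0)=I$, and let $\mu(q)=\tilde\Phi(2\pi)\in G$ be the monodromy of $q$. Let $\phi_L:\mathbb{R}\times(0,\infty)\times\mathbb{R}\to G$ be the diffeomorphism with $\phi_L(0,1,0)=I$ and $$\Pi(\phi_L(\theta,\rho,\nu))=\begin{pmatrix}\cos\theta&\sin\theta\\-\sin\theta&\cos\theta\end{pmatrix}\begin{pmatrix}\sqrt\rho&0\\0&1/\sqrt\rho\end{pmatrix}\begin{pmatrix}1&0\\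 \nu/2&1\end{pmatrix},$$ and let $G_0=\phi_L((0,\infty)\times(0,\infty)\times\mathbb{R})$, an open subset of $G$. **Theorem.** The monodromy $\mu(q)$ is well defined for every $q\in L^2([0,2\pi])$, and $G_0$ is diffeomorphic to $\mathbb{R}^3$; fix below one suitable diffeomorphism $\chi:G_0\to\mathbb{R}^3$. For every $p\ge 0$ there exist smooth diffeomorphisms $$\Psi^p_{[0,2\pi]}:G_0\times\mathbb{H}\to H^p([0,2\pi]),\qquad \Psi^p_{\mathbb{S}^1}:G_0\times\mathbb{H}\to H^p(\mathbb{S}^1)$$ such that both compositions $\mu\circ\Psi^p$ are the projection $(g,h)\mapsto g$ onto the first coordinate. In particular, for $X=H^p([0,2\pi])$ and for $X=H^p(\mathbb{S}^1)$, the image of $\mu|_X$ is exactly $G_0$, and the level sets of $\mu|_X$ are parallel affine subspaces of codimension $3$ up to a diffeomorphism: there is a smooth diffeomorphism $\Theta:X\to\mathbb{R}^3\times\mathbb{H}$ with $\Theta(\{q\in X:\mu(q)=g\})=\{\chi(g)\}\times\mathbb{H}$ for every $g\in G_0$. -/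

import Mathlib

open MeasureTheory Set
open scoped Manifold ContDiff

noncomputable section

namespace Monodromy

/-! ### The universal cover of `SL(2, ℝ)` -/

/-- The group `SL(2, ℝ)` with its usual topology. -/
abbrev SL2 : Type := Matrix.SpecialLinearGroup (Fin 2) ℝ

/-- The universal cover `G` of `SL(2, ℝ)`: pairs of a matrix `A` and a real number `θ` that is
an argument of the (nonzero) first row of `A`. See `isCoveringMap_proj` and the instance
`SimplyConnectedSpace G` below. -/
def G : Type :=
  {x : SL2 × ℝ //
    x.1 0 0 = √(x.1 0 0 ^ 2 + x.1 0 1 ^ 2) * Real.cos x.2 ∧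
    x.1 0 1 = √(x.1 0 0 ^ 2 + x.1 0 1 ^ 2) * Real.sin x.2}

instance : TopologicalSpace G := inferInstanceAs (TopologicalSpace (Subtype _))

/-- The covering projection `Π : G → SL(2, ℝ)`. -/
def G.proj (g : G) : SL2 := g.1.1

/-- The lifted argument of the first row. -/
def G.angle (g : G) : ℝ := g.1.2

/-- The base point `I` of `G`, lying over the identity matrix. -/
instance : One G := ⟨⟨(1, 0), by simp⟩⟩

instance : Inhabited G := ⟨1⟩

theorem G.ext' {g h : G} (h1 : g.proj = h.proj) (h2 : g.angle = h.angle) : g = h :=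
  Subtype.ext (Prod.ext h1 h2)

theorem continuous_proj : Continuous G.proj := continuous_fst.comp continuous_subtype_val

theorem continuous_angle : Continuous G.angle := continuous_snd.comp continuous_subtype_val

theorem continuous_entry (i j : Fin 2) : Continuous fun A : SL2 => A i j :=
  (continuous_apply_apply i j).comp continuous_subtype_val

theorem det_eq (A : SL2) : A 0 0 * A 1 1 - A 0 1 * A 1 0 = 1 := by
  have := A.2
  rwa [Matrix.det_fin_two] at this

/-- `|v|²`, where `v` is the first row of the matrix. -/
def rowSq (A : SL2) : ℝ := A 0 0 ^ 2 + A 0 1 ^ 2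

theorem rowSq_pos (A : SL2) : 0 < rowSq A := by
  have h := det_eq A
  unfold rowSq
  by_contra hn
  have h0 : A 0 0 = 0 := by nlinarith [sq_nonneg (A 0 0), sq_nonneg (A 0 1)]
  have h1 : A 0 1 = 0 := by nlinarith [sq_nonneg (A 0 0), sq_nonneg (A 0 1)]
  simp [h0, h1] at h

theorem continuous_rowSq : Continuous rowSq :=
  ((continuous_entry 0 0).pow 2).add ((continuous_entry 0 1).pow 2)

theorem G.row0 (g : G) : g.proj 0 0 = √(rowSq g.proj) * Real.cos g.angle := g.2.1

theorem G.row1 (g : G) : g.proj 0 1 = √(rowSq g.proj) * Real.sin g.angle := g.2.2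

/-- Half of the coordinate `ν` of the right Iwasawa decomposition: the scalar product of the two
rows of the matrix. -/
def rowDot (A : SL2) : ℝ := A 0 0 * A 1 0 + A 0 1 * A 1 1

theorem continuous_rowDot : Continuous rowDot :=
  ((continuous_entry 0 0).mul (continuous_entry 1 0)).add
    ((continuous_entry 0 1).mul (continuous_entry 1 1))

/-- The matrix `diag(√ρ, 1/√ρ) * (1, 0; ν/2, 1) * (cos θ, sin θ; -sin θ, cos θ)`. -/
def iwasawaMatrix (θ ρ ν : ℝ) : Matrix (Fin 2) (Fin 2) ℝ :=
  !![√ρ, 0; 0, 1 / √ρ] * !![1, 0; ν / 2, 1] *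
    !![Real.cos θ, Real.sin θ; -Real.sin θ, Real.cos θ]

theorem iwasawaMatrix_eq (θ ρ ν : ℝ) : iwasawaMatrix θ ρ ν =
    !![√ρ * Real.cos θ, √ρ * Real.sin θ;
      1 / √ρ * (ν / 2 * Real.cos θ - Real.sin θ), 1 / √ρ * (ν / 2 * Real.sin θ + Real.cos θ)] := by
  ext i j
  fin_cases i <;> fin_cases j <;> simp [iwasawaMatrix] <;> ring

theorem det_iwasawaMatrix {θ ρ ν : ℝ} (hρ : 0 < ρ) : (iwasawaMatrix θ ρ ν).det = 1 := by
  have h : √ρ ≠ 0 := (Real.sqrt_pos.2 hρ).ne'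
  simp only [iwasawaMatrix, Matrix.det_mul, Matrix.det_fin_two_of]
  have h1 : √ρ * (1 / √ρ) = 1 := mul_one_div_cancel h
  linear_combination (Real.cos θ ^ 2 + Real.sin θ ^ 2) * h1 + Real.cos_sq_add_sin_sq θ

/-- The right Iwasawa decomposition `φ_R : ℝ × (0, ∞) × ℝ → G`, `φ_R (0, 1, 0) = I`. -/
def phiR (θ ρ ν : ℝ) (hρ : 0 < ρ) : G :=
  ⟨(⟨iwasawaMatrix θ ρ ν, det_iwasawaMatrix hρ⟩, θ), by
    have h : √(ρ * Real.cos θ ^ 2 + ρ * Real.sin θ ^ 2) = √ρ := by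
      congr 1; rw [← mul_add, Real.cos_sq_add_sin_sq, mul_one]
    simp [iwasawaMatrix_eq, mul_pow, Real.sq_sqrt hρ.le, h]⟩

theorem rowSq_phiR (θ ρ ν : ℝ) (hρ : 0 < ρ) : rowSq (phiR θ ρ ν hρ).proj = ρ := by
  simp only [rowSq, phiR, G.proj, iwasawaMatrix_eq]
  simp [mul_pow, Real.sq_sqrt hρ.le]
  rw [← mul_add, Real.cos_sq_add_sin_sq, mul_one]

theorem rowDot_phiR (θ ρ ν : ℝ) (hρ : 0 < ρ) : rowDot (phiR θ ρ ν hρ).proj = ν / 2 := by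
  have h : √ρ ≠ 0 := (Real.sqrt_pos.2 hρ).ne'
  simp only [rowDot, phiR, G.proj, iwasawaMatrix_eq]
  simp
  field_simp
  linear_combination ν * Real.cos_sq_add_sin_sq θ

theorem phiR_coords (g : G) :
    phiR g.angle (rowSq g.proj) (2 * rowDot g.proj) (rowSq_pos _) = g := by
  refine G.ext' ?_ rfl
  have hs := Real.sqrt_pos.2 (rowSq_pos g.proj)
  have hd := det_eq g.proj
  have hq := Real.sq_sqrt (rowSq_pos g.proj).le
  have hc := Real.cos_sq_add_sin_sq g.angle
  have h0 := g.row0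
  have h1 := g.row1
  set s := √(rowSq g.proj) with hsdef
  apply Subtype.ext
  change iwasawaMatrix _ _ _ = (g.proj : Matrix (Fin 2) (Fin 2) ℝ)
  rw [iwasawaMatrix_eq, ← hsdef]
  ext i j
  fin_cases i <;> fin_cases j
  · simpa using h0.symm
  · simpa using h1.symm
  · simp [rowDot]
    rw [h0, h1] at hd ⊢
    field_simp
    linear_combination (Real.sin g.angle) * hd + s * g.proj 1 0 * hc
  · simp [rowDot]
    rw [h0, h1] at hd ⊢
    field_simp
    linear_combination (-Real.cos g.angle) * hd + s * g.proj 1 1 * hc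

/-- `G` is homeomorphic to `ℝ³` by the coordinates `(θ, log ρ, ν)`, where `(θ, ρ, ν)` are the
right Iwasawa coordinates. -/
def coords : G ≃ₜ EuclideanSpace ℝ (Fin 3) where
  toFun g := !₂[g.angle, Real.log (rowSq g.proj), 2 * rowDot g.proj]
  invFun x := phiR (x 0) (Real.exp (x 1)) (x 2) (Real.exp_pos _)
  left_inv g := by
    conv_rhs => rw [← phiR_coords g]
    simp [Real.exp_log (rowSq_pos g.proj)]
  right_inv x := by
    ext i
    fin_cases i
    · rfl
    · simp [rowSq_phiR]
    · simp [rowDot_phiR]; ring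
  continuous_toFun := by
    refine (PiLp.continuous_toLp 2 _).comp (continuous_pi fun i => ?_)
    fin_cases i
    · exact continuous_angle
    · exact (continuous_rowSq.comp continuous_proj).log fun g => (rowSq_pos g.proj).ne'
    · exact continuous_const.mul (continuous_rowDot.comp continuous_proj)
  continuous_invFun := by
    refine Continuous.subtype_mk (Continuous.prodMk (Continuous.subtype_mk ?_ _) ?_) _
    · have h : ∀ x : EuclideanSpace ℝ (Fin 3), √(Real.exp (x 1)) ≠ 0 := fun x =>
        (Real.sqrt_pos.2 (Real.exp_pos _)).ne'
      simp only [iwasawaMatrix_eq]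
      refine continuous_matrix fun i j => ?_
      fin_cases i <;> fin_cases j <;> simp <;> fun_prop (disch := exact h)
    · fun_prop

instance : ContractibleSpace G :=
  coords.contractibleSpace_iff.2 inferInstance

/-- `G` is simply connected. -/
instance : SimplyConnectedSpace G := inferInstance

/-- The smooth structure of the Lie group `G`: the right Iwasawa decomposition is a (global)
diffeomorphism. The coordinates `(θ, log ρ, ν)` are, locally, smooth functions of the entries of
the matrix, and the entries are smooth functions of the coordinates, so that `Π` is a local
diffeomorphism. -/
instance : ChartedSpace (EuclideanSpace ℝ (Fin 3)) G :=
  coords.toOpenPartialHomeomorph.singletonChartedSpace rfl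

instance : IsManifold (𝓡 3) ∞ G :=
  coords.toOpenPartialHomeomorph.isManifold_singleton rfl

/-! ### The projection is a covering map -/

/-- The first row of a matrix as a complex number. -/
def rowC (A : SL2) : ℂ := ⟨A 0 0, A 0 1⟩

theorem continuous_rowC : Continuous rowC := by
  have : rowC = fun A : SL2 => Complex.equivRealProdCLM.symm (A 0 0, A 0 1) := by
    ext A
    apply Complex.ext <;> rfl
  rw [this]
  exact Complex.equivRealProdCLM.symm.continuous.comp
    ((continuous_entry 0 0).prodMk (continuous_entry 0 1))

theorem norm_rowC (A : SL2) : ‖rowC A‖ = √(rowSq A) := by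
  rw [← Real.sqrt_sq (norm_nonneg _), Complex.sq_norm, Complex.normSq_apply]
  congr 1
  simp [rowC, rowSq]
  ring

theorem rowC_ne (A : SL2) : rowC A ≠ 0 := by
  rw [← norm_pos_iff, norm_rowC]
  exact Real.sqrt_pos.2 (rowSq_pos A)

theorem G.rowC_eq (g : G) : rowC g.proj = ‖rowC g.proj‖ * Complex.exp (g.angle * Complex.I) := by
  rw [norm_rowC]
  apply Complex.ext
  · simpa [rowC, Complex.exp_ofReal_mul_I_re] using g.row0
  · simpa [rowC, Complex.exp_ofReal_mul_I_im] using g.row1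

/-- A point of `G` from a matrix and an argument of its first row. -/
def G.mk (A : SL2) (θ : ℝ) (h : rowC A = ‖rowC A‖ * Complex.exp (θ * Complex.I)) : G :=
  ⟨(A, θ), by
    rw [norm_rowC] at h
    have hre : A 0 0 = √(rowSq A) * Real.cos θ := by
      simpa [rowC, Complex.exp_ofReal_mul_I_re] using congrArg Complex.re h
    have him : A 0 1 = √(rowSq A) * Real.sin θ := by
      simpa [rowC, Complex.exp_ofReal_mul_I_im] using congrArg Complex.im h
    exact ⟨hre, him⟩⟩

theorem exp_angle_eq_iff (θ α : ℝ) :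
    Complex.exp (θ * Complex.I) = Complex.exp (α * Complex.I) ↔
      ∃ n : ℤ, θ = α + n * (2 * Real.pi) := by
  rw [Complex.exp_eq_exp_iff_exists_int]
  refine exists_congr fun n => ⟨fun h => ?_, fun h => ?_⟩
  · have := congrArg Complex.im h
    simpa using this
  · rw [h]; push_cast; ring

theorem G.angle_eq_of_arg (g : G) {α : ℝ}
    (h : rowC g.proj = ‖rowC g.proj‖ * Complex.exp (α * Complex.I)) :
    ∃ n : ℤ, g.angle = α + n * (2 * Real.pi) := by
  rw [← exp_angle_eq_iff]
  have h0 : (‖rowC g.proj‖ : ℂ) ≠ 0 := by simpa using rowC_ne g.proj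
  exact mul_left_cancel₀ h0 (g.rowC_eq.symm.trans h)

/-- A continuous local choice of the argument of the first row. -/
def localArg (A₀ A : SL2) : ℝ :=
  (rowC A₀).arg + (rowC A * (starRingEnd ℂ) (rowC A₀)).arg

theorem localArg_spec (A₀ A : SL2) :
    rowC A = ‖rowC A‖ * Complex.exp (localArg A₀ A * Complex.I) := by
  have h0 : (‖rowC A₀‖ : ℂ) ≠ 0 := by simpa using rowC_ne A₀
  have h1 := Complex.norm_mul_exp_arg_mul_I (rowC A₀)
  have h2 := Complex.norm_mul_exp_arg_mul_I (rowC A * (starRingEnd ℂ) (rowC A₀))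
  have h3 := Complex.mul_conj' (rowC A₀)
  rw [norm_mul, RCLike.norm_conj] at h2
  push_cast at h2
  apply mul_right_cancel₀ (pow_ne_zero 2 h0)
  calc rowC A * (‖rowC A₀‖ : ℂ) ^ 2 = (rowC A * (starRingEnd ℂ) (rowC A₀)) * rowC A₀ := by
        rw [← h3]; ring
    _ = (‖rowC A‖ * ‖rowC A₀‖ *
          Complex.exp ((rowC A * (starRingEnd ℂ) (rowC A₀)).arg * Complex.I)) *
          (‖rowC A₀‖ * Complex.exp ((rowC A₀).arg * Complex.I)) := by rw [h1, h2]
    _ = _ := by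
        rw [localArg]
        push_cast
        rw [add_mul, Complex.exp_add]
        ring

/-- The projection `Π : G → SL(2, ℝ)` is a covering map. -/
theorem isCoveringMap_proj : IsCoveringMap G.proj := by
  intro A₀
  have hpi : (2 * Real.pi) ≠ 0 := by positivity
  set U : Set SL2 := {A | rowC A * (starRingEnd ℂ) (rowC A₀) ∈ Complex.slitPlane} with hU
  have hcont : Continuous fun A => rowC A * (starRingEnd ℂ) (rowC A₀) :=
    continuous_rowC.mul continuous_const
  have hUo : IsOpen U := Complex.isOpen_slitPlane.preimage hcont
  have harg : ContinuousOn (localArg A₀) U := fun A hA =>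
    (continuousAt_const.add
      (ContinuousAt.comp (f := fun A => rowC A * (starRingEnd ℂ) (rowC A₀))
        (Complex.continuousAt_arg hA) hcont.continuousAt)).continuousWithinAt
  choose N hN using fun g : G => g.angle_eq_of_arg (localArg_spec A₀ g.proj)
  refine IsEvenlyCovered.to_isEvenlyCovered_preimage (I := ℤ)
    ⟨inferInstance, U, ?_, hUo, hUo.preimage continuous_proj,
      { toFun := fun g => (⟨g.1.proj, g.2⟩, N g.1)
        invFun := fun p => ⟨G.mk p.1.1 (localArg A₀ p.1.1 + p.2 * (2 * Real.pi)) ?_, p.1.2⟩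
        left_inv := ?_
        right_inv := ?_
        continuous_toFun := ?_
        continuous_invFun := ?_ }, fun _ => rfl⟩
  · have : rowC A₀ * (starRingEnd ℂ) (rowC A₀) = ((‖rowC A₀‖ ^ 2 : ℝ) : ℂ) := by
      rw [Complex.mul_conj']; push_cast; rfl
    rw [hU, mem_ofPred_eq, this, Complex.ofReal_mem_slitPlane]
    exact pow_pos (norm_pos_iff.2 (rowC_ne A₀)) 2
  · rw [(exp_angle_eq_iff _ _).2 ⟨p.2, rfl⟩]
    exact localArg_spec _ _
  · intro g
    exact Subtype.ext (G.ext' rfl (hN g.1).symm)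
  · intro p
    refine Prod.ext rfl ?_
    have h := hN (G.mk p.1.1 (localArg A₀ p.1.1 + p.2 * (2 * Real.pi)) (by
      rw [(exp_angle_eq_iff _ _).2 ⟨p.2, rfl⟩]
      exact localArg_spec _ _))
    have h' : (p.2 : ℝ) * (2 * Real.pi) = N _ * (2 * Real.pi) := add_left_cancel h
    exact_mod_cast (mul_right_cancel₀ hpi h').symm
  · refine Continuous.prodMk (continuous_proj.comp continuous_subtype_val |>.subtype_mk _) ?_
    rw [Int.isClosedEmbedding_coe_real.isInducing.continuous_iff]
    have : ((↑) : ℤ → ℝ) ∘ (fun g : G.proj ⁻¹' U => N g.1) =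
        fun g => (g.1.angle - localArg A₀ g.1.proj) / (2 * Real.pi) := by
      funext g
      rw [eq_div_iff hpi, hN g.1]
      simp
    rw [this]
    refine ((continuous_angle.comp continuous_subtype_val).sub ?_).div_const _
    exact harg.comp_continuous (continuous_proj.comp continuous_subtype_val) fun g => g.2
  · refine Continuous.subtype_mk (Continuous.subtype_mk (Continuous.prodMk ?_ ?_) _) _
    · exact continuous_subtype_val.comp continuous_fst
    · refine Continuous.add ?_ ?_
      · exact harg.comp_continuous (continuous_subtype_val.comp continuous_fst) fun p => p.1.2
      · exact (Int.isClosedEmbedding_coe_real.continuous.comp continuous_snd).mul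
          continuous_const

/-! ### The left Iwasawa decomposition and the half-space `G₀` -/

/-- The matrix `(cos θ, sin θ; -sin θ, cos θ) * diag(√ρ, 1/√ρ) * (1, 0; ν/2, 1)`. -/
def leftIwasawaMatrix (θ ρ ν : ℝ) : Matrix (Fin 2) (Fin 2) ℝ :=
  !![Real.cos θ, Real.sin θ; -Real.sin θ, Real.cos θ] * !![√ρ, 0; 0, 1 / √ρ] *
    !![1, 0; ν / 2, 1]

theorem leftIwasawaMatrix_eq (θ ρ ν : ℝ) : leftIwasawaMatrix θ ρ ν =
    !![Real.cos θ * √ρ + Real.sin θ * (1 / √ρ) * (ν / 2), Real.sin θ * (1 / √ρ);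
      -Real.sin θ * √ρ + Real.cos θ * (1 / √ρ) * (ν / 2), Real.cos θ * (1 / √ρ)] := by
  ext i j
  fin_cases i <;> fin_cases j <;> simp [leftIwasawaMatrix]

theorem det_leftIwasawaMatrix {θ ρ ν : ℝ} (hρ : 0 < ρ) :
    (leftIwasawaMatrix θ ρ ν).det = 1 := by
  have h : √ρ ≠ 0 := (Real.sqrt_pos.2 hρ).ne'
  have h1 : √ρ * (1 / √ρ) = 1 := mul_one_div_cancel h
  simp only [leftIwasawaMatrix, Matrix.det_mul, Matrix.det_fin_two_of]
  linear_combination (Real.cos θ ^ 2 + Real.sin θ ^ 2) * h1 + Real.cos_sq_add_sin_sq θ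

/-- `leftIwasawaMatrix` as an element of `SL(2, ℝ)`. -/
def leftSL (θ ρ ν : ℝ) (hρ : 0 < ρ) : SL2 := ⟨leftIwasawaMatrix θ ρ ν, det_leftIwasawaMatrix hρ⟩

/-- The first row of `leftSL θ ρ ν`, turned by `-θ`. -/
def leftTurn (θ ρ ν : ℝ) (hρ : 0 < ρ) : ℂ :=
  rowC (leftSL θ ρ ν hρ) * Complex.exp ((-θ : ℝ) * Complex.I)

theorem leftTurn_mem (θ ρ ν : ℝ) (hρ : 0 < ρ) : leftTurn θ ρ ν hρ ∈ Complex.slitPlane := by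
  have h := Real.sqrt_pos.2 hρ
  have h' : 0 < 1 / √ρ := by positivity
  have hc := Real.cos_sq_add_sin_sq θ
  have hre : (leftTurn θ ρ ν hρ).re =
      (Real.cos θ * √ρ + Real.sin θ * (1 / √ρ) * (ν / 2)) * Real.cos θ +
        Real.sin θ * (1 / √ρ) * Real.sin θ := by
    simp [leftTurn, leftSL, rowC, leftIwasawaMatrix_eq, Complex.exp_re, Complex.exp_im]
  have him : (leftTurn θ ρ ν hρ).im =
      Real.sin θ * (Real.cos θ * (1 / √ρ) -
        (Real.cos θ * √ρ + Real.sin θ * (1 / √ρ) * (ν / 2))) := by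
    simp [leftTurn, leftSL, rowC, leftIwasawaMatrix_eq, Complex.exp_re, Complex.exp_im]
    ring
  rw [Complex.mem_slitPlane_iff]
  by_cases hi : (leftTurn θ ρ ν hρ).im = 0
  · left
    rw [him] at hi
    rw [hre]
    rcases mul_eq_zero.1 hi with hs | hs
    · rw [hs] at hc ⊢
      have : Real.cos θ ^ 2 = 1 := by linarith
      calc (0 : ℝ) < √ρ * Real.cos θ ^ 2 := by rw [this]; linarith
        _ = _ := by ring
    · rw [← sub_eq_zero.1 hs]
      calc (0 : ℝ) < (1 / √ρ) * (Real.cos θ ^ 2 + Real.sin θ ^ 2) := by rw [hc]; linarith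
        _ = _ := by ring
  · exact Or.inr hi

/-- The left Iwasawa decomposition `φ_L : ℝ × (0, ∞) × ℝ → G`: the continuous lift of
`leftSL` with `φ_L (0, 1, 0) = I`; see `continuous_phiL` and `phiL_base`. -/
def phiL (θ ρ ν : ℝ) (hρ : 0 < ρ) : G :=
  G.mk (leftSL θ ρ ν hρ) (θ + (leftTurn θ ρ ν hρ).arg) (by
    have h2 := Complex.norm_mul_exp_arg_mul_I (leftTurn θ ρ ν hρ)
    have h1 : ‖leftTurn θ ρ ν hρ‖ = ‖rowC (leftSL θ ρ ν hρ)‖ := by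
      rw [leftTurn, norm_mul, Complex.norm_exp_ofReal_mul_I, mul_one]
    have h3 : Complex.exp (θ * Complex.I) * Complex.exp ((-θ : ℝ) * Complex.I) = 1 := by
      rw [← Complex.exp_add]; simp
    rw [h1] at h2
    push_cast
    rw [add_mul, Complex.exp_add, mul_left_comm, h2, leftTurn, mul_left_comm, h3, mul_one])

theorem proj_phiL (θ ρ ν : ℝ) (hρ : 0 < ρ) :
    ((phiL θ ρ ν hρ).proj : Matrix (Fin 2) (Fin 2) ℝ) = leftIwasawaMatrix θ ρ ν := rfl

theorem phiL_base : phiL 0 1 0 one_pos = 1 := by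
  have h : leftSL 0 1 0 one_pos = 1 := by
    apply Subtype.ext
    change leftIwasawaMatrix 0 1 0 = 1
    rw [leftIwasawaMatrix_eq]
    ext i j
    fin_cases i <;> fin_cases j <;> simp
  refine G.ext' h ?_
  change (0 : ℝ) + (leftTurn 0 1 0 one_pos).arg = 0
  have : leftTurn 0 1 0 one_pos = 1 := by
    rw [leftTurn, h]
    apply Complex.ext <;> simp [rowC]
  rw [this]
  simp

theorem continuous_phiL :
    Continuous fun x : ℝ × Ioi (0 : ℝ) × ℝ => phiL x.1 x.2.1 x.2.2 x.2.1.2 := by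
  have hS : Continuous fun x : ℝ × Ioi (0 : ℝ) × ℝ => leftSL x.1 x.2.1 x.2.2 x.2.1.2 := by
    refine Continuous.subtype_mk ?_ _
    have h : ∀ x : ℝ × Ioi (0 : ℝ) × ℝ, √(x.2.1 : ℝ) ≠ 0 := fun x =>
      (Real.sqrt_pos.2 x.2.1.2).ne'
    simp only [leftIwasawaMatrix_eq]
    refine continuous_matrix fun i j => ?_
    fin_cases i <;> fin_cases j <;> simp <;> fun_prop (disch := exact h)
  refine Continuous.subtype_mk (Continuous.prodMk hS ?_) _
  refine continuous_fst.add (continuous_iff_continuousAt.2 fun x => ?_)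
  refine ContinuousAt.comp (f := fun x : ℝ × Ioi (0 : ℝ) × ℝ => leftTurn x.1 x.2.1 x.2.2 x.2.1.2)
    (Complex.continuousAt_arg (leftTurn_mem _ _ _ _)) ?_
  refine Continuous.continuousAt ((continuous_rowC.comp hS).mul ?_)
  fun_prop

theorem angle_phiL_pos_iff (θ ρ ν : ℝ) (hρ : 0 < ρ) :
    0 < (phiL θ ρ ν hρ).angle ↔ 0 < θ := by
  have hδ : (phiL θ ρ ν hρ).angle = θ + (leftTurn θ ρ ν hρ).arg := rfl
  have h1 := Complex.neg_pi_lt_arg (leftTurn θ ρ ν hρ)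
  have h2 : (leftTurn θ ρ ν hρ).arg < Real.pi :=
    lt_of_le_of_ne (Complex.arg_le_pi _) (Complex.mem_slitPlane_iff_arg.1
      (leftTurn_mem θ ρ ν hρ)).1
  have h3 := (phiL θ ρ ν hρ).row1
  have h4 : (phiL θ ρ ν hρ).proj 0 1 = Real.sin θ * (1 / √ρ) := by
    change leftIwasawaMatrix θ ρ ν 0 1 = _
    simp [leftIwasawaMatrix_eq]
  rw [h4] at h3
  have hs := Real.sqrt_pos.2 (rowSq_pos (phiL θ ρ ν hρ).proj)
  have hr : 0 < 1 / √ρ := by have := Real.sqrt_pos.2 hρ; positivity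
  set a := (phiL θ ρ ν hρ).angle
  constructor
  · intro ha
    by_contra hθ
    push Not at hθ
    have hsa := Real.sin_pos_of_pos_of_lt_pi ha (by linarith)
    have hst := Real.sin_nonpos_of_nonpos_of_neg_pi_le hθ (by linarith)
    nlinarith [mul_pos hs hsa]
  · intro hθ
    by_contra ha
    push Not at ha
    have hst := Real.sin_pos_of_pos_of_lt_pi hθ (by linarith)
    have hsa := Real.sin_nonpos_of_nonpos_of_neg_pi_le ha (by linarith)
    nlinarith [mul_pos hst hr]

theorem exists_phiL (g : G) : ∃ θ ρ ν, ∃ hρ : 0 < ρ, phiL θ ρ ν hρ = g := by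
  set w : ℂ := ⟨g.proj 1 1, g.proj 0 1⟩ with hw
  have hd := det_eq g.proj
  have hw0 : w ≠ 0 := by
    intro h
    have h1 : g.proj 1 1 = 0 := congrArg Complex.re h
    have h2 : g.proj 0 1 = 0 := congrArg Complex.im h
    simp [h1, h2] at hd
  have hn : 0 < ‖w‖ := norm_pos_iff.2 hw0
  have hexp := Complex.norm_mul_exp_arg_mul_I w
  have hre : g.proj 1 1 = ‖w‖ * Real.cos w.arg := by
    simp [hw]
  have him : g.proj 0 1 = ‖w‖ * Real.sin w.arg := by
    simp [hw]
  have hρ : 0 < (‖w‖⁻¹) ^ 2 := by positivity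
  have hsq : √((‖w‖⁻¹) ^ 2) = ‖w‖⁻¹ := Real.sqrt_sq (by positivity)
  set ν := 2 * ‖w‖⁻¹ * (Real.sin w.arg * g.proj 0 0 + Real.cos w.arg * g.proj 1 0) with hν
  have hc := Real.cos_sq_add_sin_sq w.arg
  have hwi : ‖w‖⁻¹ = g.proj 0 0 * Real.cos w.arg - g.proj 1 0 * Real.sin w.arg := by
    rw [hre, him] at hd
    field_simp
    linear_combination -hd
  have key : ∀ n : ℤ, leftSL (w.arg + n * (2 * Real.pi)) ((‖w‖⁻¹) ^ 2) ν hρ = g.proj := by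
    intro n
    apply Subtype.ext
    change leftIwasawaMatrix _ _ _ = (g.proj : Matrix (Fin 2) (Fin 2) ℝ)
    have h1 : ‖w‖ * (ν / 2) = Real.sin w.arg * g.proj 0 0 + Real.cos w.arg * g.proj 1 0 := by
      rw [hν]; field_simp
    rw [leftIwasawaMatrix_eq, hsq, Real.cos_add_int_mul_two_pi, Real.sin_add_int_mul_two_pi,
      one_div, inv_inv, mul_assoc, mul_assoc, h1, hwi]
    ext i j
    fin_cases i <;> fin_cases j
    · simp
      linear_combination g.proj 0 0 * hc
    · simpa [mul_comm] using him.symm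
    · simp
      linear_combination g.proj 1 0 * hc
    · simpa [mul_comm] using hre.symm
  have hturn : ∀ n : ℤ, leftTurn (w.arg + n * (2 * Real.pi)) ((‖w‖⁻¹) ^ 2) ν hρ =
      rowC g.proj * Complex.exp ((-w.arg : ℝ) * Complex.I) := by
    intro n
    rw [leftTurn, key n]
    congr 1
    rw [exp_angle_eq_iff]
    exact ⟨-n, by push_cast; ring⟩
  have h0 := (phiL (w.arg + (0 : ℤ) * (2 * Real.pi)) ((‖w‖⁻¹) ^ 2) ν hρ).rowC_eq
  have hp : (phiL (w.arg + (0 : ℤ) * (2 * Real.pi)) ((‖w‖⁻¹) ^ 2) ν hρ).proj = g.proj := key 0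
  rw [hp] at h0
  obtain ⟨n, hn⟩ := g.angle_eq_of_arg h0
  refine ⟨w.arg + n * (2 * Real.pi), (‖w‖⁻¹) ^ 2, ν, hρ, G.ext' (key n) ?_⟩
  rw [hn]
  change w.arg + n * (2 * Real.pi) + (leftTurn _ _ _ _).arg =
    w.arg + (0 : ℤ) * (2 * Real.pi) + (leftTurn _ _ _ _).arg + _
  rw [hturn, hturn]
  push_cast
  ring

/-- The set `G₀ = φ_L ((0, ∞) × (0, ∞) × ℝ)`. -/
def G0set : Set G := {g | ∃ θ ρ ν, ∃ hρ : 0 < ρ, 0 < θ ∧ phiL θ ρ ν hρ = g}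

theorem mem_G0set_iff (g : G) : g ∈ G0set ↔ 0 < g.angle := by
  constructor
  · rintro ⟨θ, ρ, ν, hρ, hθ, rfl⟩
    exact (angle_phiL_pos_iff θ ρ ν hρ).2 hθ
  · intro hg
    obtain ⟨θ, ρ, ν, hρ, rfl⟩ := exists_phiL g
    exact ⟨θ, ρ, ν, hρ, (angle_phiL_pos_iff θ ρ ν hρ).1 hg, rfl⟩

/-- `G₀` as an open subset (hence an open submanifold) of `G`. -/
def G0 : TopologicalSpace.Opens G where
  carrier := G0set
  is_open' := by
    have : G0set = G.angle ⁻¹' Ioi 0 := Set.ext mem_G0set_iff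
    rw [this]
    exact isOpen_Ioi.preimage continuous_angle

/-! ### The Sobolev spaces `H^p([0, 2π])` and `H^p(S¹)` -/

/-- The Hilbert space `H⁰([0, 2π]) = L²([0, 2π])` of real functions. -/
abbrev L2 : Type := Lp ℝ 2 (volume.restrict (Icc 0 (2 * Real.pi)))

/-- `u` is an absolutely continuous representative on `[0, 2π]` of `f`, with derivative `g`. -/
def IsACRep (f g : L2) (u : ℝ → ℝ) : Prop :=
  (∀ᵐ t ∂volume.restrict (Icc 0 (2 * Real.pi)), f t = u t) ∧
    ∀ t ∈ Icc 0 (2 * Real.pi), u t = u 0 + ∫ s in (0 : ℝ)..t, g s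

theorem L2.intervalIntegrable (g : L2) {t : ℝ} (ht : t ∈ Icc 0 (2 * Real.pi)) :
    IntervalIntegrable g volume 0 t := by
  have h : Integrable g (volume.restrict (Icc 0 (2 * Real.pi))) :=
    (Lp.memLp g).integrable (by norm_num)
  rw [intervalIntegrable_iff_integrableOn_Ioc_of_le ht.1]
  exact IntegrableOn.mono_set h (Ioc_subset_Icc_self.trans (Icc_subset_Icc_right ht.2))

theorem L2.integral_congr {g : L2} {k : ℝ → ℝ}
    (h : ∀ᵐ t ∂volume.restrict (Icc 0 (2 * Real.pi)), g t = k t)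
    {t : ℝ} (ht : t ∈ Icc 0 (2 * Real.pi)) :
    ∫ s in (0 : ℝ)..t, g s = ∫ s in (0 : ℝ)..t, k s := by
  rw [intervalIntegral.integral_of_le ht.1, intervalIntegral.integral_of_le ht.1]
  exact MeasureTheory.integral_congr_ae (ae_restrict_of_ae_restrict_of_subset
    (Ioc_subset_Icc_self.trans (Icc_subset_Icc_right ht.2)) h)

theorem IsACRep.zero : IsACRep 0 0 0 := by
  refine ⟨Lp.coeFn_zero ℝ 2 _, fun t ht => ?_⟩
  rw [L2.integral_congr (Lp.coeFn_zero ℝ 2 _) ht]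
  simp

theorem IsACRep.add {f g f' g' : L2} {u u' : ℝ → ℝ} (h : IsACRep f g u) (h' : IsACRep f' g' u') :
    IsACRep (f + f') (g + g') (u + u') := by
  refine ⟨?_, fun t ht => ?_⟩
  · filter_upwards [Lp.coeFn_add f f', h.1, h'.1] with t h1 h2 h3
    rw [h1, Pi.add_apply, Pi.add_apply, h2, h3]
  · rw [L2.integral_congr (Lp.coeFn_add g g') ht]
    simp only [Pi.add_apply]
    rw [intervalIntegral.integral_add (g.intervalIntegrable ht) (g'.intervalIntegrable ht),
      h.2 t ht, h'.2 t ht]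
    ring

theorem IsACRep.smul {f g : L2} {u : ℝ → ℝ} (c : ℝ) (h : IsACRep f g u) :
    IsACRep (c • f) (c • g) (c • u) := by
  refine ⟨?_, fun t ht => ?_⟩
  · filter_upwards [Lp.coeFn_smul c f, h.1] with t h1 h2
    rw [h1, Pi.smul_apply, Pi.smul_apply, h2]
  · rw [L2.integral_congr (Lp.coeFn_smul c g) ht]
    simp only [Pi.smul_apply, smul_eq_mul]
    rw [intervalIntegral.integral_const_mul, h.2 t ht]
    ring

/-- The Sobolev space `H^p([0, 2π])`, as a subspace of `(L²)^{p+1}` (so with its usual scalar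
product): an element is a function `f 0`, together with its derivatives `f 1, …, f p` in `L²`,
where each `f j`, `j < p`, is absolutely continuous with derivative `f (j + 1)`. -/
def sobolevInterval (p : ℕ) : Submodule ℝ (PiLp 2 fun _ : Fin (p + 1) => L2) where
  carrier := {f | ∀ j : Fin p, ∃ u : ℝ → ℝ, IsACRep (f j.castSucc) (f j.succ) u}
  zero_mem' := fun _ => ⟨0, IsACRep.zero⟩
  add_mem' := fun hf hg j => by
    obtain ⟨u, hu⟩ := hf j
    obtain ⟨v, hv⟩ := hg j
    exact ⟨u + v, hu.add hv⟩
  smul_mem' := fun c f hf j => by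
    obtain ⟨u, hu⟩ := hf j
    exact ⟨c • u, hu.smul c⟩

/-- The periodic Sobolev space `H^p(S¹)`: the functions of `H^p([0, 2π])` whose derivatives of
order `j < p` take the same value at `0` and at `2π`. -/
def sobolevCircle (p : ℕ) : Submodule ℝ (PiLp 2 fun _ : Fin (p + 1) => L2) where
  carrier := {f | ∀ j : Fin p, ∃ u : ℝ → ℝ,
    IsACRep (f j.castSucc) (f j.succ) u ∧ u 0 = u (2 * Real.pi)}
  zero_mem' := fun _ => ⟨0, IsACRep.zero, rfl⟩
  add_mem' := fun hf hg j => by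
    obtain ⟨u, hu, hu'⟩ := hf j
    obtain ⟨v, hv, hv'⟩ := hg j
    exact ⟨u + v, hu.add hv, by simp [hu', hv']⟩
  smul_mem' := fun c f hf j => by
    obtain ⟨u, hu, hu'⟩ := hf j
    exact ⟨c • u, hu.smul c, by simp [hu']⟩

/-! ### The monodromy map -/

/-- `Φ` is the fundamental matrix on `[0, 2π]` of `-v'' + q v = 0`, that is, `Φ 0 = 1` and
`Φ' = (0, 1; q, 0) * Φ`, as an absolutely continuous function: its columns are
`(v₁, v₁')` and `(v₂, v₂')`, with `v₁ 0 = 1`, `v₁' 0 = 0`, `v₂ 0 = 0`, `v₂' 0 = 1`. -/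
def IsFundamentalMatrix (q : L2) (Φ : ℝ → Matrix (Fin 2) (Fin 2) ℝ) : Prop :=
  ContinuousOn Φ (Icc 0 (2 * Real.pi)) ∧
    ∀ t ∈ Icc 0 (2 * Real.pi), ∀ j : Fin 2,
      Φ t 0 j = (1 : Matrix (Fin 2) (Fin 2) ℝ) 0 j + ∫ s in (0 : ℝ)..t, Φ s 1 j ∧
      Φ t 1 j = (1 : Matrix (Fin 2) (Fin 2) ℝ) 1 j + ∫ s in (0 : ℝ)..t, q s * Φ s 0 j

/-- `g` is the value at `2π` of a continuous lift to `G`, starting at `I`, of the fundamental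
matrix of the potential `q`. -/
def IsMonodromy (q : L2) (g : G) : Prop :=
  ∃ (Φ : ℝ → Matrix (Fin 2) (Fin 2) ℝ) (L : ℝ → G),
    IsFundamentalMatrix q Φ ∧ ContinuousOn L (Icc 0 (2 * Real.pi)) ∧ L 0 = 1 ∧
      (∀ t ∈ Icc 0 (2 * Real.pi), ((L t).proj : Matrix (Fin 2) (Fin 2) ℝ) = Φ t) ∧
      L (2 * Real.pi) = g

/-- The monodromy map `μ : L²([0, 2π]) → G`: the unique `g` with `IsMonodromy q g`. -/
def monodromy (q : L2) : G := Classical.epsilon (IsMonodromy q)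

/-- The monodromy of a potential in `H^p([0, 2π])`. -/
def monodromyInterval {p : ℕ} (q : sobolevInterval p) : G := monodromy (q.1 0)

/-- The monodromy of a potential in `H^p(S¹)`. -/
def monodromyCircle {p : ℕ} (q : sobolevCircle p) : G := monodromy (q.1 0)

end Monodromy

end

/-! The proof rests on a change of the unknown potential, the Kepler transform. The first row `(x,
y)` of the fundamental matrix is a planar curve with Wronskian 1, so it sweeps area at a constant
rate and its polar angle `θ` satisfies `θ' = 1 / ρ`, where `ρ = x² + y²`. Put `ρ = exp (-r)` and `u
= r''`. Then `r` and `r'` vanish at 0, the solutions are `exp (-r/2) cos θ` and `exp (-r/2) sin θ`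
with `θ' = exp r`, and the equation reads `q = -u/2 + r'²/4 - exp (2r)`. Conversely every `u` in
`L²` is allowed and `q` determines `r = -log ρ`, so `u ↦ q` is a bijection (`kepS_kepT`,
`kepT_kepS`). Its nonlinear part involves only `r` and `r'`, which are smoother than `u`; hence it
is a diffeomorphism of every `H^p` (`exists_equiv_kepTp`).

In right Iwasawa coordinates the monodromy of the potential of `u` is `(∫ exp r, -r(2π), -r'(2π) exp
(-r(2π)))` (`isMonodromy_kepT`). The last two coordinates amount to two linear functionals of `u`.
The first is straightened along one direction `β`, whose double primitive `b` is positive inside the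
interval and vanishes at `2π` together with its derivative: `s ↦ log ∫ exp (r + s b)` is a bijection
of the line with positive derivative. The inverse function theorem makes it a coordinate, and what
remains is a closed subspace of finite codimension, isometric to `H` (`exists_product_equiv`).

For periodic potentials the jumps of `q` must vanish. The jump of order `j` of `q` is `-1/2` times
that of `u`, plus a term that depends only on `r`, `r'` and the derivatives of `u` of order less
than `j` at the end points. This triangular structure allows a composition of shears to make the
conditions linear, without changing `r(2π)`, `r'(2π)` or the affine dependence along `β`
(`exists_periodic_equiv`). The straightening argument then applies on `H^p(S¹)`. -/

noncomputable section

namespace Monodromy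

/-! ### Multiplication and integration between `L²` and the continuous functions. -/

/-- The interval `[0, 2π]`. -/
abbrev II : Set ℝ := Icc 0 (2 * Real.pi)

/-- Lebesgue measure on `[0, 2π]`. -/
abbrev mu : Measure ℝ := volume.restrict II

/-- The Banach algebra of continuous functions on `[0, 2π]`. -/
abbrev CI : Type := C(II, ℝ)

theorem zero_le_two_pi : (0 : ℝ) ≤ 2 * Real.pi := by positivity

/-- The left end point of `[0, 2π]`. -/
def i0 : II := ⟨0, left_mem_Icc.2 zero_le_two_pi⟩

/-- The right end point of `[0, 2π]`. -/
def i1 : II := ⟨2 * Real.pi, right_mem_Icc.2 zero_le_two_pi⟩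

@[simp] theorem coe_i0 : (i0 : ℝ) = 0 := rfl

@[simp] theorem coe_i1 : (i1 : ℝ) = 2 * Real.pi := rfl

/-- The extension of a continuous function on `[0, 2π]` to the line, constant outside. -/
def ext (f : CI) : BoundedContinuousFunction ℝ ℝ :=
  (BoundedContinuousFunction.mkOfCompact f).compContinuous
    ⟨projIcc 0 (2 * Real.pi) zero_le_two_pi, continuous_projIcc⟩

theorem ext_apply (f : CI) (t : ℝ) : ext f t = f (projIcc 0 (2 * Real.pi) zero_le_two_pi t) := rfl

theorem ext_of_mem (f : CI) {t : ℝ} (ht : t ∈ II) : ext f t = f ⟨t, ht⟩ := by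
  rw [ext_apply, projIcc_of_mem _ ht]

@[simp] theorem ext_coe (f : CI) (t : II) : ext f t = f t := ext_of_mem f t.2

theorem continuous_ext (f : CI) : Continuous (ext f) := (ext f).continuous

/-- `ext` as a continuous linear map. -/
def extL : CI →L[ℝ] BoundedContinuousFunction ℝ ℝ :=
  LinearMap.mkContinuous
    { toFun := ext
      map_add' := fun _ _ => rfl
      map_smul' := fun _ _ => rfl } 1 fun f => by
    rw [one_mul]
    exact (BoundedContinuousFunction.norm_le (norm_nonneg _)).2 fun t => f.norm_coe_le_norm _

/-- The embedding of continuous functions in `L²([0, 2π])`. -/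
def J : CI →L[ℝ] L2 := (BoundedContinuousFunction.toLp 2 mu ℝ).comp extL

/-- The embedding of continuous functions in `L^∞([0, 2π])`. -/
def Jtop : CI →L[ℝ] Lp ℝ ⊤ mu := (BoundedContinuousFunction.toLp ⊤ mu ℝ).comp extL

theorem J_coe (f : CI) : J f =ᵐ[mu] ext f := BoundedContinuousFunction.coeFn_toLp 2 mu ℝ (ext f)

theorem Jtop_coe (f : CI) : Jtop f =ᵐ[mu] ext f :=
  BoundedContinuousFunction.coeFn_toLp ⊤ mu ℝ (ext f)

theorem J_eq_iff (f : CI) (g : L2) : J f = g ↔ ∀ᵐ t ∂mu, g t = ext f t := by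
  rw [Lp.ext_iff]
  constructor
  · intro h
    filter_upwards [h, J_coe f] with t h1 h2
    rw [← h1, h2]
  · intro h
    filter_upwards [h, J_coe f] with t h1 h2
    rw [h1, h2]

/-- Multiplication `L² × C → L²`. -/
def M : L2 →L[ℝ] CI →L[ℝ] L2 :=
  ((ContinuousLinearMap.compL ℝ CI (Lp ℝ ⊤ mu) L2).flip Jtop).comp
    ((ContinuousLinearMap.mul ℝ ℝ).holderL mu 2 ⊤ 2)

theorem M_coe (q : L2) (f : CI) : M q f =ᵐ[mu] fun t => q t * ext f t := by
  have h := (ContinuousLinearMap.mul ℝ ℝ).coeFn_holder (r := 2) q (Jtop f)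
  filter_upwards [h, Jtop_coe f] with t h1 h2
  change ((ContinuousLinearMap.mul ℝ ℝ).holder 2 q (Jtop f) : ℝ → ℝ) t = _
  rw [h1, h2]
  rfl

theorem M_J (f g : CI) : M (J f) g = J (f * g) := by
  symm
  rw [J_eq_iff]
  filter_upwards [M_coe (J f) g, J_coe f] with t h1 h2
  rw [h1, h2]
  rfl

theorem M_mul (q : L2) (f g : CI) : M (M q f) g = M q (f * g) := by
  rw [Lp.ext_iff]
  filter_upwards [M_coe (M q f) g, M_coe q f, M_coe q (f * g)] with t h1 h2 h3
  rw [h1, h2, h3, mul_assoc]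
  rfl

@[simp] theorem M_one (q : L2) : M q 1 = q := by
  rw [Lp.ext_iff]
  filter_upwards [M_coe q 1] with t h1
  rw [h1]
  exact mul_one _

theorem integrable_L2 (g : L2) : Integrable g mu := (Lp.memLp g).integrable (by norm_num)

/-- The primitive, vanishing at `0`, of a square integrable function. -/
def prim (g : L2) : CI where
  toFun t := ∫ s in (0 : ℝ)..t, g s
  continuous_toFun := by
    have h := intervalIntegral.continuousOn_primitive_interval (f := g) (μ := volume) (a := 0)
      (b := 2 * Real.pi) (by
        rw [uIcc_of_le zero_le_two_pi]
        exact integrable_L2 g)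
    rw [uIcc_of_le zero_le_two_pi] at h
    exact continuousOn_iff_continuous_domRestrict.1 h

theorem prim_congr {g : L2} {k : ℝ → ℝ} (h : ∀ᵐ t ∂mu, g t = k t) (t : II) :
    prim g t = ∫ s in (0 : ℝ)..t, k s :=
  L2.integral_congr h t.2

/-- Cauchy–Schwarz on `[0, t]`. Since `q` is only square integrable, the running integral of `f²` is
kept instead of a sup norm; iterating such a bound is what produces factorials for the Volterra
operator. -/
theorem abs_prim_M_sq_le (q : L2) (f : CI) (t : II) :
    (prim (M q f) t) ^ 2 ≤ ‖q‖ ^ 2 * ∫ s in (0 : ℝ)..t, ext f s ^ 2 := by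
  have ht := t.2
  have hsub : Ioc 0 (t : ℝ) ⊆ II := Ioc_subset_Icc_self.trans (Icc_subset_Icc_right ht.2)
  set ν := volume.restrict (Ioc 0 (t : ℝ)) with hν
  have hle : ν ≤ mu := Measure.restrict_mono hsub le_rfl
  rw [prim_congr (M_coe q f) t, intervalIntegral.integral_of_le ht.1,
    intervalIntegral.integral_of_le ht.1]
  have hq : MemLp q 2 ν := (Lp.memLp q).mono_measure hle
  have hf : MemLp (ext f) 2 ν :=
    (((ext f).memLp_top (μ := mu)).mono_exponent (p := 2) le_top).mono_measure hle
  have hpq : (2 : ℝ).HolderConjugate 2 := Real.HolderConjugate.two_two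
  have h1 := integral_mul_norm_le_Lp_mul_Lq (μ := ν) (f := q) (g := ext f) hpq
    (by simpa using hq) (by simpa using hf)
  have h2 : |∫ s, q s * ext f s ∂ν| ≤ ∫ s, ‖q s‖ * ‖ext f s‖ ∂ν := by
    refine (norm_integral_le_integral_norm (fun s => q s * ext f s)).trans_eq ?_
    simp only [norm_mul]
  have hA : 0 ≤ ∫ s, q s ^ 2 ∂ν := integral_nonneg fun _ => sq_nonneg _
  have hB : 0 ≤ ∫ s, ext f s ^ 2 ∂ν := integral_nonneg fun _ => sq_nonneg _
  have h3 : (∫ s, q s ^ 2 ∂ν) ≤ ‖q‖ ^ 2 := by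
    have : ‖q‖ ^ 2 = ∫ s, q s ^ 2 ∂mu := by
      rw [← real_inner_self_eq_norm_sq (F := L2), MeasureTheory.L2.inner_def (𝕜 := ℝ)]
      simp [sq]
    rw [this]
    exact integral_mono_measure hle (Filter.Eventually.of_forall fun _ => sq_nonneg _)
      (Lp.memLp q).integrable_sq
  simp only [Real.norm_eq_abs, Real.rpow_two, sq_abs, ← Real.sqrt_eq_rpow] at h1
  simp only [Real.norm_eq_abs] at h2
  calc (∫ s, q s * ext f s ∂ν) ^ 2 = |∫ s, q s * ext f s ∂ν| ^ 2 := (sq_abs _).symm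
    _ ≤ (√(∫ s, q s ^ 2 ∂ν) * √(∫ s, ext f s ^ 2 ∂ν)) ^ 2 := by gcongr; exact h2.trans h1
    _ = (∫ s, q s ^ 2 ∂ν) * ∫ s, ext f s ^ 2 ∂ν := by
      rw [mul_pow, Real.sq_sqrt hA, Real.sq_sqrt hB]
    _ ≤ _ := by gcongr

theorem abs_prim_le (g : L2) (t : II) : |prim g t| ≤ √(2 * Real.pi) * ‖g‖ := by
  have h := abs_prim_M_sq_le g 1 t
  rw [M_one] at h
  have h1 : (∫ s in (0 : ℝ)..t, ext 1 s ^ 2) = t := by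
    simp [ext_apply]
  rw [h1] at h
  refine abs_le_of_sq_le_sq ?_ (by positivity)
  rw [mul_pow, Real.sq_sqrt zero_le_two_pi, mul_comm]
  exact h.trans (by gcongr; exact t.2.2)

/-- The Volterra operator `L² → C`. -/
def V : L2 →L[ℝ] CI :=
  LinearMap.mkContinuous
    { toFun := prim
      map_add' := fun f g => by
        ext t
        rw [prim_congr (Lp.coeFn_add f g)]
        exact intervalIntegral.integral_add (f.intervalIntegrable t.2) (g.intervalIntegrable t.2)
      map_smul' := fun c f => by
        ext t
        rw [prim_congr (Lp.coeFn_smul c f)]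
        exact intervalIntegral.integral_const_mul _ _ } (√(2 * Real.pi)) fun g => by
    exact (ContinuousMap.norm_le _ (by positivity)).2 fun t => abs_prim_le g t

theorem V_apply (g : L2) (t : II) : V g t = ∫ s in (0 : ℝ)..t, g s := rfl

@[simp] theorem V_zero_left (g : L2) : V g i0 = 0 := by simp [V_apply]

theorem VJ_apply (f : CI) (t : II) : V (J f) t = ∫ s in (0 : ℝ)..t, ext f s :=
  prim_congr (J_coe f) t

theorem V_M_sq_le (q : L2) (f : CI) (t : II) :
    (V (M q f) t) ^ 2 ≤ ‖q‖ ^ 2 * ∫ s in (0 : ℝ)..t, ext f s ^ 2 := abs_prim_M_sq_le q f t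

/-- The constant functions. -/
def cst : ℝ →L[ℝ] CI := ContinuousLinearMap.toSpanSingleton ℝ (1 : CI)

@[simp] theorem cst_apply (c : ℝ) (t : II) : cst c t = c := by simp [cst]

theorem cst_one : cst 1 = 1 := by ext; simp

/-! ### Calculus of absolutely continuous functions. -/

/-- `f` is absolutely continuous with derivative `g`. -/
def IsAC (f : CI) (g : L2) : Prop := f = cst (f i0) + V g

theorem IsAC.apply {f : CI} {g : L2} (h : IsAC f g) (t : II) : f t = f i0 + V g t := by
  have := DFunLike.congr_fun h t
  simpa using this

theorem isAC_add_V (c : ℝ) (g : L2) : IsAC (cst c + V g) g := by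
  simp [IsAC]

theorem isAC_V (g : L2) : IsAC (V g) g := by
  simp [IsAC]

theorem IsAC.add {f f' : CI} {g g' : L2} (h : IsAC f g) (h' : IsAC f' g') :
    IsAC (f + f') (g + g') := by
  ext t
  rw [ContinuousMap.add_apply, h.apply, h'.apply]
  simp only [map_add, ContinuousMap.add_apply, cst_apply]
  ring

theorem IsAC.smul {f : CI} {g : L2} (c : ℝ) (h : IsAC f g) : IsAC (c • f) (c • g) := by
  ext t
  rw [ContinuousMap.smul_apply, h.apply]
  simp only [map_smul, ContinuousMap.add_apply, cst_apply, ContinuousMap.smul_apply, smul_eq_mul]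
  ring

theorem IsAC.eq_of {f f' : CI} {g : L2} (h : IsAC f g) (h' : IsAC f' g) (h0 : f i0 = f' i0) :
    f = f' := by
  ext t
  rw [h.apply, h'.apply, h0]

theorem isAC_cst (c : ℝ) : IsAC (cst c) 0 := by
  ext t
  simp

theorem absolutelyContinuousOnInterval_primitive (c : ℝ) (g : L2) {t : ℝ} (ht : t ∈ II) :
    AbsolutelyContinuousOnInterval (fun x => c + ∫ s in (0 : ℝ)..x, g s) 0 t :=
  AbsolutelyContinuousOnInterval.add
    (contDiff_const.contDiffOn.absolutelyContinuousOnInterval (f := fun _ => c))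
    ((g.intervalIntegrable ht).absolutelyContinuousOnInterval_intervalIntegral (by simp))

theorem ae_hasDerivAt_primitive (c : ℝ) (g : L2) :
    ∀ᵐ x ∂mu, HasDerivAt (fun x => c + ∫ s in (0 : ℝ)..x, g s) (g x) x := by
  have hint : IntervalIntegrable g volume 0 (2 * Real.pi) :=
    g.intervalIntegrable (right_mem_Icc.2 zero_le_two_pi)
  rw [ae_restrict_iff' measurableSet_Icc]
  filter_upwards [hint.ae_hasDerivAt_integral] with x hx hx'
  exact (hx (by rwa [uIcc_of_le zero_le_two_pi]) 0 (by simp)).const_add c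

theorem IsAC.ext_eq {f : CI} {g : L2} (h : IsAC f g) {t : ℝ} (ht : t ∈ II) :
    ext f t = f i0 + ∫ s in (0 : ℝ)..t, g s := by
  rw [ext_of_mem f ht, h.apply]
  rfl

/-- The product rule for absolutely continuous functions. -/
theorem IsAC.mul {f g : CI} {a b : L2} (hf : IsAC f a) (hg : IsAC g b) :
    IsAC (f * g) (M a g + M b f) := by
  ext t
  -- Integration by parts for absolutely continuous functions. The remaining work identifies its
  -- integrand almost everywhere with `M a g + M b f`.
  have h := (absolutelyContinuousOnInterval_primitive (f i0) a t.2).integral_deriv_mul_eq_sub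
    (absolutelyContinuousOnInterval_primitive (g i0) b t.2)
  have h1 : ∀ᵐ x ∂mu, (M a g + M b f : L2) x =
      deriv (fun x => f i0 + ∫ s in (0 : ℝ)..x, a s) x * (g i0 + ∫ s in (0 : ℝ)..x, b s) +
        (f i0 + ∫ s in (0 : ℝ)..x, a s) * deriv (fun x => g i0 + ∫ s in (0 : ℝ)..x, b s) x := by
    filter_upwards [ae_hasDerivAt_primitive (f i0) a, ae_hasDerivAt_primitive (g i0) b,
      Lp.coeFn_add (M a g) (M b f), M_coe a g, M_coe b f, ae_restrict_mem measurableSet_Icc]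
      with x h1 h2 h3 h4 h5 h6
    rw [h1.deriv, h2.deriv, h3, Pi.add_apply, h4, h5, hf.ext_eq h6, hg.ext_eq h6]
    ring
  have h2 : V (M a g + M b f) t = _ := prim_congr h1 t
  rw [h, ← hf.ext_eq t.2, ← hg.ext_eq t.2] at h2
  rw [ContinuousMap.add_apply, h2]
  simp

/-- By Lebesgue differentiation a primitive recovers its integrand almost everywhere. Hence
derivatives in the sense of `IsAC` are unique. -/
theorem V_injective : Function.Injective V := by
  rw [injective_iff_map_eq_zero]
  intro g hg
  rw [Lp.ext_iff]
  have hne : ∀ᵐ x ∂mu, x ∈ Ioo 0 (2 * Real.pi) := by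
    rw [show mu = volume.restrict (Ioo 0 (2 * Real.pi)) from
      Measure.restrict_congr_set Ioo_ae_eq_Icc.symm]
    exact ae_restrict_mem measurableSet_Ioo
  filter_upwards [ae_hasDerivAt_primitive 0 g, hne, Lp.coeFn_zero ℝ 2 mu] with x h1 h2 h3
  rw [h3, Pi.zero_apply]
  refine h1.unique (HasDerivAt.congr_of_eventuallyEq (hasDerivAt_const x (0 : ℝ)) ?_)
  filter_upwards [isOpen_Ioo.mem_nhds h2] with y hy
  have := DFunLike.congr_fun hg ⟨y, Ioo_subset_Icc_self hy⟩
  rw [V_apply] at this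
  simpa using this

/-- `f` is continuously differentiable with derivative `g`. -/
def IsDeriv (f g : CI) : Prop := IsAC f (J g)

theorem isDeriv_of_hasDerivAt {f g : CI} (F : ℝ → ℝ) (hF : ∀ t : II, F t = f t)
    (hF' : ∀ t : II, HasDerivAt F (g t) t) : IsDeriv f g := by
  ext t
  have h := intervalIntegral.integral_eq_sub_of_hasDerivAt (f := F) (f' := ext g) (a := 0) (b := t)
    (fun x hx => by
      rw [uIcc_of_le t.2.1] at hx
      have hx' : x ∈ II := ⟨hx.1, hx.2.trans t.2.2⟩
      rw [ext_of_mem g hx']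
      exact hF' ⟨x, hx'⟩) ((continuous_ext g).intervalIntegrable _ _)
  have h0 := hF i0
  rw [coe_i0] at h0
  rw [ContinuousMap.add_apply, VJ_apply, h, hF, h0]
  simp

/-- Integrating the constant extension of `g` gives a function on the whole line that has a
two-sided derivative at the end points too, so the ordinary chain rule can be used there. -/
theorem IsDeriv.exists_hasDerivAt {f g : CI} (h : IsDeriv f g) :
    ∃ F : ℝ → ℝ, (∀ t : II, F t = f t) ∧ ∀ t : II, HasDerivAt F (g t) t := by
  refine ⟨fun x => f i0 + ∫ s in (0 : ℝ)..x, ext g s, fun t => ?_, fun t => ?_⟩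
  · rw [h.apply t, VJ_apply]
  · rw [← ext_coe g t]
    exact (intervalIntegral.integral_hasDerivAt_right ((continuous_ext g).intervalIntegrable _ _)
      ((continuous_ext g).stronglyMeasurableAtFilter _ _) (continuous_ext g).continuousAt).const_add _

theorem IsDeriv.add {f f' g g' : CI} (h : IsDeriv f f') (h' : IsDeriv g g') :
    IsDeriv (f + g) (f' + g') := by
  rw [IsDeriv, map_add]
  exact IsAC.add h h'

theorem IsDeriv.smul {f f' : CI} (c : ℝ) (h : IsDeriv f f') : IsDeriv (c • f) (c • f') := by
  rw [IsDeriv, map_smul]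
  exact IsAC.smul c h

theorem IsDeriv.mul {f f' g g' : CI} (h : IsDeriv f f') (h' : IsDeriv g g') :
    IsDeriv (f * g) (f' * g + g' * f) := by
  rw [IsDeriv, map_add, ← M_J, ← M_J]
  exact IsAC.mul h h'

/-- The chain rule. -/
theorem IsDeriv.comp {f f' : CI} (h : IsDeriv f f') {φ φ' : ℝ → ℝ} {k k' : CI}
    (hφ : ∀ t : II, HasDerivAt φ (φ' (f t)) (f t)) (hk : ∀ t, k t = φ (f t))
    (hk' : ∀ t, k' t = φ' (f t) * f' t) : IsDeriv k k' := by
  obtain ⟨F, h1, h2⟩ := h.exists_hasDerivAt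
  refine isDeriv_of_hasDerivAt (φ ∘ F) (fun t => by rw [hk, Function.comp_apply, h1]) fun t => ?_
  rw [hk']
  have h3 := hφ t
  rw [← h1] at h3 ⊢
  exact h3.comp (t : ℝ) (h2 t)

/-- Pointwise exponential. -/
def cexp (f : CI) : CI := ⟨fun t => Real.exp (f t), Real.continuous_exp.comp f.continuous⟩

@[simp] theorem cexp_apply (f : CI) (t : II) : cexp f t = Real.exp (f t) := rfl

theorem IsDeriv.cexp {f f' : CI} (h : IsDeriv f f') : IsDeriv (cexp f) (f' * cexp f) :=
  h.comp (φ := Real.exp) (φ' := Real.exp) (fun _ => Real.hasDerivAt_exp _) (fun _ => rfl)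
    fun _ => mul_comm _ _

/-- Smoothness of pointwise exponentiation, as a map of `C([0, 2π])`, follows from analyticity of
the exponential of a Banach algebra. -/
theorem cexp_eq_exp : cexp = NormedSpace.exp := by
  funext f
  ext t
  have := NormedSpace.map_exp (ContinuousMap.evalAlgHom ℝ ℝ t : CI →ₐ[ℝ] ℝ)
    (continuous_eval_const t) f
  rw [cexp_apply, Real.exp_eq_exp_ℝ]
  exact this.symm

theorem contDiff_cexp {n : WithTop ℕ∞} : ContDiff ℝ n cexp := by
  rw [cexp_eq_exp]
  exact contDiff_iff_contDiffAt.2 fun f => (NormedSpace.exp_analytic f).contDiffAt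

/-- Integration of continuous functions. -/
def VJ : CI →L[ℝ] CI := V.comp J

theorem isDeriv_VJ (f : CI) : IsDeriv (VJ f) f := isAC_V (J f)

@[simp] theorem VJ_zero_left (f : CI) : VJ f i0 = 0 := V_zero_left _

theorem VJ_eq (f : CI) (t : II) : VJ f t = ∫ s in (0 : ℝ)..t, ext f s := VJ_apply f t

/-! ### Solving `v'' = q v` by a Volterra integral equation. -/

/-- The integral operator of the equation `v'' = q v`, as a linear function of `q`. -/
def W : L2 →L[ℝ] CI →L[ℝ] CI := (ContinuousLinearMap.compL ℝ CI L2 CI (VJ.comp V)).comp M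

theorem W_apply (q : L2) (f : CI) : W q f = VJ (V (M q f)) := rfl

theorem W_sq_le (q : L2) (f : CI) (t : II) :
    (W q f t) ^ 2 ≤ (‖J 1‖ ^ 2 * (2 * Real.pi) * ‖q‖ ^ 2) * ∫ s in (0 : ℝ)..t, ext f s ^ 2 := by
  have hint : ∀ {g : CI} {a b : ℝ}, IntervalIntegrable (fun s => ext g s ^ 2) volume a b :=
    fun {g _ _} => ((continuous_ext g).pow 2).intervalIntegrable _ _
  -- The outer integration is also put in the form `V (M · ·)`, with weight 1, so that the same
  -- Cauchy–Schwarz bound serves for both integrations. This is where `‖J 1‖` comes from; the factor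
  -- `2π` is the length of the interval.
  have h0 : W q f = V (M (J 1) (V (M q f))) := by rw [M_J, one_mul, W_apply]; rfl
  rw [h0]
  refine (V_M_sq_le _ _ t).trans ?_
  have h1 : ∀ s ∈ Icc (0 : ℝ) t, ext (V (M q f)) s ^ 2 ≤
      ‖q‖ ^ 2 * ∫ s in (0 : ℝ)..t, ext f s ^ 2 := fun s hs => by
    rw [ext_of_mem _ ⟨hs.1, hs.2.trans t.2.2⟩]
    refine (V_M_sq_le _ _ _).trans ?_
    gcongr
    exact intervalIntegral.integral_mono_interval le_rfl hs.1 hs.2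
      (Filter.Eventually.of_forall fun _ => sq_nonneg _) hint
  have h2 := intervalIntegral.integral_mono_on t.2.1 hint (intervalIntegrable_const) h1
  have h3 : 0 ≤ ∫ s in (0 : ℝ)..t, ext f s ^ 2 :=
    intervalIntegral.integral_nonneg t.2.1 fun _ _ => sq_nonneg _
  rw [intervalIntegral.integral_const, sub_zero, smul_eq_mul] at h2
  calc ‖J 1‖ ^ 2 * _ ≤ ‖J 1‖ ^ 2 * ((t : ℝ) * (‖q‖ ^ 2 * ∫ s in (0 : ℝ)..t, ext f s ^ 2)) := by
        gcongr
    _ ≤ ‖J 1‖ ^ 2 * ((2 * Real.pi) * (‖q‖ ^ 2 * ∫ s in (0 : ℝ)..t, ext f s ^ 2)) := by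
        gcongr
        exact t.2.2
    _ = _ := by ring

/-- The usual Volterra induction: the bound for the square of the `n`-th iterate is a multiple of `t
^ n / n!`, and integrating it gives the next one. -/
theorem W_pow_sq_le (q : L2) (n : ℕ) (f : CI) (t : II) :
    ((W q ^ n) f t) ^ 2 ≤
      ‖f‖ ^ 2 * ((‖J 1‖ ^ 2 * (2 * Real.pi) * ‖q‖ ^ 2) * t) ^ n / n.factorial := by
  set K := ‖J 1‖ ^ 2 * (2 * Real.pi) * ‖q‖ ^ 2 with hK
  have hK0 : 0 ≤ K := by positivity
  induction n generalizing t with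
  | zero =>
    simp only [pow_zero, mul_one, Nat.factorial_zero, Nat.cast_one, div_one]
    rw [← sq_abs]
    gcongr
    exact f.norm_coe_le_norm t
  | succ n ih =>
    rw [pow_succ' (W q), mul_apply_eq_comp]
    refine (W_sq_le _ _ _).trans ?_
    rw [← hK]
    have h := intervalIntegral.integral_mono_on (μ := volume) (a := 0) (b := t)
      (f := fun s => ext ((W q ^ n) f) s ^ 2)
      (g := fun s => (‖f‖ ^ 2 * K ^ n / n.factorial) * s ^ n) t.2.1
      (((continuous_ext _).pow 2).intervalIntegrable _ _)
      ((by fun_prop : Continuous _).intervalIntegrable _ _) fun s hs => by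
        rw [ext_of_mem _ ⟨hs.1, hs.2.trans t.2.2⟩]
        refine (ih _).trans_eq ?_
        rw [mul_pow]
        ring
    rw [intervalIntegral.integral_const_mul, integral_pow] at h
    refine (mul_le_mul_of_nonneg_left h hK0).trans_eq ?_
    rw [Nat.factorial_succ]
    push_cast
    field_simp
    ring

/-- No smallness of `q` is needed: some power of `W q` has norm less than 1. -/
theorem isUnit_one_sub_W (q : L2) : IsUnit (1 - W q) := by
  set K := ‖J 1‖ ^ 2 * (2 * Real.pi) * ‖q‖ ^ 2 with hK
  have hK0 : 0 ≤ K := by positivity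
  have hlim := FloorSemiring.tendsto_pow_div_factorial_atTop (K * (2 * Real.pi))
  -- The bounds concern squares, so `1 / 4` yields `‖W q ^ n‖ ≤ 1 / 2`.
  obtain ⟨n, hn⟩ := (hlim.eventually (gt_mem_nhds (show (0 : ℝ) < 1 / 4 by norm_num))).exists
  have hnorm : ‖W q ^ n‖ ≤ 1 / 2 := by
    refine ContinuousLinearMap.opNorm_le_bound _ (by norm_num) fun f => ?_
    refine (ContinuousMap.norm_le _ (by positivity)).2 fun t => ?_
    rw [Real.norm_eq_abs]
    refine abs_le_of_sq_le_sq ?_ (by positivity)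
    calc ((W q ^ n) f t) ^ 2 ≤ ‖f‖ ^ 2 * (K * t) ^ n / n.factorial := W_pow_sq_le q n f t
      _ ≤ ‖f‖ ^ 2 * (K * (2 * Real.pi)) ^ n / n.factorial := by
        have := t.2.1
        gcongr
        exact t.2.2
      _ = ‖f‖ ^ 2 * ((K * (2 * Real.pi)) ^ n / n.factorial) := by ring
      _ ≤ ‖f‖ ^ 2 * (1 / 4) := by gcongr
      _ = _ := by ring
  have hu : IsUnit (1 - W q ^ n) :=
    isUnit_one_sub_of_norm_lt_one (x := W q ^ n) (hnorm.trans_lt (by norm_num))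
  -- The invertible `1 - W q ^ n` is the product of `1 - W q` and the geometric sum; as these
  -- commute, each factor is invertible.
  have hc : Commute (1 - W q) (∑ i ∈ Finset.range n, W q ^ i) :=
    (Commute.one_left _).sub_left (Commute.sum_right _ _ _ fun i _ => Commute.self_pow _ _)
  rw [← mul_neg_geom_sum] at hu
  exact (hc.isUnit_mul_iff.1 hu).1

/-- The solution `x` of `x = f + W q x`. -/
def sol (q : L2) (f : CI) : CI := Ring.inverse (1 - W q) f

theorem sol_eq (q : L2) (f : CI) : sol q f = f + W q (sol q f) := by
  have h := DFunLike.congr_fun (Ring.mul_inverse_cancel _ (isUnit_one_sub_W q)) f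
  change (1 - W q) (sol q f) = f at h
  rw [sub_apply, one_apply_eq_self] at h
  exact sub_eq_iff_eq_add.1 h

theorem eq_sol {q : L2} {f x : CI} (h : x = f + W q x) : x = sol q f := by
  have h1 := DFunLike.congr_fun (Ring.inverse_mul_cancel _ (isUnit_one_sub_W q)) x
  have h2 : (1 - W q) x = f := by
    rw [sub_apply, one_apply_eq_self]
    exact sub_eq_of_eq_add h
  rw [mul_apply_eq_comp, h2] at h1
  exact h1.symm

/-- Inversion is smooth at the units of a Banach algebra, so the solution of the integral equation
depends smoothly on the potential. -/
theorem contDiff_inverse_one_sub_apply {E F : Type*} [NormedAddCommGroup E] [NormedSpace ℝ E]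
    [CompleteSpace E] [NormedAddCommGroup F] [NormedSpace ℝ F] {n : WithTop ℕ∞}
    (A : F →L[ℝ] E →L[ℝ] E) (hu : ∀ x, IsUnit (1 - A x)) (f : E) :
    ContDiff ℝ n fun x => Ring.inverse (1 - A x) f := by
  have h : ContDiff ℝ n fun x => Ring.inverse (1 - A x) := contDiff_iff_contDiffAt.2 fun x => by
    obtain ⟨u, hu⟩ := hu x
    have h1 := contDiffAt_ringInverse ℝ (n := n) (R := E →L[ℝ] E) u
    rw [hu] at h1
    exact ContDiffAt.comp x h1 (contDiff_const.sub A.contDiff).contDiffAt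
  exact h.clm_apply contDiff_const

theorem contDiff_sol (f : CI) {n : WithTop ℕ∞} : ContDiff ℝ n fun q => sol q f :=
  contDiff_inverse_one_sub_apply W isUnit_one_sub_W f

/-- The functions `x`, `y` solve `x' = y`, `y' = q x` with `x 0 = a`, `y 0 = b`. -/
structure IsSol (q : L2) (a b : ℝ) (x y : CI) : Prop where
  left : x = cst a + VJ y
  right : y = cst b + V (M q x)

theorem IsSol.isDeriv {q : L2} {a b : ℝ} {x y : CI} (h : IsSol q a b x y) : IsDeriv x y := by
  have := isAC_add_V a (J y)
  rwa [show cst a + V (J y) = x from h.left.symm] at this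

theorem IsSol.isAC {q : L2} {a b : ℝ} {x y : CI} (h : IsSol q a b x y) : IsAC y (M q x) := by
  have := isAC_add_V b (M q x)
  rwa [← h.right] at this

theorem IsSol.left_zero {q : L2} {a b : ℝ} {x y : CI} (h : IsSol q a b x y) : x i0 = a := by
  rw [h.left]; simp

theorem IsSol.right_zero {q : L2} {a b : ℝ} {x y : CI} (h : IsSol q a b x y) : y i0 = b := by
  rw [h.right]; simp

theorem IsSol.of {q : L2} {x y : CI} (h : IsDeriv x y) (h' : IsAC y (M q x)) :
    IsSol q (x i0) (y i0) x y := ⟨h, h'⟩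

/-- Eliminating `y` leaves `x = a + b t + W q x`, whose only solution is given by the inverse of `1
- W q`; uniqueness for the system follows. -/
theorem IsSol.eq_sol {q : L2} {a b : ℝ} {x y : CI} (h : IsSol q a b x y) :
    x = sol q (cst a + VJ (cst b)) := by
  apply Monodromy.eq_sol
  conv_lhs => rw [h.left, h.right]
  rw [map_add, W_apply, add_assoc]

theorem IsSol.unique {q : L2} {a b : ℝ} {x y x' y' : CI} (h : IsSol q a b x y)
    (h' : IsSol q a b x' y') : x = x' ∧ y = y' := by
  have hx : x = x' := h.eq_sol.trans h'.eq_sol.symm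
  exact ⟨hx, by rw [h.right, h'.right, hx]⟩

theorem isSol_sol (q : L2) (a b : ℝ) :
    IsSol q a b (sol q (cst a + VJ (cst b)))
      (cst b + V (M q (sol q (cst a + VJ (cst b))))) :=
  ⟨by conv_lhs => rw [sol_eq]
      rw [map_add, W_apply, add_assoc], rfl⟩

/-! ### The Kepler transform on `L²` -/

/-- Pointwise cosine. -/
def ccos (f : CI) : CI := ⟨fun t => Real.cos (f t), Real.continuous_cos.comp f.continuous⟩

/-- Pointwise sine. -/
def csin (f : CI) : CI := ⟨fun t => Real.sin (f t), Real.continuous_sin.comp f.continuous⟩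

@[simp] theorem ccos_apply (f : CI) (t : II) : ccos f t = Real.cos (f t) := rfl

@[simp] theorem csin_apply (f : CI) (t : II) : csin f t = Real.sin (f t) := rfl

theorem IsDeriv.ccos {f f' : CI} (h : IsDeriv f f') : IsDeriv (Monodromy.ccos f) (-(f' * Monodromy.csin f)) :=
  h.comp (φ := Real.cos) (φ' := fun x => -Real.sin x) (fun _ => Real.hasDerivAt_cos _)
    (fun _ => rfl) fun t => by simp; ring

theorem IsDeriv.csin {f f' : CI} (h : IsDeriv f f') : IsDeriv (Monodromy.csin f) (f' * Monodromy.ccos f) :=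
  h.comp (φ := Real.sin) (φ' := Real.cos) (fun _ => Real.hasDerivAt_sin _)
    (fun _ => rfl) fun t => by simp; ring

/-- The nonlinear part of the Kepler transform. -/
def kepK (u : L2) : CI := (4⁻¹ : ℝ) • (V u * V u) - cexp ((2 : ℝ) • VJ (V u))

/-- The Kepler transform: `q = -u / 2 + r' ^ 2 / 4 - exp (2 r)`, where `r'' = u`, `r 0 = 0` and
`r' 0 = 0`. -/
def kepT (u : L2) : L2 := -(2⁻¹ : ℝ) • u + J (kepK u)

/-- The angle `θ`, the primitive of `exp r`. -/
def kepAngle (u : L2) : CI := VJ (cexp (VJ (V u)))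

theorem IsAC.derivative_unique {f : CI} {g g' : L2} (h : IsAC f g) (h' : IsAC f g') : g = g' :=
  V_injective (add_left_cancel (h.symm.trans h'))

/-- A continuous function is the derivative of its primitive at every point, so its class in `L²`
determines it. -/
theorem J_injective : Function.Injective J := by
  rw [injective_iff_map_eq_zero]
  intro f hf
  have h1 : VJ f = 0 := by
    change V (J f) = 0
    rw [hf, map_zero]
  obtain ⟨F, hF, hF'⟩ := (isDeriv_VJ f).exists_hasDerivAt
  ext t
  refine (uniqueDiffOn_Icc (by positivity) t t.2).eq_deriv II (hF' t).hasDerivWithinAt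
    ((hasDerivWithinAt_const (t : ℝ) II (0 : ℝ)).congr_of_mem (fun s hs => ?_) t.2)
  rw [hF ⟨s, hs⟩, h1]
  rfl

theorem IsAC.congr {f f' : CI} {g g' : L2} (h : IsAC f g) (hf : f = f') (hg : g = g') :
    IsAC f' g' := hf ▸ hg ▸ h

theorem IsDeriv.congr {f f' g g' : CI} (h : IsDeriv f g) (hf : f = f') (hg : g = g') :
    IsDeriv f' g' := hf ▸ hg ▸ h

theorem M_add_left (a b : L2) (f : CI) : M (a + b) f = M a f + M b f := by
  rw [map_add]; rfl

theorem M_smul_left (c : ℝ) (a : L2) (f : CI) : M (c • a) f = c • M a f := by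
  rw [map_smul]; rfl

/-- The computation behind the Kepler transform, with `c' = -e exp(r) s`, `s' = e exp(r) c`. The
sign `e = 1` serves for the cosine and `e = -1` for the sine, with the roles of `c` and `s`
exchanged. -/
theorem isSol_kepT_aux (u : L2) {c s : CI} (e : ℝ) (he : e ^ 2 = 1)
    (hc : IsDeriv c (-e • (cexp (VJ (V u)) * s)))
    (hs : IsDeriv s (e • (cexp (VJ (V u)) * c))) :
    IsSol (kepT u) (c i0) (-e * s i0)
    (cexp (-(2⁻¹ : ℝ) • VJ (V u)) * c)
    (-(2⁻¹ : ℝ) • (cexp (-(2⁻¹ : ℝ) • VJ (V u)) * c * V u) -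
      e • (cexp ((2⁻¹ : ℝ) • VJ (V u)) * s)) := by
  set r' := V u with hr'
  set r := VJ r' with hr
  have hdr : IsDeriv r r' := isDeriv_VJ r'
  have hm := (hdr.smul (-(2⁻¹ : ℝ))).cexp
  have hp := (hdr.smul (2⁻¹ : ℝ)).cexp
  have hmp : cexp (-(2⁻¹ : ℝ) • r) * cexp r = cexp ((2⁻¹ : ℝ) • r) := by
    ext t
    simp only [ContinuousMap.mul_apply, cexp_apply, ContinuousMap.smul_apply, smul_eq_mul,
      ← Real.exp_add]
    congr 1
    ring
  have hpp : cexp ((2⁻¹ : ℝ) • r) * cexp r = cexp (-(2⁻¹ : ℝ) • r) * cexp ((2 : ℝ) • r) := by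
    ext t
    simp only [ContinuousMap.mul_apply, cexp_apply, ContinuousMap.smul_apply, smul_eq_mul,
      ← Real.exp_add]
    congr 1
    ring
  have h1 : IsDeriv (cexp (-(2⁻¹ : ℝ) • r) * c)
      (-(2⁻¹ : ℝ) • (cexp (-(2⁻¹ : ℝ) • r) * c * r') - e • (cexp ((2⁻¹ : ℝ) • r) * s)) := by
    refine (hm.mul hc).congr rfl ?_
    rw [← hmp]
    simp only [smul_mul_assoc, neg_smul, neg_mul, sub_eq_add_neg]
    congr 1
    · congr 2; ring
    · congr 2; ring
  have h2 : IsDeriv (cexp ((2⁻¹ : ℝ) • r) * s)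
      ((2⁻¹ : ℝ) • (cexp ((2⁻¹ : ℝ) • r) * s * r') +
        e • (cexp (-(2⁻¹ : ℝ) • r) * cexp ((2 : ℝ) • r) * c)) := by
    refine (hp.mul hs).congr rfl ?_
    rw [← hpp]
    simp only [smul_mul_assoc]
    congr 1
    · congr 1; ring
    · congr 1; ring
  -- When the derivative of `exp(-r/2) c` is differentiated again, the two terms in `r' exp(r/2) s`
  -- cancel; what is left is `-u/2 + r'²/4 - exp(2r)` times `exp(-r/2) c`.
  have h3 := ((IsAC.mul h1 (isAC_V u)).smul (-(2⁻¹ : ℝ))).add (IsAC.smul (-e) h2)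
  have h4 := IsSol.of (q := kepT u) h1 (h3.congr (by rw [neg_smul e, sub_eq_add_neg]) ?_)
  · convert h4 using 1
    · simp [hr]
    · simp [hr, hr']
  · rw [← hr', kepT, M_J, kepK, M_add_left, M_J, M_smul_left, ← hr', ← hr]
    have h5 : (J ((-(2⁻¹ : ℝ) • (cexp (-(2⁻¹ : ℝ) • r) * c * r') -
        e • (cexp ((2⁻¹ : ℝ) • r) * s)) * r') : L2) = -(2⁻¹ : ℝ) • J (cexp (-(2⁻¹ : ℝ) • r) * c * (r' * r')) -
        e • J (cexp ((2⁻¹ : ℝ) • r) * s * r') := by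
      rw [← map_smul J, ← map_smul J, ← map_sub J]
      congr 1
      simp only [sub_mul, smul_mul_assoc, mul_assoc]
    have h6 : (J (((4⁻¹ : ℝ) • (r' * r') - cexp ((2 : ℝ) • r)) * (cexp (-(2⁻¹ : ℝ) • r) * c)) : L2) =
        (4⁻¹ : ℝ) • J (cexp (-(2⁻¹ : ℝ) • r) * c * (r' * r')) -
          J (cexp (-(2⁻¹ : ℝ) • r) * cexp ((2 : ℝ) • r) * c) := by
      rw [← map_smul J, ← map_sub J]
      congr 1
      simp only [sub_mul, smul_mul_assoc]
      congr 1
      · congr 1; ring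
      · ring
    rw [h5, h6, map_add, map_smul, map_smul, smul_add (-e), smul_smul (-e) e,
      show -e * e = -1 by linear_combination -he]
    module

theorem isSol_kepT_cos (u : L2) : IsSol (kepT u) 1 0
    (cexp (-(2⁻¹ : ℝ) • VJ (V u)) * ccos (kepAngle u))
    (-(2⁻¹ : ℝ) • (cexp (-(2⁻¹ : ℝ) • VJ (V u)) * ccos (kepAngle u) * V u) -
      cexp ((2⁻¹ : ℝ) • VJ (V u)) * csin (kepAngle u)) := by
  have hd : IsDeriv (kepAngle u) (cexp (VJ (V u))) := isDeriv_VJ _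
  have h := isSol_kepT_aux u 1 (by norm_num) (c := ccos (kepAngle u)) (s := csin (kepAngle u))
    (hd.ccos.congr rfl (by simp)) (hd.csin.congr rfl (by simp))
  simpa [kepAngle] using h

theorem isSol_kepT_sin (u : L2) : IsSol (kepT u) 0 1
    (cexp (-(2⁻¹ : ℝ) • VJ (V u)) * csin (kepAngle u))
    (-(2⁻¹ : ℝ) • (cexp (-(2⁻¹ : ℝ) • VJ (V u)) * csin (kepAngle u) * V u) +
      cexp ((2⁻¹ : ℝ) • VJ (V u)) * ccos (kepAngle u)) := by
  have hd : IsDeriv (kepAngle u) (cexp (VJ (V u))) := isDeriv_VJ _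
  have h := isSol_kepT_aux u (-1) (by norm_num) (c := csin (kepAngle u)) (s := ccos (kepAngle u))
    (hd.csin.congr rfl (by simp)) (hd.ccos.congr rfl (by simp))
  simpa [kepAngle, sub_eq_add_neg] using h

/-! ### The inverse Kepler transform -/

/-- First solution. -/
def sx (q : L2) : CI := sol q 1

/-- Derivative of the first solution. -/
def sx' (q : L2) : CI := V (M q (sx q))

/-- Second solution. -/
def sy (q : L2) : CI := sol q (VJ 1)

/-- Derivative of the second solution. -/
def sy' (q : L2) : CI := 1 + V (M q (sy q))

theorem isSol_sx (q : L2) : IsSol q 1 0 (sx q) (sx' q) := by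
  have h := isSol_sol q 1 0
  simp only [map_zero, add_zero, zero_add, cst_one] at h
  exact h

theorem isSol_sy (q : L2) : IsSol q 0 1 (sy q) (sy' q) := by
  have h := isSol_sol q 0 1
  simp only [map_zero, zero_add, cst_one] at h
  exact h

/-- The square of the distance from the origin to the planar curve of a potential. -/
def srho (q : L2) : CI := sx q * sx q + sy q * sy q

/-- The derivative of `srho q`. -/
def srho' (q : L2) : CI := (2 : ℝ) • (sx q * sx' q + sy q * sy' q)

theorem isDeriv_srho (q : L2) : IsDeriv (srho q) (srho' q) := by
  have h1 := (isSol_sx q).isDeriv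
  have h2 := (isSol_sy q).isDeriv
  refine ((h1.mul h1).add (h2.mul h2)).congr rfl ?_
  rw [srho', two_smul]
  ring

/-- Its derivative is zero, as both solutions share the potential, and its value at 0 is 1. -/
theorem wronskian (q : L2) : sx q * sy' q - sy q * sx' q = 1 := by
  have h1 := isSol_sx q
  have h2 := isSol_sy q
  have h3 := (IsAC.mul h1.isDeriv h2.isAC).add ((IsAC.mul h2.isDeriv h1.isAC).smul (-1))
  have h4 : M (J (sx' q)) (sy' q) + M (M q (sy q)) (sx q) +
      (-1 : ℝ) • (M (J (sy' q)) (sx' q) + M (M q (sx q)) (sy q)) = 0 := by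
    rw [M_J, M_J, M_mul, M_mul, mul_comm (sy' q), mul_comm (sy q) (sx q)]
    module
  rw [h4] at h3
  have h5 := h3.eq_of (isAC_cst 1) (by
    simp [h1.left_zero, h1.right_zero, h2.left_zero, h2.right_zero])
  rw [cst_one, neg_one_smul, ← sub_eq_add_neg] at h5
  exact h5

theorem srho_pos (q : L2) (t : II) : 0 < srho q t := by
  have h := DFunLike.congr_fun (wronskian q) t
  simp only [ContinuousMap.sub_apply, ContinuousMap.mul_apply, ContinuousMap.one_apply] at h
  simp only [srho, ContinuousMap.add_apply, ContinuousMap.mul_apply]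
  by_contra hn
  have h0 : sx q t = 0 := by nlinarith [sq_nonneg (sx q t), sq_nonneg (sy q t)]
  have h1 : sy q t = 0 := by nlinarith [sq_nonneg (sx q t), sq_nonneg (sy q t)]
  simp [h0, h1] at h

theorem isUnit_srho (q : L2) : IsUnit (srho q) :=
  (ContinuousMap.isUnit_iff_forall_ne_zero _).2 fun t => (srho_pos q t).ne'

/-- The inverse of `srho q`. -/
def skap (q : L2) : CI := Ring.inverse (srho q)

theorem srho_mul_skap (q : L2) : srho q * skap q = 1 := Ring.mul_inverse_cancel _ (isUnit_srho q)

theorem ringInverse_apply {f : CI} (hf : IsUnit f) (t : II) : Ring.inverse f t = (f t)⁻¹ := by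
  have h := DFunLike.congr_fun (Ring.mul_inverse_cancel _ hf) t
  exact eq_inv_of_mul_eq_one_right h

theorem IsDeriv.ringInverse {f f' : CI} (h : IsDeriv f f') (hf : IsUnit f) :
    IsDeriv (Ring.inverse f) (-(f' * (Ring.inverse f * Ring.inverse f))) :=
  h.comp (φ := fun x => x⁻¹) (φ' := fun x => -(x ^ 2)⁻¹)
    (fun t => hasDerivAt_inv ((ContinuousMap.isUnit_iff_forall_ne_zero _).1 hf t))
    (fun t => ringInverse_apply hf t) fun t => by
      simp only [ContinuousMap.neg_apply, ContinuousMap.mul_apply, ringInverse_apply hf]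
      rw [pow_two, mul_inv]
      ring

/-- The nonlinear part of the inverse Kepler transform. -/
def kepL (q : L2) : CI :=
  (2⁻¹ : ℝ) • ((srho' q * skap q) * (srho' q * skap q)) - (2 : ℝ) • (skap q * skap q)

/-- The inverse Kepler transform. -/
def kepS (q : L2) : L2 := -(2 : ℝ) • q + J (kepL q)

theorem cexp_neg (f : CI) : cexp (-f) * cexp f = 1 := by
  ext t
  simp [← Real.exp_add]

theorem cexp_half_mul_self (f : CI) (c d : ℝ) : cexp (c • f) * cexp (d • f) = cexp ((c + d) • f) := by
  ext t
  simp [← Real.exp_add, add_mul]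

theorem ccos_sq_add_csin_sq (f : CI) : ccos f * ccos f + csin f * csin f = 1 := by
  ext t
  simp [← sq]

/-- The fundamental solutions are `exp(-r/2)` times the cosine and the sine of one angle, so the
squared radius forgets the angle. -/
theorem srho_kepT (u : L2) : srho (kepT u) = cexp (-VJ (V u)) := by
  have h1 := ((isSol_sx _).unique (isSol_kepT_cos u)).1
  have h2 := ((isSol_sy _).unique (isSol_kepT_sin u)).1
  rw [srho, h1, h2]
  have h3 := cexp_half_mul_self (VJ (V u)) (-(2⁻¹ : ℝ)) (-(2⁻¹ : ℝ))
  rw [show (-(2⁻¹ : ℝ)) + -(2⁻¹ : ℝ) = -1 by norm_num, neg_one_smul] at h3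
  linear_combination h3 * (ccos (kepAngle u) * ccos (kepAngle u) +
    csin (kepAngle u) * csin (kepAngle u)) + cexp (-VJ (V u)) * ccos_sq_add_csin_sq (kepAngle u)

theorem skap_kepT (u : L2) : skap (kepT u) = cexp (VJ (V u)) := by
  have h := srho_mul_skap (kepT u)
  rw [srho_kepT] at h
  have h2 := cexp_neg (VJ (V u))
  calc skap (kepT u) = (cexp (-VJ (V u)) * cexp (VJ (V u))) * skap (kepT u) := by rw [h2, one_mul]
    _ = cexp (VJ (V u)) * (cexp (-VJ (V u)) * skap (kepT u)) := by ring
    _ = _ := by rw [h, mul_one]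

theorem srho'_kepT (u : L2) : srho' (kepT u) = -(V u * cexp (-VJ (V u))) := by
  have h1 := isDeriv_srho (kepT u)
  have h2 := ((isDeriv_VJ (V u)).smul (-1)).cexp
  rw [neg_one_smul, ← srho_kepT] at h2
  have h3 := J_injective (h1.derivative_unique h2)
  rw [h3, srho_kepT]
  simp

/-- Substituting `ρ = exp(-r)` and `ρ'/ρ = -r'` turns `kepL` into twice `kepK`, and then the two
affine formulas are inverse to each other. -/
theorem kepS_kepT (u : L2) : kepS (kepT u) = u := by
  have h : kepL (kepT u) = (2 : ℝ) • kepK u := by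
    have h2 := cexp_neg (VJ (V u))
    have h3 : srho' (kepT u) * skap (kepT u) = -V u := by
      rw [srho'_kepT, skap_kepT]
      linear_combination -(V u) * h2
    have h4 : skap (kepT u) * skap (kepT u) = cexp ((2 : ℝ) • VJ (V u)) := by
      rw [skap_kepT]
      have := cexp_half_mul_self (VJ (V u)) 1 1
      rw [one_smul] at this
      rw [this]
      norm_num
    rw [kepL, kepK, h3, h4, neg_mul_neg]
    module
  rw [kepS, h, kepT, map_smul]
  module

theorem isAC_srho' (q : L2) : IsAC (srho' q)
    ((2 : ℝ) • (J (sx' q * sx' q + sy' q * sy' q) + M q (srho q))) := by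
  have h1 := isSol_sx q
  have h2 := isSol_sy q
  refine (((IsAC.mul h1.isDeriv h1.isAC).add (IsAC.mul h2.isDeriv h2.isAC)).smul 2).congr rfl ?_
  rw [M_J, M_J, M_mul, M_mul, srho, map_add, map_add]
  module

/-- Here `-ρ'/ρ` is differentiated and seen to have derivative `kepS q` and initial value 0: it is
the `r'` belonging to `q`. -/
theorem V_kepS (q : L2) : V (kepS q) = -(srho' q * skap q) := by
  have h := (IsAC.mul (isAC_srho' q) ((isDeriv_srho q).ringInverse (isUnit_srho q))).smul (-1)
  have h0 : srho' q i0 = 0 := by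
    have h1 := isSol_sx q
    have h2 := isSol_sy q
    simp [srho', h1.left_zero, h1.right_zero, h2.left_zero, h2.right_zero]
  symm
  rw [← neg_one_smul ℝ]
  refine IsAC.eq_of (h.congr rfl ?_) (isAC_V (kepS q)) (by simp [h0])
  have hs := srho_mul_skap q
  rw [← skap, M_J, M_smul_left, M_add_left, M_mul, hs, M_one, M_J, kepS]
  have h3 : kepL q = -(2 : ℝ) • ((sx' q * sx' q + sy' q * sy' q) * skap q) -
      -(srho' q * (skap q * skap q)) * srho' q := by
    -- Lagrange's identity: squared speed times squared radius is the square of the scalar product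
    -- `ρ'/2` plus the square of the Wronskian, which is 1.
    have h4 : (sx' q * sx' q + sy' q * sy' q) * srho q =
        (4⁻¹ : ℝ) • (srho' q * srho' q) + 1 := by
      rw [srho', srho]
      simp only [smul_mul_assoc, mul_smul_comm, smul_smul]
      norm_num
      linear_combination (sx q * sy' q - sy q * sx' q + 1) * wronskian q
    have h5 : (sx' q * sx' q + sy' q * sy' q) * skap q =
        (4⁻¹ : ℝ) • (srho' q * skap q * (srho' q * skap q)) + skap q * skap q := by
      calc _ = (sx' q * sx' q + sy' q * sy' q) * skap q * (srho q * skap q) := by rw [hs, mul_one]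
        _ = ((sx' q * sx' q + sy' q * sy' q) * srho q) * (skap q * skap q) := by ring
        _ = _ := by
          rw [h4, add_mul, one_mul, smul_mul_assoc]
          congr 2
          ring
    rw [h5, kepL]
    have h6 : -(srho' q * (skap q * skap q)) * srho' q =
      (-1 : ℝ) • (srho' q * skap q * (srho' q * skap q)) := by rw [neg_one_smul]; ring
    rw [h6]
    module
  rw [h3, map_sub, map_smul]
  module

/-- Since `r' = -ρ'/ρ`, the product `exp(-r) ρ⁻¹` has zero derivative, and it equals 1 at 0. -/
theorem cexp_VJ_V_kepS (q : L2) : cexp (VJ (V (kepS q))) = skap q := by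
  have h1 := ((isDeriv_VJ (V (kepS q))).smul (-1)).cexp
  have h2 := (isDeriv_srho q).ringInverse (isUnit_srho q)
  have h3 : skap q i0 = 1 := by
    have h1 := isSol_sx q
    have h2 := isSol_sy q
    rw [skap, ringInverse_apply (isUnit_srho q)]
    simp [srho, h1.left_zero, h2.left_zero]
  rw [neg_one_smul, neg_one_smul] at h1
  have h4 := (h1.mul h2).congr (g' := 0) rfl (by
    rw [V_kepS, ← skap]
    ring)
  rw [IsDeriv, map_zero] at h4
  have h5 := h4.eq_of (isAC_cst 1) (by rw [← skap]; simp [h3])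
  rw [← skap, cst_one] at h5
  have h6 := cexp_neg (VJ (V (kepS q)))
  calc cexp (VJ (V (kepS q))) = cexp (VJ (V (kepS q))) * (cexp (-VJ (V (kepS q))) * skap q) := by
        rw [h5, mul_one]
    _ = (cexp (-VJ (V (kepS q))) * cexp (VJ (V (kepS q)))) * skap q := by ring
    _ = _ := by rw [h6, one_mul]

theorem kepT_kepS (q : L2) : kepT (kepS q) = q := by
  have h : kepL q = (2 : ℝ) • kepK (kepS q) := by
    have h4 := cexp_half_mul_self (VJ (V (kepS q))) 1 1
    rw [one_smul, cexp_VJ_V_kepS, one_add_one_eq_two] at h4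
    rw [kepK, ← h4, V_kepS, neg_mul_neg, kepL]
    module
  rw [kepT]
  nth_rewrite 1 [kepS]
  rw [h, map_smul]
  module

/-! ### The monodromy of a potential -/

theorem integral_eq_VJ {k : ℝ → ℝ} {f : CI} (h : ∀ t : II, k t = f t) (t : II) :
    ∫ s in (0 : ℝ)..t, k s = VJ f t := by
  rw [VJ_eq]
  refine intervalIntegral.integral_congr fun s hs => ?_
  rw [uIcc_of_le t.2.1] at hs
  have hs' : s ∈ II := ⟨hs.1, hs.2.trans t.2.2⟩
  change k s = ext f s
  rw [ext_of_mem f hs', ← h]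

theorem integral_mul_eq_V {q : L2} {k : ℝ → ℝ} {f : CI} (h : ∀ t : II, k t = f t) (t : II) :
    ∫ s in (0 : ℝ)..t, q s * k s = V (M q f) t := by
  refine (prim_congr ?_ t).symm
  filter_upwards [M_coe q f, ae_restrict_mem measurableSet_Icc] with s h1 h2
  rw [h1, ext_of_mem f h2, h ⟨s, h2⟩]

theorem isFundamentalMatrix_iff (q : L2) (Φ : ℝ → Matrix (Fin 2) (Fin 2) ℝ) :
    IsFundamentalMatrix q Φ ↔ ∃ x : Fin 2 → Fin 2 → CI, (∀ (t : II) i j, Φ t i j = x i j t) ∧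
      ∀ j, IsSol q ((1 : Matrix (Fin 2) (Fin 2) ℝ) 0 j) ((1 : Matrix (Fin 2) (Fin 2) ℝ) 1 j)
        (x 0 j) (x 1 j) := by
  constructor
  · rintro ⟨hc, h⟩
    have hc' : ∀ i j, ContinuousOn (fun t => Φ t i j) II := fun i j =>
      (continuous_apply_apply i j).comp_continuousOn hc
    refine ⟨fun i j => ⟨II.domRestrict fun t => Φ t i j,
      continuousOn_iff_continuous_domRestrict.1 (hc' i j)⟩, fun _ _ _ => rfl, fun j => ⟨?_, ?_⟩⟩
    · ext t
      rw [ContinuousMap.add_apply, cst_apply, ← integral_eq_VJ (k := fun s => Φ s 1 j)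
        (fun _ => rfl)]
      exact (h t t.2 j).1
    · ext t
      rw [ContinuousMap.add_apply, cst_apply, ← integral_mul_eq_V (k := fun s => Φ s 0 j)
        (fun _ => rfl)]
      exact (h t t.2 j).2
  · rintro ⟨x, hx, h⟩
    refine ⟨?_, fun t ht j => ⟨?_, ?_⟩⟩
    · refine continuousOn_pi.2 fun i => continuousOn_pi.2 fun j => ?_
      rw [continuousOn_iff_continuous_domRestrict]
      convert (x i j).continuous using 1
      funext t
      exact hx t i j
    · rw [integral_eq_VJ (fun s => hx s 1 j) ⟨t, ht⟩]
      have := DFunLike.congr_fun (h j).left ⟨t, ht⟩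
      rw [← hx] at this
      simpa using this
    · rw [integral_mul_eq_V (fun s => hx s 0 j) ⟨t, ht⟩]
      have := DFunLike.congr_fun (h j).right ⟨t, ht⟩
      rw [← hx] at this
      simpa using this

theorem IsFundamentalMatrix.eqOn {q : L2} {Φ Φ' : ℝ → Matrix (Fin 2) (Fin 2) ℝ}
    (h : IsFundamentalMatrix q Φ) (h' : IsFundamentalMatrix q Φ') : EqOn Φ Φ' II := by
  obtain ⟨x, hx, hs⟩ := (isFundamentalMatrix_iff q Φ).1 h
  obtain ⟨x', hx', hs'⟩ := (isFundamentalMatrix_iff q Φ').1 h'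
  intro t ht
  ext i j
  rw [hx ⟨t, ht⟩, hx' ⟨t, ht⟩]
  have := (hs j).unique (hs' j)
  fin_cases i
  · exact DFunLike.congr_fun this.1 _
  · exact DFunLike.congr_fun this.2 _

/-- Uniqueness for the differential equation fixes the path in `SL(2, ℝ)`; uniqueness of lifts
through the covering fixes its lift. -/
theorem IsMonodromy.unique {q : L2} {g g' : G} (h : IsMonodromy q g) (h' : IsMonodromy q g') :
    g = g' := by
  obtain ⟨Φ, L, hΦ, hL, h0, hp, rfl⟩ := h
  obtain ⟨Φ', L', hΦ', hL', h0', hp', rfl⟩ := h'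
  have h1 : EqOn (G.proj ∘ L) (G.proj ∘ L') II := fun t ht =>
    Subtype.ext ((hp t ht).trans ((hΦ.eqOn hΦ' ht).trans (hp' t ht).symm))
  exact isCoveringMap_proj.eqOn_of_comp_eqOn isPreconnected_Icc hL hL' h1
    (left_mem_Icc.2 zero_le_two_pi) (h0.trans h0'.symm) (right_mem_Icc.2 zero_le_two_pi)

/-- The coordinates of the lifted fundamental matrix of `kepT u`. -/
def kepCoords (u : L2) (t : II) : EuclideanSpace ℝ (Fin 3) :=
  !₂[kepAngle u t, -VJ (V u) t, -(V u t * Real.exp (-VJ (V u) t))]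

theorem sqrt_exp (x : ℝ) : √(Real.exp x) = Real.exp (2⁻¹ * x) := by
  rw [Real.sqrt_eq_iff_mul_self_eq (Real.exp_pos _).le (Real.exp_pos _).le, ← Real.exp_add]
  congr 1
  ring

/-- The lift is explicit: in right Iwasawa coordinates the angle of the first row is the continuous
function `θ = ∫ exp r`, its squared length is `exp(-r)`, and `ν` is the derivative of that squared
length. -/
theorem isMonodromy_kepT (u : L2) :
    IsMonodromy (kepT u) (coords.symm (kepCoords u i1)) := by
  set P : ℝ → II := projIcc 0 (2 * Real.pi) zero_le_two_pi with hP
  have hPc : Continuous P := continuous_projIcc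
  have hPI : ∀ t : II, P t = t := fun t => projIcc_val zero_le_two_pi t
  refine ⟨fun t => (coords.symm (kepCoords u (P t))).proj, fun t => coords.symm (kepCoords u (P t)),
    ?_, ?_, ?_, fun _ _ => rfl, ?_⟩
  · rw [isFundamentalMatrix_iff]
    refine ⟨![![cexp (-(2⁻¹ : ℝ) • VJ (V u)) * ccos (kepAngle u),
      cexp (-(2⁻¹ : ℝ) • VJ (V u)) * csin (kepAngle u)],
      ![-(2⁻¹ : ℝ) • (cexp (-(2⁻¹ : ℝ) • VJ (V u)) * ccos (kepAngle u) * V u) -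
        cexp ((2⁻¹ : ℝ) • VJ (V u)) * csin (kepAngle u),
      -(2⁻¹ : ℝ) • (cexp (-(2⁻¹ : ℝ) • VJ (V u)) * csin (kepAngle u) * V u) +
        cexp ((2⁻¹ : ℝ) • VJ (V u)) * ccos (kepAngle u)]], fun t i j => ?_, Fin.forall_fin_two.2 ⟨?_, ?_⟩⟩
    · change iwasawaMatrix (kepCoords u (P t) 0) (Real.exp (kepCoords u (P t) 1))
        (kepCoords u (P t) 2) i j = _
      rw [iwasawaMatrix_eq, hPI, sqrt_exp, one_div, ← Real.exp_neg]
      set r := VJ (V u) t with hr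
      set θ := kepAngle u t with hθ
      set v := V u t with hv
      have e0 : kepCoords u t 0 = θ := rfl
      have e1 : kepCoords u t 1 = -r := rfl
      have e2 : kepCoords u t 2 = -(v * Real.exp (-r)) := rfl
      have h1 : Real.exp (-(2⁻¹ * -r)) = Real.exp (2⁻¹ * r) := by congr 1; ring
      have h2 : Real.exp (2⁻¹ * r) * Real.exp (-r) = Real.exp (2⁻¹ * -r) := by
        rw [← Real.exp_add]; congr 1; ring
      have h3 : Real.exp (-(2⁻¹ * r)) = Real.exp (2⁻¹ * -r) := by congr 1; ring
      rw [e0, e1, e2, h1]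
      fin_cases i <;> fin_cases j
      · simp [← hr, ← hθ]
      · simp [← hr, ← hθ]
      · simp [← hr, ← hθ, ← hv, h3]
        linear_combination -(v * Real.cos θ / 2) * h2
      · simp [← hr, ← hθ, ← hv, h3]
        linear_combination -(v * Real.sin θ / 2) * h2
    · simpa using isSol_kepT_cos u
    · simpa using isSol_kepT_sin u
  · refine (coords.symm.continuous.comp ?_).continuousOn
    refine (PiLp.continuous_toLp 2 _).comp (continuous_pi fun i => ?_)
    fin_cases i
    · exact (kepAngle u).continuous.comp hPc
    · exact ((VJ (V u)).continuous.comp hPc).neg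
    · exact (((V u).continuous.comp hPc).mul
        (Real.continuous_exp.comp ((VJ (V u)).continuous.comp hPc).neg)).neg
  · rw [Homeomorph.symm_apply_eq]
    have : P 0 = i0 := hPI i0
    rw [this]
    have h1 : (1 : G).proj = 1 := rfl
    have h2 : (1 : G).angle = 0 := rfl
    ext i
    fin_cases i <;> simp [kepCoords, kepAngle, coords, rowSq, rowDot, h1, h2]
  · have : P (2 * Real.pi) = i1 := hPI i1
    simp only [this]

theorem existsUnique_isMonodromy (q : L2) : ∃! g : G, IsMonodromy q g := by
  have h := isMonodromy_kepT (kepS q)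
  rw [kepT_kepS] at h
  exact ⟨_, h, fun g hg => hg.unique h⟩

theorem monodromy_kepT (u : L2) : monodromy (kepT u) = coords.symm (kepCoords u i1) :=
  (Classical.epsilon_spec (p := IsMonodromy (kepT u)) ⟨_, isMonodromy_kepT u⟩).unique
    (isMonodromy_kepT u)

/-! ### Sobolev spaces -/

/-- The space `(L²)^{p+1}`. -/
abbrev EP (p : ℕ) : Type := PiLp 2 fun _ : Fin (p + 1) => L2

/-- The `j`-th component, zero for `j > p`. -/
def compo (p j : ℕ) : EP p →L[ℝ] L2 :=
  if h : j < p + 1 then PiLp.proj 2 (fun _ : Fin (p + 1) => L2) ⟨j, h⟩ else 0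

theorem compo_eq {p j : ℕ} (h : j < p + 1) (f : EP p) : compo p j f = f ⟨j, h⟩ := by
  simp [compo, h]

theorem compo_zero (p : ℕ) (f : EP p) : compo p 0 f = f 0 := compo_eq (Nat.succ_pos p) f

theorem EP.ext {p : ℕ} {f g : EP p} (h : ∀ j ≤ p, compo p j f = compo p j g) : f = g := by
  apply PiLp.ext
  intro i
  have := h i (Nat.lt_succ_iff.1 i.2)
  rwa [compo_eq i.2, compo_eq i.2] at this

/-- Evaluation at a point. -/
def ev (t : II) : CI →L[ℝ] ℝ := ContinuousMap.evalCLM ℝ t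

@[simp] theorem ev_apply (t : II) (f : CI) : ev t f = f t := rfl

/-- The mean value of a square integrable function. -/
def mean : L2 →L[ℝ] ℝ := (2 * Real.pi)⁻¹ • (ev i1).comp V

theorem mean_J_cst (c : ℝ) : mean (J (cst c)) = c := by
  have h : V (J (cst c)) i1 = 2 * Real.pi * c := by
    rw [VJ_apply]
    simp [ext_apply]
  have hpi : 2 * Real.pi ≠ 0 := by positivity
  change (2 * Real.pi)⁻¹ * V (J (cst c)) i1 = c
  rw [h, inv_mul_cancel_left₀ hpi]

/-- The continuous representative of the `j`-th component, for `j < p`. -/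
def rep (p j : ℕ) : EP p →L[ℝ] CI :=
  V.comp (compo p (j + 1)) +
    cst.comp (mean.comp (compo p j - (J.comp V).comp (compo p (j + 1))))

theorem rep_apply (p j : ℕ) (f : EP p) : rep p j f =
    V (compo p (j + 1) f) + cst (mean (compo p j f - J (V (compo p (j + 1) f)))) := rfl

theorem isAC_rep (p j : ℕ) (f : EP p) : IsAC (rep p j f) (compo p (j + 1) f) := by
  rw [rep_apply, add_comm]
  exact isAC_add_V _ _

/-- A primitive is known up to a constant, and the mean value fixes it. Using the mean makes `rep` a
continuous linear map on all of `(L²)^{p+1}`. -/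
theorem rep_eq_of_isAC {p j : ℕ} {f : EP p} {x : CI} (h : IsAC x (compo p (j + 1) f))
    (h' : J x = compo p j f) : rep p j f = x := by
  have h1 : J x - J (V (compo p (j + 1) f)) = J (cst (x i0)) := by
    rw [← map_sub]
    congr 1
    nth_rewrite 1 [h]
    exact add_sub_cancel_right _ _
  rw [rep_apply, ← h', h1, mean_J_cst, add_comm]
  exact h.symm

theorem isACRep_iff (f g : L2) (u : ℝ → ℝ) :
    IsACRep f g u ↔ ∃ x : CI, (∀ t : II, u t = x t) ∧ IsAC x g ∧ J x = f := by
  constructor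
  · rintro ⟨h1, h2⟩
    have h3 : ∀ t : II, u t = (cst (u 0) + V g) t := fun t => by
      rw [h2 t t.2]
      simp [V_apply]
    refine ⟨cst (u 0) + V g, h3, isAC_add_V _ _, ?_⟩
    rw [J_eq_iff]
    filter_upwards [h1, ae_restrict_mem measurableSet_Icc] with t h4 h5
    rw [h4, ext_of_mem _ h5, h3 ⟨t, h5⟩]
  · rintro ⟨x, h1, h2, h3⟩
    refine ⟨?_, fun t ht => ?_⟩
    · filter_upwards [(J_eq_iff x f).1 h3, ae_restrict_mem measurableSet_Icc] with t h4 h5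
      rw [h4, ext_of_mem _ h5, h1 ⟨t, h5⟩]
    · have h0 := h1 i0
      rw [coe_i0] at h0
      rw [h1 ⟨t, ht⟩, h2.apply, h0, V_apply]

/-- Trades the existence of a representative for a closed linear condition, from which completeness
of the Sobolev spaces follows. -/
theorem mem_sobolevInterval_iff {p : ℕ} {f : EP p} :
    f ∈ sobolevInterval p ↔ ∀ j < p, J (rep p j f) = compo p j f := by
  have key : ∀ j : Fin p, (∃ u, IsACRep (f j.castSucc) (f j.succ) u) ↔
      J (rep p j f) = compo p j f := fun j => by
    have e1 : compo p j f = f j.castSucc := compo_eq (j.2.trans (Nat.lt_succ_self p)) f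
    have e2 : compo p (j + 1) f = f j.succ := compo_eq (Nat.succ_lt_succ j.2) f
    rw [← e1, ← e2]
    constructor
    · rintro ⟨u, hu⟩
      obtain ⟨x, -, h2, h3⟩ := (isACRep_iff _ _ _).1 hu
      rw [rep_eq_of_isAC h2 h3, h3]
    · intro h
      exact ⟨ext (rep p j f), (isACRep_iff _ _ _).2
        ⟨rep p j f, fun t => ext_coe _ t, isAC_rep p j f, h⟩⟩
  exact ⟨fun h j hj => (key ⟨j, hj⟩).1 (h ⟨j, hj⟩), fun h j => (key j).2 (h j j.2)⟩

theorem mem_sobolevCircle_iff {p : ℕ} {f : EP p} :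
    f ∈ sobolevCircle p ↔
      f ∈ sobolevInterval p ∧ ∀ j < p, rep p j f i1 - rep p j f i0 = 0 := by
  have key : ∀ j : Fin p,
      (∃ u, IsACRep (f j.castSucc) (f j.succ) u ∧ u 0 = u (2 * Real.pi)) ↔
      J (rep p j f) = compo p j f ∧ rep p j f i1 - rep p j f i0 = 0 := fun j => by
    have e1 : compo p j f = f j.castSucc := compo_eq (j.2.trans (Nat.lt_succ_self p)) f
    have e2 : compo p (j + 1) f = f j.succ := compo_eq (Nat.succ_lt_succ j.2) f
    rw [← e1, ← e2]
    constructor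
    · rintro ⟨u, hu, hu'⟩
      obtain ⟨x, h1, h2, h3⟩ := (isACRep_iff _ _ _).1 hu
      rw [rep_eq_of_isAC h2 h3, h3, ← h1, ← h1, coe_i0, coe_i1, hu', sub_self]
      exact ⟨rfl, rfl⟩
    · rintro ⟨h, h'⟩
      refine ⟨ext (rep p j f), (isACRep_iff _ _ _).2
        ⟨rep p j f, fun t => ext_coe _ t, isAC_rep p j f, h⟩, ?_⟩
      exact (ext_coe _ i0).trans ((sub_eq_zero.1 h').symm.trans (ext_coe _ i1).symm)
  rw [mem_sobolevInterval_iff]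
  exact ⟨fun h => ⟨fun j hj => ((key ⟨j, hj⟩).1 (h ⟨j, hj⟩)).1,
    fun j hj => ((key ⟨j, hj⟩).1 (h ⟨j, hj⟩)).2⟩, fun h j => (key j).2 ⟨h.1 j j.2, h.2 j j.2⟩⟩

theorem isClosed_sobolevInterval (p : ℕ) : IsClosed (sobolevInterval p : Set (EP p)) := by
  have : (sobolevInterval p : Set (EP p)) =
      ⋂ j, ⋂ (_ : j < p), {f | J (rep p j f) = compo p j f} := by
    ext f
    simp [mem_sobolevInterval_iff]
  rw [this]
  exact isClosed_iInter fun j => isClosed_iInter fun _ =>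
    isClosed_eq (J.continuous.comp (rep p j).continuous) (compo p j).continuous

theorem isClosed_sobolevCircle (p : ℕ) : IsClosed (sobolevCircle p : Set (EP p)) := by
  have : (sobolevCircle p : Set (EP p)) = (sobolevInterval p : Set (EP p)) ∩
      ⋂ j, ⋂ (_ : j < p), {f | rep p j f i1 - rep p j f i0 = 0} := by
    ext f
    simp [mem_sobolevCircle_iff]
  rw [this]
  refine (isClosed_sobolevInterval p).inter (isClosed_iInter fun j => isClosed_iInter fun _ =>
    isClosed_eq ?_ continuous_const)
  exact ((ev i1).continuous.comp (rep p j).continuous).sub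
    ((ev i0).continuous.comp (rep p j).continuous)

instance (p : ℕ) : CompleteSpace (sobolevInterval p) :=
  (isClosed_sobolevInterval p).completeSpace_coe

instance (p : ℕ) : CompleteSpace (sobolevCircle p) :=
  (isClosed_sobolevCircle p).completeSpace_coe

theorem isDeriv_rep {p j : ℕ} (hj : j + 1 < p) (f : sobolevInterval p) :
    IsDeriv (rep p j f) (rep p (j + 1) f) := by
  rw [IsDeriv, mem_sobolevInterval_iff.1 f.2 (j + 1) hj]
  exact isAC_rep p j f

/-- The function determines its derivatives, so identities in `H^p` may be checked in `L²`. -/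
theorem compo_zero_injective (p : ℕ) :
    Function.Injective fun f : sobolevInterval p => compo p 0 f := by
  intro f g h
  apply Subtype.ext
  apply EP.ext
  intro j
  induction j with
  | zero => exact fun _ => h
  | succ j ih =>
    intro hj
    have h1 := mem_sobolevInterval_iff.1 f.2 j hj
    have h2 := mem_sobolevInterval_iff.1 g.2 j hj
    have h3 : rep p j f = rep p j g := J_injective (h1.trans ((ih (by omega)).trans h2.symm))
    have h4 := isAC_rep p j f
    rw [h3] at h4
    exact h4.derivative_unique (isAC_rep p j g)

/-- The orthogonal projection is a smooth left inverse of the inclusion of the subspace. -/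
theorem contDiff_codRestrict {E X : Type*} [NormedAddCommGroup E] [InnerProductSpace ℝ E]
    [NormedAddCommGroup X] [NormedSpace ℝ X] {S : Submodule ℝ E} [CompleteSpace S]
    {n : WithTop ℕ∞} {F : X → S} (h : ContDiff ℝ n fun x => (F x : E)) : ContDiff ℝ n F := by
  have : F = fun x => S.orthogonalProjectionOnto (F x : E) := by
    funext x
    exact (Submodule.orthogonalProjectionOnto_mem_subspace_eq_self _).symm
  rw [this]
  exact S.orthogonalProjectionOnto.contDiff.comp h

/-- The element of the Sobolev space given by a function and its derivatives. -/
def ofSeq (p : ℕ) (d : ℕ → CI) (h : ∀ j < p, IsDeriv (d j) (d (j + 1))) : sobolevInterval p :=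
  ⟨WithLp.toLp 2 fun j => J (d j), by
    rw [mem_sobolevInterval_iff]
    intro j hj
    have e1 := compo_eq (j := j) (by omega) (WithLp.toLp 2 fun j : Fin (p + 1) => J (d j))
    have e2 := compo_eq (j := j + 1) (by omega) (WithLp.toLp 2 fun j : Fin (p + 1) => J (d j))
    rw [rep_eq_of_isAC (x := d j) (by rw [e2]; exact h j hj) (by rw [e1]), e1]⟩

theorem compo_ofSeq {p j : ℕ} (hj : j ≤ p) (d : ℕ → CI)
    (h : ∀ j < p, IsDeriv (d j) (d (j + 1))) : compo p j (ofSeq p d h) = J (d j) :=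
  compo_eq (Nat.lt_succ_iff.2 hj) _

theorem rep_ofSeq {p j : ℕ} (hj : j < p) (d : ℕ → CI)
    (h : ∀ j < p, IsDeriv (d j) (d (j + 1))) : rep p j (ofSeq p d h) = d j :=
  rep_eq_of_isAC (by rw [compo_ofSeq hj]; exact h j hj) (by rw [compo_ofSeq hj.le])

theorem contDiff_ofSeq {X : Type*} [NormedAddCommGroup X] [NormedSpace ℝ X] {p : ℕ}
    {n : WithTop ℕ∞} {D : ℕ → X → CI} (hD : ∀ j ≤ p, ContDiff ℝ n (D j))
    (h : ∀ x, ∀ j < p, IsDeriv (D j x) (D (j + 1) x)) :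
    ContDiff ℝ n fun x => ofSeq p (fun j => D j x) (h x) := by
  apply contDiff_codRestrict
  rw [contDiff_piLp]
  intro i
  exact J.contDiff.comp (hD i (Nat.lt_succ_iff.1 i.2))

/-! ### Towers of derivatives -/

section Tower

variable {X : Type*}

/-- The family `F` of functions has `n` successive derivatives, the `j`-th one satisfying `P j`. -/
def Tower : ℕ → (ℕ → (X → CI) → Prop) → (X → CI) → Prop
  | 0, P, F => P 0 F
  | n + 1, P, F => P 0 F ∧ ∃ F', (∀ x, IsDeriv (F x) (F' x)) ∧ Tower n (fun j => P (j + 1)) F'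

/-- A sequence of classes of families of functions that are closed under the usual operations. -/
structure IsRingPred (P : ℕ → (X → CI) → Prop) : Prop where
  succ : ∀ j F, P j F → P (j + 1) F
  add : ∀ j F F', P j F → P j F' → P j (F + F')
  smul : ∀ j (c : ℝ) F, P j F → P j (c • F)
  mul : ∀ j F F', P j F → P j F' → P j (F * F')
  cexp : ∀ j F, P j F → P j (fun x => Monodromy.cexp (F x))

theorem IsRingPred.shift {P : ℕ → (X → CI) → Prop} (h : IsRingPred P) :
    IsRingPred fun j => P (j + 1) :=
  ⟨fun j => h.succ (j + 1), fun j => h.add (j + 1), fun j => h.smul (j + 1),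
    fun j => h.mul (j + 1), fun j => h.cexp (j + 1)⟩

variable {P : ℕ → (X → CI) → Prop} {n : ℕ} {F G : X → CI}

theorem Tower.base (h : Tower n P F) : P 0 F := by
  cases n with
  | zero => exact h
  | succ n => exact h.1

theorem Tower.of_succ (h : Tower (n + 1) P F) : Tower n P F := by
  induction n generalizing P F with
  | zero => exact h.1
  | succ n ih =>
    obtain ⟨h0, F', h1, h2⟩ := h
    exact ⟨h0, F', h1, ih h2⟩

theorem Tower.shift (hP : IsRingPred P) (h : Tower n P F) : Tower n (fun j => P (j + 1)) F := by
  induction n generalizing P F with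
  | zero => exact hP.succ 0 F h
  | succ n ih =>
    obtain ⟨h0, F', h1, h2⟩ := h
    exact ⟨hP.succ 0 F h0, F', h1, ih hP.shift h2⟩

theorem Tower.add (hP : IsRingPred P) (h : Tower n P F) (h' : Tower n P G) :
    Tower n P (F + G) := by
  induction n generalizing P F G with
  | zero => exact hP.add 0 F G h h'
  | succ n ih =>
    obtain ⟨h0, F', h1, h2⟩ := h
    obtain ⟨h0', G', h1', h2'⟩ := h'
    exact ⟨hP.add 0 F G h0 h0', F' + G', fun x => (h1 x).add (h1' x), ih hP.shift h2 h2'⟩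

theorem Tower.smul (hP : IsRingPred P) (c : ℝ) (h : Tower n P F) : Tower n P (c • F) := by
  induction n generalizing P F with
  | zero => exact hP.smul 0 c F h
  | succ n ih =>
    obtain ⟨h0, F', h1, h2⟩ := h
    exact ⟨hP.smul 0 c F h0, c • F', fun x => (h1 x).smul c, ih hP.shift h2⟩

theorem Tower.neg (hP : IsRingPred P) (h : Tower n P F) : Tower n P (-F) := by
  rw [← neg_one_smul ℝ]
  exact h.smul hP _

theorem Tower.sub (hP : IsRingPred P) (h : Tower n P F) (h' : Tower n P G) :
    Tower n P (F - G) := by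
  rw [sub_eq_add_neg]
  exact h.add hP (h'.neg hP)

theorem Tower.mul (hP : IsRingPred P) (h : Tower n P F) (h' : Tower n P G) :
    Tower n P (F * G) := by
  induction n generalizing P F G with
  | zero => exact hP.mul 0 F G h h'
  | succ n ih =>
    have h3 := h.of_succ.shift hP
    have h3' := h'.of_succ.shift hP
    obtain ⟨h0, F', h1, h2⟩ := h
    obtain ⟨h0', G', h1', h2'⟩ := h'
    exact ⟨hP.mul 0 F G h0 h0', F' * G + G' * F, fun x => (h1 x).mul (h1' x),
      (ih hP.shift h2 h3').add hP.shift (ih hP.shift h2' h3)⟩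

theorem Tower.cexp (hP : IsRingPred P) (h : Tower n P F) :
    Tower n P fun x => Monodromy.cexp (F x) := by
  induction n generalizing P F with
  | zero => exact hP.cexp 0 F h
  | succ n ih =>
    have h3 := (ih hP h.of_succ).shift hP
    obtain ⟨h0, F', h1, h2⟩ := h
    exact ⟨hP.cexp 0 F h0, F' * fun x => Monodromy.cexp (F x), fun x => (h1 x).cexp,
      h2.mul hP.shift h3⟩

theorem Tower.exists_seq (h : Tower n P F) : ∃ D : ℕ → X → CI, D 0 = F ∧ (∀ j ≤ n, P j (D j)) ∧
    ∀ x, ∀ j < n, IsDeriv (D j x) (D (j + 1) x) := by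
  induction n generalizing P F with
  | zero =>
    refine ⟨fun _ => F, rfl, fun j hj => ?_, fun x j hj => absurd hj (Nat.not_lt_zero j)⟩
    rw [Nat.le_zero.1 hj]
    exact h
  | succ n ih =>
    obtain ⟨h0, F', h1, h2⟩ := h
    obtain ⟨D, hD0, hD1, hD2⟩ := ih h2
    refine ⟨fun j => Nat.casesOn j F D, rfl, fun j hj => ?_, fun x j hj => ?_⟩
    · cases j with
      | zero => exact h0
      | succ j => exact hD1 j (by omega)
    · cases j with
      | zero =>
        change IsDeriv (F x) (D 0 x)
        rw [hD0]
        exact h1 x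
      | succ j => exact hD2 x j (by omega)

end Tower

section Smooth

variable {X : Type*} [NormedAddCommGroup X] [NormedSpace ℝ X]

/-- The class of smooth families of functions. -/
def SmoothPred : ℕ → (X → CI) → Prop := fun _ F => ContDiff ℝ ∞ F

theorem isRingPred_smoothPred : IsRingPred (SmoothPred (X := X)) where
  succ _ _ h := h
  add _ _ _ h h' := ContDiff.add h h'
  smul _ c _ h := ContDiff.const_smul c h
  mul _ _ _ h h' := ContDiff.mul h h'
  cexp _ _ h := contDiff_cexp.comp h

/-- Induction through `(1/F)' = -F' / F²`, whose right-hand side needs one derivative less of `1/F`.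
-/
theorem tower_ringInverse {n : ℕ} {F : X → CI} (h : Tower n SmoothPred F)
    (hF : ∀ x, IsUnit (F x)) : Tower n SmoothPred fun x => Ring.inverse (F x) := by
  have h0 : ContDiff ℝ ∞ fun x => Ring.inverse (F x) := contDiff_iff_contDiffAt.2 fun x => by
    obtain ⟨u, hu⟩ := hF x
    have h1 := contDiffAt_ringInverse ℝ (n := ∞) u
    rw [hu] at h1
    exact h1.comp x (ContDiff.contDiffAt h.base)
  induction n with
  | zero => exact h0
  | succ n ih =>
    have h3 := ih h.of_succ
    obtain ⟨-, F', h1, h2⟩ := h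
    exact ⟨h0, -(F' * ((fun x => Ring.inverse (F x)) * fun x => Ring.inverse (F x))),
      fun x => (h1 x).ringInverse (hF x), (h2.mul isRingPred_smoothPred
        (h3.mul isRingPred_smoothPred h3)).neg isRingPred_smoothPred⟩

end Smooth

/-! ### The Kepler transform on Sobolev spaces -/

/-- The potential in `L²` of an element of a Sobolev space. -/
def pot (p : ℕ) : sobolevInterval p →L[ℝ] L2 := (compo p 0).comp (sobolevInterval p).subtypeL

theorem pot_apply (p : ℕ) (u : sobolevInterval p) : pot p u = compo p 0 u := rfl

theorem pot_injective (p : ℕ) : Function.Injective (pot p) := compo_zero_injective p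

theorem J_rep_zero {p : ℕ} (hp : 0 < p) (u : sobolevInterval p) : J (rep p 0 u) = pot p u :=
  mem_sobolevInterval_iff.1 u.2 0 hp

theorem tower_rep {p j n : ℕ} (hn : j + n < p) {P : ℕ → (sobolevInterval p → CI) → Prop}
    (hP : ∀ i ≤ n, P i fun u => rep p (j + i) u) : Tower n P fun u => rep p j u := by
  induction n generalizing j P with
  | zero => exact hP 0 le_rfl
  | succ n ih =>
    refine ⟨hP 0 (by omega), fun u => rep p (j + 1) u, fun u => isDeriv_rep (by omega) u,
      ih (by omega) fun i hi => ?_⟩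
    have := hP (i + 1) (by omega)
    rwa [show j + (i + 1) = j + 1 + i by ring] at this

theorem tower_V {p n : ℕ} (hn : n ≤ p) {P : ℕ → (sobolevInterval p → CI) → Prop}
    (h0 : P 0 fun u => V (pot p u)) (hP : ∀ i < n, P (i + 1) fun u => rep p i u) :
    Tower n P fun u => V (pot p u) := by
  cases n with
  | zero => exact h0
  | succ n =>
    refine ⟨h0, fun u => rep p 0 u, fun u => ?_, tower_rep (by omega) fun i hi => ?_⟩
    · rw [IsDeriv, J_rep_zero (by omega)]
      exact isAC_V _
    · rw [zero_add]
      exact hP i (by omega)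

theorem tower_VJV {p n : ℕ} (hn : n ≤ p) {P : ℕ → (sobolevInterval p → CI) → Prop}
    (hR : IsRingPred P) (h0 : P 0 fun u => V (pot p u)) (h1 : P 0 fun u => VJ (V (pot p u)))
    (hP : ∀ i < n, P (i + 1) fun u => rep p i u) :
    Tower n P fun u => VJ (V (pot p u)) := by
  cases n with
  | zero => exact h1
  | succ n =>
    exact ⟨h1, fun u => V (pot p u), fun u => isDeriv_VJ _,
      (tower_V hn h0 hP).of_succ.shift hR⟩

/-- The nonlinear part contains only `r` and `r' = V u`, hence one derivative less than `u` itself: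
for `u` in `H^p` it has `p` continuous derivatives. The shifted index records that the `i`-th
derivative of `u` first enters at level `i + 1`. -/
theorem tower_kepK {p n : ℕ} (hn : n ≤ p) {P : ℕ → (sobolevInterval p → CI) → Prop}
    (hR : IsRingPred P) (h0 : P 0 fun u => V (pot p u)) (h1 : P 0 fun u => VJ (V (pot p u)))
    (hP : ∀ i < n, P (i + 1) fun u => rep p i u) :
    Tower n P fun u => kepK (pot p u) := by
  have hV := tower_V hn h0 hP
  exact ((hV.mul hR hV).smul hR _).sub hR (((tower_VJV hn hR h0 h1 hP).smul hR 2).cexp hR)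

/-- `x` has trivial jets of order `< j` at the end points, and so do its first two primitives. -/
structure Flat (p j : ℕ) (x : sobolevInterval p) : Prop where
  V_eq : V (pot p x) i1 = 0
  VJV_eq : VJ (V (pot p x)) i1 = 0
  left : ∀ i < j, rep p i x i0 = 0
  right : ∀ i < j, rep p i x i1 = 0

theorem Flat.mono {p j k : ℕ} {x : sobolevInterval p} (h : Flat p k x) (hjk : j ≤ k) :
    Flat p j x :=
  ⟨h.V_eq, h.VJV_eq, fun i hi => h.left i (by omega), fun i hi => h.right i (by omega)⟩

theorem Flat.smul {p j : ℕ} {x : sobolevInterval p} (h : Flat p j x) (c : ℝ) :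
    Flat p j (c • x) :=
  ⟨by simp [h.V_eq], by simp [h.VJV_eq], fun i hi => by simp [h.left i hi],
    fun i hi => by simp [h.right i hi]⟩

/-- The class of smooth families of functions whose values at the end points do not change when
a flat element is added. -/
def FlatPred (p : ℕ) : ℕ → (sobolevInterval p → CI) → Prop := fun j F =>
  ContDiff ℝ ∞ F ∧ ∀ w x, Flat p j x → F (w + x) i0 = F w i0 ∧ F (w + x) i1 = F w i1

theorem isRingPred_flatPred (p : ℕ) : IsRingPred (FlatPred p) where
  succ j F h := ⟨h.1, fun w x hx => h.2 w x (hx.mono (Nat.le_succ j))⟩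
  add j F F' h h' := ⟨h.1.add h'.1, fun w x hx => by
    simp [h.2 w x hx, h'.2 w x hx]⟩
  smul j c F h := ⟨h.1.const_smul c, fun w x hx => by simp [h.2 w x hx]⟩
  mul j F F' h h' := ⟨h.1.mul h'.1, fun w x hx => by
    simp [h.2 w x hx, h'.2 w x hx]⟩
  cexp j F h := ⟨contDiff_cexp.comp h.1, fun w x hx => by simp [h.2 w x hx]⟩

/-- At the end points, the `j`-th derivative of the nonlinear part is a function of `r`, `r'` and
the derivatives of `u` of order less than `j`. This is the triangularity on which the periodic case
rests. -/
theorem tower_kepK_flatPred (p : ℕ) : Tower p (FlatPred p) fun u => kepK (pot p u) := by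
  refine tower_kepK le_rfl (isRingPred_flatPred p) ⟨(V.comp (pot p)).contDiff, fun w x hx => ?_⟩
    ⟨(VJ.comp (V.comp (pot p))).contDiff, fun w x hx => ?_⟩ fun i _ =>
    ⟨((rep p i).comp (sobolevInterval p).subtypeL).contDiff, fun w x hx => ?_⟩
  · simp [hx.V_eq]
  · simp [hx.VJV_eq]
  · simp [hx.left i (Nat.lt_succ_self i), hx.right i (Nat.lt_succ_self i)]

/-- The derivatives of the nonlinear part of the Kepler transform. -/
def kepD (p : ℕ) : ℕ → sobolevInterval p → CI := (tower_kepK_flatPred p).exists_seq.choose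

theorem kepD_zero (p : ℕ) (u : sobolevInterval p) : kepD p 0 u = kepK (pot p u) :=
  congrFun (tower_kepK_flatPred p).exists_seq.choose_spec.1 u

theorem flatPred_kepD {p j : ℕ} (hj : j ≤ p) : FlatPred p j (kepD p j) :=
  (tower_kepK_flatPred p).exists_seq.choose_spec.2.1 j hj

theorem isDeriv_kepD (p : ℕ) (u : sobolevInterval p) :
    ∀ j < p, IsDeriv (kepD p j u) (kepD p (j + 1) u) :=
  (tower_kepK_flatPred p).exists_seq.choose_spec.2.2 u

/-- The Kepler transform on `H^p`. -/
def kepTp (p : ℕ) (u : sobolevInterval p) : sobolevInterval p :=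
  -(2⁻¹ : ℝ) • u + ofSeq p (fun j => kepD p j u) (isDeriv_kepD p u)

theorem pot_kepTp (p : ℕ) (u : sobolevInterval p) : pot p (kepTp p u) = kepT (pot p u) := by
  rw [kepTp, map_add, map_smul, pot_apply p (ofSeq _ _ _), compo_ofSeq (Nat.zero_le p), kepD_zero]
  rfl

theorem contDiff_kepTp (p : ℕ) : ContDiff ℝ ∞ (kepTp p) :=
  (contDiff_id.const_smul _).add (contDiff_ofSeq (fun _ hj => (flatPred_kepD hj).1) _)

theorem rep_kepTp {p j : ℕ} (hj : j < p) (u : sobolevInterval p) :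
    rep p j (kepTp p u) = -(2⁻¹ : ℝ) • rep p j u + kepD p j u := by
  rw [kepTp, Submodule.coe_add, map_add, rep_ofSeq hj, Submodule.coe_smul, map_smul]

theorem contDiff_bilinear {E F G X : Type*} [NormedAddCommGroup E] [NormedSpace ℝ E]
    [NormedAddCommGroup F] [NormedSpace ℝ F] [NormedAddCommGroup G] [NormedSpace ℝ G]
    [NormedAddCommGroup X] [NormedSpace ℝ X] {n : WithTop ℕ∞} (B : E →L[ℝ] F →L[ℝ] G) {f : X → E}
    {g : X → F} (hf : ContDiff ℝ n f) (hg : ContDiff ℝ n g) :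
    ContDiff ℝ n fun x => B (f x) (g x) :=
  B.isBoundedBilinearMap.contDiff.comp (hf.prodMk hg)

/-- The two equations `x' = y` and `y' = q x` are bootstrapped together: `n` derivatives of `x` and
`y` give one more, as long as `q` has enough of them. -/
theorem tower_sol {p n : ℕ} (hn : n ≤ p) {f c : CI} {a b : ℝ}
    (hf : ∀ q, IsSol q a b (sol q f) (c + V (M q (sol q f)))) :
    Tower n SmoothPred (fun q : sobolevInterval p => sol (pot p q) f) ∧
      Tower n SmoothPred (fun q : sobolevInterval p => c + V (M (pot p q) (sol (pot p q) f))) := by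
  have hs : ContDiff ℝ ∞ fun q : sobolevInterval p => sol (pot p q) f :=
    (contDiff_sol f).comp (pot p).contDiff
  have hM : ContDiff ℝ ∞ fun q : sobolevInterval p => M (pot p q) (sol (pot p q) f) :=
    contDiff_bilinear M (pot p).contDiff hs
  have hs' : ContDiff ℝ ∞ fun q : sobolevInterval p => c + V (M (pot p q) (sol (pot p q) f)) :=
    contDiff_const.add (V.contDiff.comp hM)
  induction n with
  | zero => exact ⟨hs, hs'⟩
  | succ n ih =>
    obtain ⟨h1, h2⟩ := ih (by omega)
    refine ⟨⟨hs, _, fun q => (hf _).isDeriv, h2⟩, hs',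
      (fun q : sobolevInterval p => rep p 0 q) * fun q => sol (pot p q) f, fun q => ?_, Tower.mul isRingPred_smoothPred
        (tower_rep (j := 0) (by omega) fun i _ => ?_) h1⟩
    · change IsAC _ (J (rep p 0 q * sol (pot p q) f))
      rw [← M_J, J_rep_zero (by omega)]
      exact (hf _).isAC
    · exact ((rep p (0 + i)).comp (sobolevInterval p).subtypeL).contDiff

theorem tower_kepL (p : ℕ) : Tower p SmoothPred fun q : sobolevInterval p => kepL (pot p q) := by
  have hR := isRingPred_smoothPred (X := sobolevInterval p)
  obtain ⟨hx, hx'⟩ := tower_sol (le_refl p) (f := 1) (c := 0) (a := 1) (b := 0) fun q => by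
    have := isSol_sx q
    rwa [zero_add]
  simp only [zero_add] at hx'
  obtain ⟨hy, hy'⟩ := tower_sol (le_refl p) (f := VJ 1) (c := 1) (a := 0) (b := 1) isSol_sy
  have hρ : Tower p SmoothPred fun q : sobolevInterval p => srho (pot p q) :=
    (hx.mul hR hx).add hR (hy.mul hR hy)
  have hρ' : Tower p SmoothPred fun q : sobolevInterval p => srho' (pot p q) :=
    ((hx.mul hR hx').add hR (hy.mul hR hy')).smul hR 2
  have hk := tower_ringInverse hρ fun q => isUnit_srho (pot p q)
  have h1 := hρ'.mul hR hk
  exact ((h1.mul hR h1).smul hR _).sub hR ((hk.mul hR hk).smul hR _)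

theorem exists_kepSp (p : ℕ) : ∃ S : sobolevInterval p → sobolevInterval p,
    ContDiff ℝ ∞ S ∧ ∀ q, pot p (S q) = kepS (pot p q) := by
  obtain ⟨D, h0, h1, h2⟩ := (tower_kepL p).exists_seq
  refine ⟨fun q => -(2 : ℝ) • q + ofSeq p (fun j => D j q) (h2 q),
    (contDiff_id.const_smul _).add (contDiff_ofSeq h1 _), fun q => ?_⟩
  rw [map_add, map_smul, pot_apply p (ofSeq _ _ _), compo_ofSeq (Nat.zero_le p), h0]
  rfl

/-- A bijection that is smooth in both directions. -/
structure IsSmoothEquiv {E F : Type*} [NormedAddCommGroup E] [NormedSpace ℝ E]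
    [NormedAddCommGroup F] [NormedSpace ℝ F] (e : E ≃ F) : Prop where
  contDiff : ContDiff ℝ ∞ e
  contDiff_symm : ContDiff ℝ ∞ e.symm

theorem IsSmoothEquiv.trans {E F G : Type*} [NormedAddCommGroup E] [NormedSpace ℝ E]
    [NormedAddCommGroup F] [NormedSpace ℝ F] [NormedAddCommGroup G] [NormedSpace ℝ G] {e : E ≃ F}
    {e' : F ≃ G} (h : IsSmoothEquiv e) (h' : IsSmoothEquiv e') : IsSmoothEquiv (e.trans e') :=
  ⟨h'.contDiff.comp h.contDiff, h.contDiff_symm.comp h'.contDiff_symm⟩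

theorem IsSmoothEquiv.symm {E F : Type*} [NormedAddCommGroup E] [NormedSpace ℝ E]
    [NormedAddCommGroup F] [NormedSpace ℝ F] {e : E ≃ F}
    (h : IsSmoothEquiv e) : IsSmoothEquiv e.symm :=
  ⟨h.contDiff_symm, h.contDiff⟩

/-- The Kepler transform is a diffeomorphism of `H^p`. -/
theorem exists_equiv_kepTp (p : ℕ) : ∃ e : sobolevInterval p ≃ sobolevInterval p,
    IsSmoothEquiv e ∧ ∀ u, e u = kepTp p u := by
  obtain ⟨S, hS, hS'⟩ := exists_kepSp p
  refine ⟨⟨kepTp p, S, fun u => pot_injective p ?_, fun q => pot_injective p ?_⟩,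
    ⟨contDiff_kepTp p, hS⟩, fun _ => rfl⟩
  · rw [hS', pot_kepTp, kepS_kepT]
  · rw [pot_kepTp, hS', kepT_kepS]

/-! ### Hilbert spaces -/

/-- Distinct orthonormal vectors are at distance `√2`, so balls of radius `1 / 2` around them are
disjoint open sets, of which a separable space has only countably many. -/
theorem exists_hilbertBasis_nat (E : Type*) [NormedAddCommGroup E] [InnerProductSpace ℝ E]
    [CompleteSpace E] [TopologicalSpace.SeparableSpace E] (hE : ¬ FiniteDimensional ℝ E) :
    Nonempty (HilbertBasis ℕ ℝ E) := by
  obtain ⟨w, b, hb⟩ := exists_hilbertBasis ℝ E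
  have hdist : ∀ i j : w, i ≠ j → 1 ≤ dist (b i) (b j) := fun i j hij => by
    have h1 : ‖b i - b j‖ ^ 2 = 2 := by
      rw [norm_sub_sq_real, b.orthonormal.1 i, b.orthonormal.1 j, b.orthonormal.2 hij]
      norm_num
    rw [dist_eq_norm]
    nlinarith [norm_nonneg (b i - b j)]
  have hc : Countable w := by
    refine Pairwise.countable_of_isOpen_disjoint (s := fun i : w => Metric.ball (b i) (1 / 2))
      (fun i j hij => Metric.ball_disjoint_ball (by linarith [hdist i j hij]))
      (fun i => Metric.isOpen_ball) fun i => ⟨b i, Metric.mem_ball_self (by norm_num)⟩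
  have hi : Infinite w := by
    by_contra h
    rw [not_infinite_iff_finite] at h
    have := Fintype.ofFinite w
    exact hE b.toOrthonormalBasis.toBasis.finiteDimensional_of_finite
  obtain ⟨hd⟩ := nonempty_denumerable w
  have e := (Denumerable.eqv w).symm
  refine ⟨HilbertBasis.mk (v := b ∘ e) (b.orthonormal.comp e e.injective) ?_⟩
  rw [e.surjective.range_comp, b.dense_span]

theorem nonempty_linearIsometryEquiv (E F : Type*) [NormedAddCommGroup E] [InnerProductSpace ℝ E]
    [CompleteSpace E] [TopologicalSpace.SeparableSpace E] (hE : ¬ FiniteDimensional ℝ E)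
    [NormedAddCommGroup F] [InnerProductSpace ℝ F]
    [CompleteSpace F] [TopologicalSpace.SeparableSpace F] (hF : ¬ FiniteDimensional ℝ F) :
    Nonempty (E ≃ₗᵢ[ℝ] F) := by
  obtain ⟨b⟩ := exists_hilbertBasis_nat E hE
  obtain ⟨c⟩ := exists_hilbertBasis_nat F hF
  exact ⟨b.repr.trans c.repr.symm⟩

/-! ### Straightening -/

/-- Invertible derivatives make the bijection open, hence a homeomorphism; the inverse function
theorem then makes the inverse smooth. -/
theorem isSmoothEquiv_of_bijective {E F : Type*} [NormedAddCommGroup E] [NormedSpace ℝ E]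
    [CompleteSpace E] [NormedAddCommGroup F] [NormedSpace ℝ F] (e : E ≃ F)
    (he : ContDiff ℝ ∞ e) (L : E → E ≃L[ℝ] F)
    (hL : ∀ x, HasFDerivAt e (L x : E →L[ℝ] F) x) : IsSmoothEquiv e := by
  have hs : ∀ x, HasStrictFDerivAt e (L x : E →L[ℝ] F) x := fun x =>
    he.contDiffAt.hasStrictFDerivAt' (hL x) (by simp)
  have ho : IsOpenMap e := isOpenMap_of_hasStrictFDerivAt_equiv hs
  exact ⟨he, (e.toHomeomorphOfContinuousOpen he.continuous ho).contDiff_symm hL he⟩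

/-- A function on `ℝ × Z` whose partial functions on `ℝ` are bijective with non-zero derivatives
can be taken as a new first coordinate. -/
theorem exists_equiv_first_coord {Z : Type*} [NormedAddCommGroup Z] [NormedSpace ℝ Z]
    [CompleteSpace Z] (g : ℝ × Z → ℝ) (hg : ContDiff ℝ ∞ g)
    (hb : ∀ z, Function.Bijective fun s => g (s, z))
    (hd : ∀ s z, deriv (fun s => g (s, z)) s ≠ 0) :
    ∃ e : ℝ × Z ≃ ℝ × Z, IsSmoothEquiv e ∧ ∀ x, e x = (g x, x.2) := by
  have hbij : Function.Bijective fun x : ℝ × Z => (g x, x.2) := by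
    constructor
    · rintro ⟨s, z⟩ ⟨s', z'⟩ h
      obtain ⟨h1, rfl⟩ := Prod.mk.inj h
      rw [(hb z).1 h1]
    · rintro ⟨s, z⟩
      obtain ⟨s', hs'⟩ := (hb z).2 s
      exact ⟨(s', z), Prod.ext hs' rfl⟩
  have hdiff : Differentiable ℝ g := hg.differentiable (by simp)
  have hd' : ∀ x, fderiv ℝ g x (1, 0) ≠ 0 := fun x => by
    have h1 : HasDerivAt (fun s : ℝ => (s, x.2)) ((1 : ℝ), (0 : Z)) x.1 :=
      (hasDerivAt_id x.1).prodMk (hasDerivAt_const _ _)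
    have h2 := (hdiff (x.1, x.2)).hasFDerivAt.comp_hasDerivAt x.1 h1
    have h3 := hd x.1 x.2
    rwa [show deriv (fun s => g (s, x.2)) x.1 = _ from h2.deriv] at h3
  have hlin : ∀ (x : ℝ × Z) (s : ℝ) (z : Z),
      fderiv ℝ g x (s, z) = s * fderiv ℝ g x (1, 0) + fderiv ℝ g x (0, z) := fun x s z => by
    rw [← smul_eq_mul, ← map_smul, ← map_add]
    simp
  -- The derivative of `(s, z) ↦ (g (s, z), z)` is triangular, with diagonal entries `∂g/∂s ≠ 0` and
  -- the identity; its inverse is written out.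
  refine ⟨Equiv.ofBijective _ hbij, isSmoothEquiv_of_bijective _ (hg.prodMk contDiff_snd)
    (fun x => ContinuousLinearEquiv.equivOfInverse
      ((fderiv ℝ g x).prod (ContinuousLinearMap.snd ℝ ℝ Z))
      (((fderiv ℝ g x (1, 0))⁻¹ • (ContinuousLinearMap.fst ℝ ℝ Z -
        (fderiv ℝ g x).comp ((0 : ℝ × Z →L[ℝ] ℝ).prod (ContinuousLinearMap.snd ℝ ℝ Z)))).prod
        (ContinuousLinearMap.snd ℝ ℝ Z)) ?_ ?_) ?_, fun _ => rfl⟩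
  · rintro ⟨s, z⟩
    refine Prod.ext ?_ rfl
    have := hd' x
    simp
    rw [hlin x s z]
    field_simp
    ring
  · rintro ⟨s, z⟩
    refine Prod.ext ?_ rfl
    have := hd' x
    simp
    rw [hlin]
    field_simp
    ring
  · intro x
    exact (hdiff x).hasFDerivAt.prodMk hasFDerivAt_snd

/-! ### The total angle -/

theorem cexp_add (f g : CI) : cexp (f + g) = cexp f * cexp g := by
  ext t
  exact Real.exp_add _ _

/-- The integral over `[0, 2π]`. -/
def total : CI →L[ℝ] ℝ := (ev i1).comp VJ

theorem total_eq (f : CI) : total f = ∫ s in (0 : ℝ)..2 * Real.pi, ext f s := VJ_eq f i1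

theorem total_pos {f : CI} (hf : ∀ t : II, (t : ℝ) ∈ Ioo 0 (2 * Real.pi) → 0 < f t) :
    0 < total f := by
  rw [total_eq]
  refine intervalIntegral.intervalIntegral_pos_of_pos_on
    ((continuous_ext f).intervalIntegrable _ _) (fun s hs => ?_) (by positivity)
  rw [ext_of_mem f (Ioo_subset_Icc_self hs)]
  exact hf ⟨s, Ioo_subset_Icc_self hs⟩ hs

theorem total_cexp_pos (f : CI) : 0 < total (cexp f) := total_pos fun _ _ => Real.exp_pos _

theorem total_mono {f g : CI} (h : ∀ t, f t ≤ g t) : total f ≤ total g := by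
  rw [total_eq, total_eq]
  exact intervalIntegral.integral_mono_on zero_le_two_pi
    ((continuous_ext f).intervalIntegrable _ _) ((continuous_ext g).intervalIntegrable _ _)
    fun s _ => h _

/-- The logarithm of the integral of the exponential. -/
def logTotal (f : CI) : ℝ := Real.log (total (cexp f))

theorem contDiff_logTotal : ContDiff ℝ ∞ logTotal :=
  (total.contDiff.comp contDiff_cexp).log fun f => (total_cexp_pos f).ne'

theorem hasDerivAt_logTotal (f b : CI) (s : ℝ) :
    HasDerivAt (fun s : ℝ => logTotal (f + s • b))
      (total (cexp (f + s • b) * b) / total (cexp (f + s • b))) s := by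
  have h1 : HasDerivAt (fun s : ℝ => cexp (f + s • b)) (cexp (f + s • b) * b) s := by
    have h2 : HasDerivAt (fun s : ℝ => cexp (s • b)) (cexp (s • b) * b) s := by
      rw [cexp_eq_exp]
      exact hasDerivAt_exp_smul_const b s
    have h3 := h2.const_mul (cexp f)
    simp only [← cexp_add] at h3
    rwa [← mul_assoc, ← cexp_add] at h3
  exact (total.hasFDerivAt.comp_hasDerivAt s h1).log (total_cexp_pos _).ne'

/-- The inequality `exp x ≥ 1 + x` bounds the integral below by an affine function of `s` with slope
`∫ b > 0`. -/
theorem tendsto_logTotal_atTop (f : CI) {b : CI}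
    (hb : ∀ t : II, (t : ℝ) ∈ Ioo 0 (2 * Real.pi) → 0 < b t) :
    Filter.Tendsto (fun s : ℝ => logTotal (f + s • b)) Filter.atTop Filter.atTop := by
  refine Real.tendsto_log_atTop.comp ?_
  have h1 : Filter.Tendsto (fun s : ℝ => total (1 + f) + s * total b) Filter.atTop
      Filter.atTop :=
    Filter.tendsto_atTop_add_const_left _ _ (Filter.tendsto_id.atTop_mul_const (total_pos hb))
  refine Filter.tendsto_atTop_mono (fun s => ?_) h1
  rw [← smul_eq_mul, ← map_smul, ← map_add]
  refine total_mono fun t => ?_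
  have := Real.add_one_le_exp ((f + s • b) t)
  simp only [ContinuousMap.add_apply, ContinuousMap.smul_apply, ContinuousMap.one_apply,
    cexp_apply, smul_eq_mul] at this ⊢
  linarith

theorem nonneg_of_pos_Ioo {b : CI} (hb : ∀ t : II, (t : ℝ) ∈ Ioo 0 (2 * Real.pi) → 0 < b t)
    (t : ℝ) : 0 ≤ ext b t := by
  have h1 : closure (Ioo 0 (2 * Real.pi)) ⊆ {t | 0 ≤ ext b t} := by
    refine closure_minimal (fun s hs => ?_) (isClosed_le continuous_const (continuous_ext b))
    have hs' := Ioo_subset_Icc_self hs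
    change 0 ≤ ext b s
    rw [ext_of_mem b hs']
    exact (hb ⟨s, hs'⟩ hs).le
  rw [closure_Ioo (by positivity)] at h1
  have h2 := h1 (projIcc 0 (2 * Real.pi) zero_le_two_pi t).2
  rw [mem_ofPred_eq, ext_coe] at h2
  exact h2

/-- Dominated convergence: for `s ≤ 0` the integrand is at most `exp f`, and it tends to 0 wherever
`b` is positive, that is, off the end points. -/
theorem tendsto_logTotal_atBot (f : CI) {b : CI}
    (hb : ∀ t : II, (t : ℝ) ∈ Ioo 0 (2 * Real.pi) → 0 < b t) :
    Filter.Tendsto (fun s : ℝ => logTotal (f + s • b)) Filter.atBot Filter.atBot := by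
  refine Real.tendsto_log_nhdsGT_zero.comp (tendsto_nhdsWithin_iff.2 ⟨?_,
    Filter.Eventually.of_forall fun s => total_cexp_pos _⟩)
  simp only [total_eq]
  rw [show nhds (0 : ℝ) = nhds (∫ s in (0 : ℝ)..2 * Real.pi, (0 : ℝ)) by simp]
  refine intervalIntegral.tendsto_integral_filter_of_dominated_convergence
    (fun t => Real.exp (ext f t)) ?_ ?_ ?_ ?_
  · exact Filter.Eventually.of_forall fun s => (continuous_ext _).aestronglyMeasurable
  · filter_upwards [Filter.eventually_le_atBot (0 : ℝ)] with s hs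
    refine Filter.Eventually.of_forall fun t _ => ?_
    rw [Real.norm_eq_abs, ext_apply, cexp_apply, Real.abs_exp]
    have h1 : s * ext b t ≤ 0 := mul_nonpos_of_nonpos_of_nonneg hs (nonneg_of_pos_Ioo hb t)
    refine Real.exp_le_exp.2 ?_
    change ext f t + s * ext b t ≤ _
    linarith
  · exact (Real.continuous_exp.comp (continuous_ext f)).intervalIntegrable _ _
  · have h1 : ∀ᵐ t : ℝ, t ≠ 2 * Real.pi := by simp [ae_iff, measure_singleton]
    filter_upwards [h1] with t ht hI
    rw [uIoc_of_le zero_le_two_pi] at hI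
    have hIoo : t ∈ Ioo 0 (2 * Real.pi) := ⟨hI.1, lt_of_le_of_ne hI.2 ht⟩
    have h2 : 0 < ext b t := by
      rw [ext_of_mem b (Ioo_subset_Icc_self hIoo)]
      exact hb _ hIoo
    have h3 : Filter.Tendsto (fun s : ℝ => ext f t + s * ext b t) Filter.atBot Filter.atBot :=
      Filter.tendsto_atBot_add_const_left _ _ (Filter.tendsto_id.atBot_mul_const h2)
    exact Real.tendsto_exp_atBot.comp h3

theorem deriv_logTotal_pos (f : CI) {b : CI}
    (hb : ∀ t : II, (t : ℝ) ∈ Ioo 0 (2 * Real.pi) → 0 < b t) (s : ℝ) :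
    0 < deriv (fun s : ℝ => logTotal (f + s • b)) s := by
  rw [(hasDerivAt_logTotal f b s).deriv]
  exact div_pos (total_pos fun t ht => mul_pos (Real.exp_pos _) (hb t ht)) (total_cexp_pos _)

theorem bijective_logTotal (f : CI) {b : CI}
    (hb : ∀ t : II, (t : ℝ) ∈ Ioo 0 (2 * Real.pi) → 0 < b t) :
    Function.Bijective fun s : ℝ => logTotal (f + s • b) :=
  ⟨(strictMono_of_deriv_pos (deriv_logTotal_pos f hb)).injective,
    Continuous.surjective
      (continuous_iff_continuousAt.2 fun s => (hasDerivAt_logTotal f b s).continuousAt)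
      (tendsto_logTotal_atTop f hb) (tendsto_logTotal_atBot f hb)⟩

/-! ### The product structure -/

/-- The last change of coordinates. -/
def coordsEquiv (H : Type*) : ℝ × (ℝ × ℝ × H) ≃ EuclideanSpace ℝ (Fin 3) × H where
  toFun x := (!₂[x.1, -x.2.1, -(x.2.2.1 * Real.exp (-x.2.1))], x.2.2.2)
  invFun y := (y.1 0, -y.1 1, -(y.1 2 * Real.exp (-y.1 1)), y.2)
  left_inv x := by
    simp [mul_assoc, ← Real.exp_add]
  right_inv y := by
    refine Prod.ext ?_ rfl
    ext i
    fin_cases i <;> simp [mul_assoc, ← Real.exp_add]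

theorem isSmoothEquiv_coordsEquiv (H : Type*) [NormedAddCommGroup H] [NormedSpace ℝ H] :
    IsSmoothEquiv (coordsEquiv H) := by
  constructor
  · refine ContDiff.prodMk ?_ (by fun_prop)
    rw [contDiff_piLp]
    intro i
    fin_cases i
    · exact contDiff_fst
    · exact (contDiff_fst.comp contDiff_snd).neg
    · exact (((contDiff_fst.comp (contDiff_snd.comp contDiff_snd))).mul
        (Real.contDiff_exp.comp (contDiff_fst.comp contDiff_snd).neg)).neg
  · have h : ∀ i : Fin 3, ContDiff ℝ ∞ fun y : EuclideanSpace ℝ (Fin 3) × H => y.1 i := fun i =>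
      (contDiff_piLp 2).1 contDiff_fst i
    exact (h 0).prodMk ((h 1).neg.prodMk (((h 2).mul (Real.contDiff_exp.comp (h 1).neg)).neg.prodMk
      contDiff_snd))

section Product

variable {Y H : Type*} [NormedAddCommGroup Y] [InnerProductSpace ℝ Y] [CompleteSpace Y]
  [TopologicalSpace.SeparableSpace Y] [NormedAddCommGroup H] [InnerProductSpace ℝ H]
  [CompleteSpace H] [TopologicalSpace.SeparableSpace H]

/-- The functional `m` is dual to `β`. Removing the `β` component from `f₁` and `f₂` gives a basis
dual to `(m, l₁, l₂)`, and the common kernel `N` is identified with `H`. -/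
theorem exists_adapted_equiv (hY : ¬ FiniteDimensional ℝ Y) (hH : ¬ FiniteDimensional ℝ H)
    {l₁ l₂ : Y →L[ℝ] ℝ} {β f₁ f₂ : Y} (hβ : β ≠ 0) (h₁β : l₁ β = 0) (h₂β : l₂ β = 0)
    (h₁₁ : l₁ f₁ = 1) (h₁₂ : l₁ f₂ = 0) (h₂₁ : l₂ f₁ = 0) (h₂₂ : l₂ f₂ = 1) :
    ∃ e : Y ≃L[ℝ] ℝ × (ℝ × ℝ × H), (∀ y, (e y).2.1 = l₁ y) ∧ (∀ y, (e y).2.2.1 = l₂ y) ∧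
      e β = (1, 0) := by
  set m : Y →L[ℝ] ℝ := (‖β‖ ^ 2)⁻¹ • innerSL ℝ β with hm
  have hβ' : ‖β‖ ^ 2 ≠ 0 := by simpa using hβ
  have hmβ : m β = 1 := by
    simp [hm, hβ']
  set g₁ := f₁ - m f₁ • β with hg₁
  set g₂ := f₂ - m f₂ • β with hg₂
  have e11 : l₁ g₁ = 1 := by simp [hg₁, h₁β, h₁₁]
  have e12 : l₁ g₂ = 0 := by simp [hg₂, h₁β, h₁₂]
  have e21 : l₂ g₁ = 0 := by simp [hg₁, h₂β, h₂₁]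
  have e22 : l₂ g₂ = 1 := by simp [hg₂, h₂β, h₂₂]
  have em1 : m g₁ = 0 := by simp [hg₁, hmβ]
  have em2 : m g₂ = 0 := by simp [hg₂, hmβ]
  set Λ : Y →L[ℝ] ℝ × ℝ × ℝ := m.prod (l₁.prod l₂) with hΛ
  have hmem : ∀ y, y ∈ Λ.ker ↔ m y = 0 ∧ l₁ y = 0 ∧ l₂ y = 0 := fun y => by
    simp [hΛ]
  set N : Submodule ℝ Y := Λ.ker with hN
  have hNc : IsClosed (N : Set Y) := Λ.isClosed_ker
  have : CompleteSpace N := hNc.completeSpace_coe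
  -- The quotient by `N` is isomorphic to a subspace of `ℝ × ℝ × ℝ`, so a finite-dimensional `N`
  -- would force `Y` to be finite-dimensional.
  have hNi : ¬ FiniteDimensional ℝ N := fun h => by
    refine hY ?_
    have h1 : FiniteDimensional ℝ (Y ⧸ N) :=
      Module.Finite.equiv (LinearMap.quotKerEquivRange (Λ : Y →ₗ[ℝ] ℝ × ℝ × ℝ)).symm
    exact Module.Finite.of_submodule_quotient N
  obtain ⟨φ⟩ := nonempty_linearIsometryEquiv N H hNi hH
  set P₀ : Y →L[ℝ] Y := ContinuousLinearMap.id ℝ Y - m.smulRight β - l₁.smulRight g₁ -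
    l₂.smulRight g₂ with hP₀
  have hP₀' : ∀ y, P₀ y = y - m y • β - l₁ y • g₁ - l₂ y • g₂ := fun y => rfl
  set P : Y →L[ℝ] N := P₀.codRestrict N fun y => by
    rw [hmem, hP₀']
    simp [hmβ, em1, em2, e11, e12, e21, e22, h₁β, h₂β] with hP
  refine ⟨ContinuousLinearEquiv.equivOfInverse
    (m.prod (l₁.prod (l₂.prod ((φ : N →L[ℝ] H).comp P))))
    (((ContinuousLinearMap.fst ℝ ℝ (ℝ × ℝ × H)).smulRight β) +
      ((ContinuousLinearMap.fst ℝ ℝ (ℝ × H)).comp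
        (ContinuousLinearMap.snd ℝ ℝ (ℝ × ℝ × H))).smulRight g₁ +
      ((ContinuousLinearMap.fst ℝ ℝ H).comp ((ContinuousLinearMap.snd ℝ ℝ (ℝ × H)).comp
        (ContinuousLinearMap.snd ℝ ℝ (ℝ × ℝ × H)))).smulRight g₂ +
      (N.subtypeL.comp (φ.symm : H →L[ℝ] N)).comp
      ((ContinuousLinearMap.snd ℝ ℝ H).comp ((ContinuousLinearMap.snd ℝ ℝ (ℝ × H)).comp
        (ContinuousLinearMap.snd ℝ ℝ (ℝ × ℝ × H))))) ?_ ?_, fun _ => rfl, fun _ => rfl, ?_⟩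
  · intro y
    have : ((P y : N) : Y) = P₀ y := rfl
    simp [this, hP₀']
  · rintro ⟨s, a, b, h⟩
    have hn := (hmem _).1 (φ.symm h).2
    have hPn : ∀ n : N, P (s • β + a • g₁ + b • g₂ + n) = n := fun n => by
      have hn := (hmem _).1 n.2
      apply Subtype.ext
      change P₀ _ = _
      rw [hP₀']
      simp [hn.1, hn.2.1, hn.2.2, hmβ, em1, em2, e11, e12, e21, e22, h₁β, h₂β]
      abel
    simp [hn.1, hn.2.1, hn.2.2, hmβ, em1, em2, e11, e12, e21, e22, h₁β, h₂β, hPn]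
  · have hPβ : P β = 0 := by
      apply Subtype.ext
      change P₀ _ = _
      rw [hP₀']
      simp [hmβ, h₁β, h₂β]
    simp [hPβ, hmβ, h₁β, h₂β, Prod.ext_iff]

/-- The abstract form of the straightening, shared by the interval and the circle: `B y` plays the
role of `r`, `l₁` of `r(2π)` and `l₂` of `r'(2π)`. Moving along `β` changes `B` by multiples of `b`
only, so `logTotal ∘ B` can replace the coordinate along `β`. -/
theorem exists_product_equiv (hY : ¬ FiniteDimensional ℝ Y) (hH : ¬ FiniteDimensional ℝ H)
    {l₁ l₂ : Y →L[ℝ] ℝ} {β f₁ f₂ : Y} (h₁β : l₁ β = 0) (h₂β : l₂ β = 0)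
    (h₁₁ : l₁ f₁ = 1) (h₁₂ : l₁ f₂ = 0) (h₂₁ : l₂ f₁ = 0) (h₂₂ : l₂ f₂ = 1)
    {B : Y → CI} (hB : ContDiff ℝ ∞ B) {b : CI}
    (hb : ∀ t : II, (t : ℝ) ∈ Ioo 0 (2 * Real.pi) → 0 < b t)
    (hBb : ∀ y (s : ℝ), B (y + s • β) = B y + s • b) :
    ∃ Θ : Y ≃ EuclideanSpace ℝ (Fin 3) × H, IsSmoothEquiv Θ ∧ ∀ y,
      (Θ y).1 = !₂[logTotal (B y), -l₁ y, -(l₂ y * Real.exp (-l₁ y))] := by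
  have hβ : β ≠ 0 := by
    rintro rfl
    have h := hBb 0 1
    rw [smul_zero, add_zero, one_smul, left_eq_add] at h
    have hpi : Real.pi ∈ Ioo 0 (2 * Real.pi) := ⟨Real.pi_pos, by linarith [Real.pi_pos]⟩
    have := hb ⟨Real.pi, Ioo_subset_Icc_self hpi⟩ hpi
    simp [h] at this
  obtain ⟨e, he1, he2, heβ⟩ := exists_adapted_equiv hY hH hβ h₁β h₂β h₁₁ h₁₂ h₂₁ h₂₂
  have hsymm : ∀ (s : ℝ) z, B (e.symm (s, z)) = B (e.symm (0, z)) + s • b := fun s z => by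
    rw [← hBb]
    congr 1
    rw [e.symm_apply_eq, map_add, map_smul, heβ, e.apply_symm_apply]
    simp
  have hpart : ∀ z, (fun s : ℝ => logTotal (B (e.symm (s, z)))) =
      fun s => logTotal (B (e.symm (0, z)) + s • b) := fun z => by
    funext s
    rw [hsymm]
  obtain ⟨d, hd, hd'⟩ := exists_equiv_first_coord (fun x => logTotal (B (e.symm x)))
    (contDiff_logTotal.comp (hB.comp e.symm.contDiff))
    (fun z => by
      rw [hpart]
      exact bijective_logTotal _ hb)
    (fun s z => by
      rw [hpart]
      exact (deriv_logTotal_pos _ hb s).ne')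
  refine ⟨(e.toEquiv.trans d).trans (coordsEquiv H),
    (IsSmoothEquiv.trans ⟨e.contDiff, e.symm.contDiff⟩ hd).trans
      (isSmoothEquiv_coordsEquiv H),
    fun y => ?_⟩
  change (coordsEquiv H (d (e y))).1 = _
  rw [hd', e.symm_apply_apply, coordsEquiv]
  simp [he1, he2]

end Product

/-! ### Polynomials -/

section Polynomials

open Polynomial

/-- A polynomial as a continuous function on `[0, 2π]`. -/
def polyC (Q : ℝ[X]) : CI := ⟨fun t => Q.eval (t : ℝ), Q.continuous.comp continuous_subtype_val⟩

theorem polyC_apply (Q : ℝ[X]) (t : II) : polyC Q t = Q.eval (t : ℝ) := rfl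

theorem isDeriv_polyC (Q : ℝ[X]) : IsDeriv (polyC Q) (polyC (derivative Q)) :=
  isDeriv_of_hasDerivAt (fun t => Q.eval t) (fun _ => rfl) fun t => Q.hasDerivAt t

/-- A polynomial as an element of a Sobolev space. -/
def polySob (p : ℕ) (Q : ℝ[X]) : sobolevInterval p :=
  ofSeq p (fun j => polyC (derivative^[j] Q)) fun j _ => by
    rw [Function.iterate_succ_apply']
    exact isDeriv_polyC _

theorem rep_polySob {p j : ℕ} (hj : j < p) (Q : ℝ[X]) :
    rep p j (polySob p Q) = polyC (derivative^[j] Q) := rep_ofSeq hj _ _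

theorem pot_polySob (p : ℕ) (Q : ℝ[X]) : pot p (polySob p Q) = J (polyC Q) :=
  compo_ofSeq (Nat.zero_le p) (fun j => polyC (derivative^[j] Q)) fun j _ => by
    rw [Function.iterate_succ_apply']
    exact isDeriv_polyC _

/-- The linear map `Q ↦ polySob p (R * Q)`. -/
def polySobL (p : ℕ) (R : ℝ[X]) : ℝ[X] →ₗ[ℝ] sobolevInterval p where
  toFun Q := polySob p (R * Q)
  map_add' Q Q' := pot_injective p (by
    rw [map_add, pot_polySob, pot_polySob, pot_polySob, ← map_add]
    congr 1
    ext t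
    simp [polyC_apply, mul_add])
  map_smul' c Q := pot_injective p (by
    rw [map_smul, pot_polySob, pot_polySob, ← map_smul]
    congr 1
    ext t
    simp [polyC_apply])

theorem polySobL_injective (p : ℕ) {R : ℝ[X]} (hR : R ≠ 0) :
    Function.Injective (polySobL p R) := by
  rw [injective_iff_map_eq_zero]
  intro Q hQ
  have h1 : J (polyC (R * Q)) = 0 := by
    rw [← pot_polySob p]
    change pot p (polySobL p R Q) = 0
    rw [hQ, map_zero]
  have h2 : polyC (R * Q) = 0 := J_injective (h1.trans (map_zero J).symm)
  have h3 : R * Q = 0 := by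
    refine Polynomial.eq_zero_of_infinite_isRoot _ ((Icc_infinite (a := 0)
      (b := 2 * Real.pi) (by positivity)).mono fun t ht => ?_)
    exact DFunLike.congr_fun h2 ⟨t, ht⟩
  exact (mul_eq_zero.1 h3).resolve_left hR

theorem V_pot_polySob (p : ℕ) {Q : ℝ[X]} (h : (derivative Q).eval 0 = 0) :
    V (pot p (polySob p (derivative^[2] Q))) = polyC (derivative Q) := by
  rw [pot_polySob]
  exact (isAC_V _).eq_of (isDeriv_polyC (derivative Q)) (by simp [polyC_apply, h])

theorem VJ_V_pot_polySob (p : ℕ) {Q : ℝ[X]} (h0 : Q.eval 0 = 0)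
    (h : (derivative Q).eval 0 = 0) :
    VJ (V (pot p (polySob p (derivative^[2] Q)))) = polyC Q := by
  rw [V_pot_polySob p h]
  exact (isDeriv_VJ _).eq_of (isDeriv_polyC Q) (by simp [polyC_apply, h0])

theorem eval_iterate_derivative_eq_zero {Q : ℝ[X]} {c : ℝ} {n i : ℕ} (h : (X - C c) ^ n ∣ Q)
    (hi : i < n) : (derivative^[i] Q).eval c = 0 := by
  have h1 := pow_sub_dvd_iterate_derivative_of_pow_dvd i h
  have h2 : X - C c ∣ derivative^[i] Q := (dvd_pow_self _ (by omega)).trans h1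
  exact dvd_iff_isRoot.1 h2

theorem eval_iterate_derivative_pow (c : ℝ) (k i : ℕ) :
    (derivative^[i] ((X - C c) ^ k)).eval c = if i = k then (k.factorial : ℝ) else 0 := by
  rw [iterate_derivative_X_sub_pow]
  split_ifs with h
  · rw [h, Nat.descFactorial_self]
    simp
  · rcases lt_or_gt_of_ne h with h | h
    · simp [Nat.sub_ne_zero_of_lt h]
    · simp [Nat.descFactorial_of_lt h]

/-- Hermite interpolation. -/
theorem exists_hermite {c : ℝ} (hc : c ≠ 0) (n k : ℕ) : ∃ Q : ℝ[X],
    (∀ i < n, (derivative^[i] Q).eval 0 = 0) ∧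
      ∀ i < n, (derivative^[i] Q).eval c = if i = k then 1 else 0 := by
  have hco : IsCoprime ((X - C (0 : ℝ)) ^ n) ((X - C c) ^ n) := by
    apply IsCoprime.pow
    exact isCoprime_X_sub_C_of_isUnit_sub (by simpa using hc)
  obtain ⟨a, b, hab⟩ := hco
  set R : ℝ[X] := C ((k.factorial : ℝ)⁻¹) * (X - C c) ^ k with hR
  refine ⟨a * (X - C 0) ^ n * R, fun i hi => eval_iterate_derivative_eq_zero
    (Dvd.intro_left _ (by ring : a * R * (X - C 0) ^ n = _)) hi, fun i hi => ?_⟩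
  -- By the Bézout identity the polynomial is `R` modulo `(X - c) ^ n` and 0 modulo `X ^ n`; this
  -- determines its first `n` derivatives at both points.
  have h1 : a * (X - C 0) ^ n * R = R + (X - C c) ^ n * (-(b * R)) := by
    linear_combination R * hab
  rw [h1, iterate_map_add, eval_add,
    eval_iterate_derivative_eq_zero (Dvd.intro _ rfl) hi, add_zero, hR,
    iterate_derivative_C_mul, eval_C_mul, eval_iterate_derivative_pow]
  have : (k.factorial : ℝ) ≠ 0 := by positivity
  split_ifs <;> simp [this]

theorem exists_bump {c : ℝ} (n : ℕ) : ∃ Q : ℝ[X],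
    (∀ i < n, (derivative^[i] Q).eval 0 = 0) ∧ (∀ i < n, (derivative^[i] Q).eval c = 0) ∧
      ∀ t ∈ Ioo 0 c, 0 < Q.eval t := by
  refine ⟨X ^ n * (C c - X) ^ n, fun i hi => eval_iterate_derivative_eq_zero (n := n) ?_ hi,
    fun i hi => eval_iterate_derivative_eq_zero (n := n) ?_ hi, fun t ht => ?_⟩
  · rw [C_0, sub_zero]
    exact dvd_mul_right _ _
  · rw [← neg_sub X, neg_pow, ← mul_assoc]
    exact dvd_mul_left _ _
  · have h1 := ht.1
    have h2 := sub_pos.2 ht.2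
    simp only [eval_mul, eval_pow, eval_X, eval_sub, eval_C]
    positivity

/-- The polynomial `Q` plays the role of `r` and its second derivative that of `u`; hence the shift
of all orders by 2. -/
theorem flat_polySob {p j : ℕ} (hj : j ≤ p) {Q : ℝ[X]}
    (h0 : ∀ i < p + 2, (derivative^[i] Q).eval 0 = 0)
    (h1 : ∀ i < j + 2, (derivative^[i] Q).eval (2 * Real.pi) = 0) :
    Flat p j (polySob p (derivative^[2] Q)) := by
  have e0 : Q.eval 0 = 0 := h0 0 (by omega)
  have e1 : (derivative Q).eval 0 = 0 := h0 1 (by omega)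
  refine ⟨?_, ?_, fun i hi => ?_, fun i hi => ?_⟩
  · rw [V_pot_polySob p e1]
    exact h1 1 (by omega)
  · rw [VJ_V_pot_polySob p e0 e1]
    exact h1 0 (by omega)
  · rw [rep_polySob (by omega), ← Function.iterate_add_apply]
    exact h0 (i + 2) (by omega)
  · rw [rep_polySob (by omega), ← Function.iterate_add_apply]
    exact h1 (i + 2) (by omega)

end Polynomials

/-! ### The periodicity conditions -/

/-- The jump of the `j`-th derivative. -/
def jump (p j : ℕ) : sobolevInterval p →L[ℝ] ℝ :=
  (ev i1 - ev i0).comp ((rep p j).comp (sobolevInterval p).subtypeL)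

theorem jump_apply (p j : ℕ) (u : sobolevInterval p) :
    jump p j u = rep p j u i1 - rep p j u i0 := rfl

theorem mem_sobolevCircle_iff_jump {p : ℕ} (u : sobolevInterval p) :
    (u : EP p) ∈ sobolevCircle p ↔ ∀ j < p, jump p j u = 0 := by
  rw [mem_sobolevCircle_iff]
  exact and_iff_right u.2

/-- The jump of the `j`-th derivative of the nonlinear part of the Kepler transform, times `-2`. -/
def kjump (p j : ℕ) (u : sobolevInterval p) : ℝ := -2 * (kepD p j u i1 - kepD p j u i0)

theorem contDiff_kjump {p j : ℕ} (hj : j ≤ p) : ContDiff ℝ ∞ (kjump p j) :=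
  contDiff_const.mul ((ev i1 - ev i0).contDiff.comp (flatPred_kepD hj).1)

theorem kjump_add {p j : ℕ} (hj : j ≤ p) (w : sobolevInterval p) {x : sobolevInterval p}
    (hx : Flat p j x) : kjump p j (w + x) = kjump p j w := by
  obtain ⟨h1, h2⟩ := (flatPred_kepD hj).2 w x hx
  rw [kjump, h1, h2, kjump]

/-- The factor `-2` in `kjump` undoes the coefficient `-1/2` of `u` in the transform. -/
theorem jump_kepTp {p j : ℕ} (hj : j < p) (u : sobolevInterval p) :
    jump p j u + kjump p j u = -2 * jump p j (kepTp p u) := by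
  rw [jump_apply, jump_apply, rep_kepTp hj, kjump]
  simp
  ring

/-- Hermite interpolation for `r` with a single non-zero datum at `2π`, the derivative of order `k +
2`. The element `e k` thus has unit jump at order `k` and is flat below it. -/
theorem exists_jump_basis (p : ℕ) : ∃ e : ℕ → sobolevInterval p, (∀ k ≤ p, Flat p k (e k)) ∧
    ∀ j < p, ∀ k, jump p j (e k) = if j = k then 1 else 0 := by
  choose Q h0 h1 using fun k => exists_hermite (c := 2 * Real.pi) (by positivity) (p + 2) (k + 2)
  refine ⟨fun k => polySob p (Polynomial.derivative^[2] (Q k)), fun k hk =>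
    flat_polySob hk (h0 k) fun i hi => ?_, fun j hj k => ?_⟩
  · rw [h1 k i (by omega), if_neg (by omega)]
  · rw [jump_apply, rep_polySob hj, ← Function.iterate_add_apply, polyC_apply, polyC_apply,
      coe_i1, coe_i0, h0 k _ (by omega), h1 k _ (by omega), sub_zero]
    simp

/-- Each factor `w ↦ w + kjump n w • e n` is inverted by changing the sign, as `kjump n` does not
see multiples of `e n`. Applying the factor of highest index first leaves all lower `kjump k`
unchanged, so the corrections add up. -/
theorem exists_shear_equiv (p : ℕ) {e : ℕ → sobolevInterval p} (he : ∀ k ≤ p, Flat p k (e k)) :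
    ∀ n ≤ p, ∃ A : sobolevInterval p ≃ sobolevInterval p, IsSmoothEquiv A ∧
      ∀ w, A w = w + ∑ k ∈ Finset.range n, kjump p k w • e k := by
  intro n
  induction n with
  | zero => exact fun _ => ⟨Equiv.refl _, ⟨contDiff_id, contDiff_id⟩, fun w => by simp⟩
  | succ n ih =>
    intro hn
    obtain ⟨A, hA, hA'⟩ := ih (by omega)
    have hk := contDiff_kjump (p := p) (j := n) (by omega)
    have hinv : ∀ w (c : ℝ), kjump p n (w + c • e n) = kjump p n w := fun w c =>
      kjump_add (by omega) w ((he n (by omega)).smul c)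
    let S : sobolevInterval p ≃ sobolevInterval p :=
      { toFun := fun w => w + kjump p n w • e n
        invFun := fun w => w + (-kjump p n w) • e n
        left_inv := fun w => by
          simp only
          rw [hinv]
          module
        right_inv := fun w => by
          simp only
          rw [hinv]
          module }
    have hS : IsSmoothEquiv S :=
      ⟨contDiff_id.add (hk.smul contDiff_const), contDiff_id.add (hk.neg.smul contDiff_const)⟩
    refine ⟨S.trans A, hS.trans hA, fun w => ?_⟩
    change A (w + kjump p n w • e n) = _
    rw [hA', Finset.sum_range_succ, add_assoc, add_comm (∑ k ∈ Finset.range n, _)]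
    congr 2
    refine Finset.sum_congr rfl fun k hk => ?_
    have := Finset.mem_range.1 hk
    rw [kjump_add (by omega) w (((he n (by omega)).mono this.le).smul _)]

/-- A diffeomorphism of `H^p` that turns the periodicity conditions for the Kepler transform into
linear ones. -/
theorem exists_periodic_equiv (p : ℕ) : ∃ A : sobolevInterval p ≃ sobolevInterval p,
    IsSmoothEquiv A ∧ (∀ w, ∀ j < p, jump p j (A w) = -2 * jump p j (kepTp p w)) ∧
      (∀ w, V (pot p (A w)) i1 = V (pot p w) i1) ∧
      (∀ w, VJ (V (pot p (A w))) i1 = VJ (V (pot p w)) i1) ∧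
      ∀ w x, Flat p p x → A (w + x) = A w + x := by
  obtain ⟨e, he, he'⟩ := exists_jump_basis p
  obtain ⟨A, hA, hA'⟩ := exists_shear_equiv p he p le_rfl
  refine ⟨A, hA, fun w j hj => ?_, fun w => ?_, fun w => ?_, fun w x hx => ?_⟩
  -- Only `e j` has a jump at order `j`, so the sum contributes exactly `kjump p j w`.
  · rw [← jump_kepTp hj, hA', map_add, map_sum]
    simp only [map_smul, he' j hj, smul_eq_mul, mul_ite, mul_one, mul_zero]
    rw [Finset.sum_ite_eq, if_pos (Finset.mem_range.2 hj)]
  · have : (ev i1).comp (V.comp (pot p)) (A w) = (ev i1).comp (V.comp (pot p)) w := by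
      rw [hA', map_add, map_sum, add_eq_left]
      refine Finset.sum_eq_zero fun k hk => ?_
      rw [map_smul]
      change _ • V (pot p (e k)) i1 = 0
      rw [(he k (Finset.mem_range.1 hk).le).V_eq, smul_zero]
    exact this
  · have : (ev i1).comp (VJ.comp (V.comp (pot p))) (A w) =
        (ev i1).comp (VJ.comp (V.comp (pot p))) w := by
      rw [hA', map_add, map_sum, add_eq_left]
      refine Finset.sum_eq_zero fun k hk => ?_
      rw [map_smul]
      change _ • VJ (V (pot p (e k))) i1 = 0
      rw [(he k (Finset.mem_range.1 hk).le).VJV_eq, smul_zero]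
    exact this
  · rw [hA', hA', add_right_comm]
    congr 2
    refine Finset.sum_congr rfl fun k hk => ?_
    rw [kjump_add (Finset.mem_range.1 hk).le w (hx.mono (Finset.mem_range.1 hk).le)]

/-- The inclusion of `H^p(S¹)` in `H^p([0, 2π])`. -/
def circleIncl (p : ℕ) : sobolevCircle p →L[ℝ] sobolevInterval p :=
  (sobolevCircle p).subtypeL.codRestrict (sobolevInterval p) fun f =>
    (mem_sobolevCircle_iff.1 f.2).1

theorem exists_circleIncl_eq {p : ℕ} {u : sobolevInterval p} (h : ∀ j < p, jump p j u = 0) :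
    ∃ f : sobolevCircle p, circleIncl p f = u :=
  ⟨⟨u, (mem_sobolevCircle_iff_jump u).2 h⟩, rfl⟩

theorem jump_circleIncl {p j : ℕ} (hj : j < p) (f : sobolevCircle p) :
    jump p j (circleIncl p f) = 0 :=
  (mem_sobolevCircle_iff_jump (circleIncl p f)).1 f.2 j hj

theorem not_finiteDimensional_sobolevInterval (p : ℕ) :
    ¬ FiniteDimensional ℝ (sobolevInterval p) := fun _ =>
  Polynomial.not_finite (R := ℝ) (Module.Finite.of_injective (polySobL p 1)
    (polySobL_injective p one_ne_zero))

/-- The circle space is the common kernel of the `p` jump functionals on an infinite-dimensional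
space. -/
theorem not_finiteDimensional_sobolevCircle (p : ℕ) :
    ¬ FiniteDimensional ℝ (sobolevCircle p) := by
  intro h
  refine not_finiteDimensional_sobolevInterval p ?_
  set Λ : sobolevInterval p →ₗ[ℝ] Fin p → ℝ :=
    LinearMap.pi fun j : Fin p => (jump p j : sobolevInterval p →ₗ[ℝ] ℝ) with hΛ
  have h1 : FiniteDimensional ℝ (sobolevInterval p ⧸ LinearMap.ker Λ) :=
    Module.Finite.equiv Λ.quotKerEquivRange.symm
  have h2 : FiniteDimensional ℝ (LinearMap.ker Λ) := by
    refine Module.Finite.of_surjective ((circleIncl p : sobolevCircle p →ₗ[ℝ]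
      sobolevInterval p).codRestrict (LinearMap.ker Λ) fun f => ?_) fun u => ?_
    · ext j
      exact jump_circleIncl j.2 f
    · obtain ⟨f, hf⟩ := exists_circleIncl_eq (u := u.1) fun j hj =>
        congrFun (LinearMap.mem_ker.1 u.2) ⟨j, hj⟩
      exact ⟨f, Subtype.ext hf⟩
  exact Module.Finite.of_submodule_quotient (LinearMap.ker Λ)

/-! ### The product structure of the Sobolev spaces -/

/-- Second derivatives of a bump polynomial and of two Hermite polynomials with data at `2π` of
order 0 and 1. Having no jumps, these elements serve for both the interval and the circle. -/
theorem exists_adapted_elements (p : ℕ) : ∃ (β f₁ f₂ : sobolevInterval p) (b : CI),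
    Flat p p β ∧ VJ (V (pot p β)) = b ∧
    (∀ t : II, (t : ℝ) ∈ Ioo 0 (2 * Real.pi) → 0 < b t) ∧
    (∀ j < p, jump p j β = 0 ∧ jump p j f₁ = 0 ∧ jump p j f₂ = 0) ∧
    VJ (V (pot p f₁)) i1 = 1 ∧ VJ (V (pot p f₂)) i1 = 0 ∧
    V (pot p f₁) i1 = 0 ∧ V (pot p f₂) i1 = 1 := by
  obtain ⟨Q, hQ0, hQ1, hQ⟩ := exists_bump (c := 2 * Real.pi) (p + 2)
  obtain ⟨R, hR0, hR1⟩ := exists_hermite (c := 2 * Real.pi) (by positivity) (p + 2) 0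
  obtain ⟨S, hS0, hS1⟩ := exists_hermite (c := 2 * Real.pi) (by positivity) (p + 2) 1
  have key : ∀ T : Polynomial ℝ, (∀ i < p + 2, (Polynomial.derivative^[i] T).eval 0 = 0) →
      VJ (V (pot p (polySob p (Polynomial.derivative^[2] T)))) = polyC T ∧
      V (pot p (polySob p (Polynomial.derivative^[2] T))) = polyC (Polynomial.derivative T) :=
    fun T hT => ⟨VJ_V_pot_polySob p (hT 0 (by omega)) (hT 1 (by omega)),
      V_pot_polySob p (hT 1 (by omega))⟩
  have hjump : ∀ T : Polynomial ℝ, (∀ i < p + 2, (Polynomial.derivative^[i] T).eval 0 = 0) →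
      (∀ j < p, (Polynomial.derivative^[j + 2] T).eval (2 * Real.pi) = 0) → ∀ j < p,
      jump p j (polySob p (Polynomial.derivative^[2] T)) = 0 := fun T hT hT' j hj => by
    rw [jump_apply, rep_polySob hj, ← Function.iterate_add_apply, polyC_apply, polyC_apply,
      coe_i1, coe_i0, hT _ (by omega), hT' j hj, sub_zero]
  refine ⟨polySob p (Polynomial.derivative^[2] Q), polySob p (Polynomial.derivative^[2] R),
    polySob p (Polynomial.derivative^[2] S), polyC Q, flat_polySob le_rfl hQ0 hQ1,
    (key Q hQ0).1, fun t ht => hQ t ht, fun j hj => ⟨hjump Q hQ0 (fun i hi => hQ1 _ (by omega)) j hj,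
      hjump R hR0 (fun i hi => ?_) j hj, hjump S hS0 (fun i hi => ?_) j hj⟩, ?_, ?_, ?_, ?_⟩
  · rw [hR1 _ (by omega), if_neg (by omega)]
  · rw [hS1 _ (by omega), if_neg (by omega)]
  · rw [(key R hR0).1]
    exact hR1 0 (by omega)
  · rw [(key S hS0).1]
    exact hS1 0 (by omega)
  · rw [(key R hR0).2]
    exact hR1 1 (by omega)
  · rw [(key S hS0).2]
    exact hS1 1 (by omega)

/-- The coordinates of the monodromy of `kepT u`, with a logarithm in the first place. -/
def logCoords (u : L2) : EuclideanSpace ℝ (Fin 3) :=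
  !₂[logTotal (VJ (V u)), -VJ (V u) i1, -(V u i1 * Real.exp (-VJ (V u) i1))]

instance secondCountableTopology_L2 : SecondCountableTopology L2 := by
  have : Fact ((2 : ENNReal) ≠ ⊤) := ⟨ENNReal.ofNat_ne_top⟩
  exact Lp.SecondCountableTopology

instance secondCountableTopology_EP (p : ℕ) : SecondCountableTopology (EP p) :=
  (PiLp.homeomorph 2 fun _ : Fin (p + 1) => L2).secondCountableTopology

instance separableSpace_sobolevInterval (p : ℕ) :
    TopologicalSpace.SeparableSpace (sobolevInterval p) :=
  have : SecondCountableTopology (sobolevInterval p) :=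
    TopologicalSpace.Subtype.secondCountableTopology (sobolevInterval p : Set (EP p))
  inferInstance

instance separableSpace_sobolevCircle (p : ℕ) :
    TopologicalSpace.SeparableSpace (sobolevCircle p) :=
  have : SecondCountableTopology (sobolevCircle p) :=
    TopologicalSpace.Subtype.secondCountableTopology (sobolevCircle p : Set (EP p))
  inferInstance

section Theta

variable (H : Type*) [NormedAddCommGroup H] [InnerProductSpace ℝ H] [CompleteSpace H]
  [TopologicalSpace.SeparableSpace H]

theorem exists_theta_interval (hH : ¬ FiniteDimensional ℝ H) (p : ℕ) :
    ∃ Θ : sobolevInterval p ≃ EuclideanSpace ℝ (Fin 3) × H, IsSmoothEquiv Θ ∧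
      ∀ q, ∃ u, pot p q = kepT u ∧ (Θ q).1 = logCoords u := by
  obtain ⟨β, f₁, f₂, b, hβ, hβb, hb, -, h₁₁, h₁₂, h₂₁, h₂₂⟩ := exists_adapted_elements p
  obtain ⟨e, he, he'⟩ := exists_equiv_kepTp p
  obtain ⟨Θ, hΘ, hΘ'⟩ := exists_product_equiv (not_finiteDimensional_sobolevInterval p) hH
    (l₁ := (ev i1).comp (VJ.comp (V.comp (pot p)))) (l₂ := (ev i1).comp (V.comp (pot p)))
    hβ.VJV_eq hβ.V_eq h₁₁ h₁₂ h₂₁ h₂₂ (B := fun u => VJ (V (pot p u)))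
    (VJ.comp (V.comp (pot p))).contDiff hb fun y s => by
      rw [map_add, map_smul, map_add, map_smul, map_add, map_smul, hβb]
  refine ⟨e.symm.trans Θ, he.symm.trans hΘ, fun q => ⟨pot p (e.symm q), ?_, hΘ' _⟩⟩
  rw [← pot_kepTp, ← he', e.apply_symm_apply]

/-- By `h`, the jumps of `A w` vanish exactly when those of `e w` do, so `e ∘ A⁻¹` restricts to a
bijection of the periodic subspace. -/
theorem exists_circle_equiv (p : ℕ) {A e : sobolevInterval p ≃ sobolevInterval p}
    (hA : IsSmoothEquiv A) (he : IsSmoothEquiv e)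
    (h : ∀ w, ∀ j < p, jump p j (A w) = -2 * jump p j (e w)) :
    ∃ k : sobolevCircle p ≃ sobolevCircle p, IsSmoothEquiv k ∧
      ∀ y, circleIncl p (k y) = e (A.symm (circleIncl p y)) := by
  have h1 : ∀ y : sobolevCircle p, ∃ q, circleIncl p q = e (A.symm (circleIncl p y)) := fun y =>
    exists_circleIncl_eq fun j hj => by
      have := h (A.symm (circleIncl p y)) j hj
      rw [A.apply_symm_apply, jump_circleIncl hj] at this
      linarith
  have h2 : ∀ q : sobolevCircle p, ∃ y, circleIncl p y = A (e.symm (circleIncl p q)) := fun q =>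
    exists_circleIncl_eq fun j hj => by
      rw [h _ j hj, e.apply_symm_apply, jump_circleIncl hj, mul_zero]
  choose f hf using h1
  choose g hg using h2
  have hinj : Function.Injective (circleIncl p) := fun x y hxy =>
    Subtype.ext (congrArg (fun z : sobolevInterval p => (z : EP p)) hxy)
  refine ⟨⟨f, g, fun y => hinj ?_, fun q => hinj ?_⟩, ⟨contDiff_codRestrict ?_,
    contDiff_codRestrict ?_⟩, hf⟩
  · rw [hg, hf, e.symm_apply_apply, A.apply_symm_apply]
  · rw [hf, hg, A.symm_apply_apply, e.apply_symm_apply]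
  · have : (fun y => (f y : EP p)) = fun y =>
        ((e (A.symm (circleIncl p y)) : sobolevInterval p) : EP p) := funext fun y => by
      rw [← hf]; rfl
    change ContDiff ℝ ∞ fun y => (f y : EP p)
    rw [this]
    exact (sobolevInterval p).subtypeL.contDiff.comp
      (he.contDiff.comp (hA.contDiff_symm.comp (circleIncl p).contDiff))
  · have : (fun y => (g y : EP p)) = fun y =>
        ((A (e.symm (circleIncl p y)) : sobolevInterval p) : EP p) := funext fun y => by
      rw [← hg]; rfl
    change ContDiff ℝ ∞ fun y => (g y : EP p)
    rw [this]
    exact (sobolevInterval p).subtypeL.contDiff.comp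
      (hA.contDiff.comp (he.contDiff_symm.comp (circleIncl p).contDiff))

/-- The straightening is applied on the circle to `y = A w`, with `w` the variable of the Kepler
transform. The functionals `r(2π)` and `r'(2π)` may be read on `y` in place of `w` because `A`
preserves them. -/
theorem exists_theta_circle (hH : ¬ FiniteDimensional ℝ H) (p : ℕ) :
    ∃ Θ : sobolevCircle p ≃ EuclideanSpace ℝ (Fin 3) × H, IsSmoothEquiv Θ ∧
      ∀ q, ∃ u, pot p (circleIncl p q) = kepT u ∧ (Θ q).1 = logCoords u := by
  obtain ⟨β, f₁, f₂, b, hβ, hβb, hb, hj, h₁₁, h₁₂, h₂₁, h₂₂⟩ := exists_adapted_elements p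
  obtain ⟨e, he, he'⟩ := exists_equiv_kepTp p
  obtain ⟨A, hA, hAj, hAV, hAVJ, hAflat⟩ := exists_periodic_equiv p
  obtain ⟨k, hk, hk'⟩ := exists_circle_equiv p hA he fun w j hj => by rw [he', hAj w j hj]
  obtain ⟨β', rfl⟩ := exists_circleIncl_eq fun j hj' => (hj j hj').1
  obtain ⟨f₁', rfl⟩ := exists_circleIncl_eq fun j hj' => (hj j hj').2.1
  obtain ⟨f₂', rfl⟩ := exists_circleIncl_eq fun j hj' => (hj j hj').2.2
  obtain ⟨Θ, hΘ, hΘ'⟩ := exists_product_equiv (not_finiteDimensional_sobolevCircle p) hH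
    (l₁ := (ev i1).comp (VJ.comp (V.comp ((pot p).comp (circleIncl p)))))
    (l₂ := (ev i1).comp (V.comp ((pot p).comp (circleIncl p))))
    hβ.VJV_eq hβ.V_eq h₁₁ h₁₂ h₂₁ h₂₂ (B := fun y => VJ (V (pot p (A.symm (circleIncl p y)))))
    ((VJ.comp (V.comp (pot p))).contDiff.comp
      (hA.contDiff_symm.comp (circleIncl p).contDiff)) hb fun y s => by
      -- Because `β` is flat to full order, `A` commutes with translation along it; so `r` stays
      -- affine along `β` after `A⁻¹`.
      have : A.symm (circleIncl p (y + s • β')) =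
          A.symm (circleIncl p y) + s • circleIncl p β' := by
        rw [A.symm_apply_eq, hAflat _ _ (hβ.smul s), A.apply_symm_apply, map_add, map_smul]
      rw [this, map_add, map_smul, map_add, map_smul, map_add, map_smul, hβb]
  refine ⟨k.symm.trans Θ, hk.symm.trans hΘ, fun q =>
    ⟨pot p (A.symm (circleIncl p (k.symm q))), ?_, (hΘ' _).trans ?_⟩⟩
  · rw [← pot_kepTp, ← he', ← hk', k.apply_symm_apply]
  · have h1 := hAV (A.symm (circleIncl p (k.symm q)))
    have h2 := hAVJ (A.symm (circleIncl p (k.symm q)))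
    rw [A.apply_symm_apply] at h1 h2
    rw [logCoords, ← h1, ← h2]
    rfl

end Theta

/-! ### The global chart of `G₀` -/

theorem contMDiff_coords : ContMDiff (𝓡 3) (𝓡 3) ∞ coords := by
  rw [← contMDiffOn_univ]
  exact contMDiffOn_chart (I := 𝓡 3) (n := ∞) (x := (1 : G))

theorem contMDiff_coords_symm : ContMDiff (𝓡 3) (𝓡 3) ∞ coords.symm := by
  rw [← contMDiffOn_univ]
  exact contMDiffOn_chart_symm (I := 𝓡 3) (n := ∞) (x := (1 : G))

theorem mem_G0_iff (g : G) : g ∈ G0 ↔ 0 < coords g 0 := mem_G0set_iff g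

theorem contDiff_coord (i : Fin 3) : ContDiff ℝ ∞ fun x : EuclideanSpace ℝ (Fin 3) => x i :=
  (contDiff_piLp 2).1 contDiff_id i

/-- The diffeomorphism from `G₀` to `ℝ³` given by the logarithm of the angle and the other two
coordinates. -/
def chi : G0 ≃ₘ⟮𝓡 3, 𝓡 3⟯ EuclideanSpace ℝ (Fin 3) where
  toFun g := !₂[Real.log (coords g 0), coords g 1, coords g 2]
  invFun x := ⟨coords.symm !₂[Real.exp (x 0), x 1, x 2], by
    rw [mem_G0_iff, Homeomorph.apply_symm_apply]
    exact Real.exp_pos _⟩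
  left_inv g := by
    apply Subtype.ext
    change coords.symm _ = _
    rw [Homeomorph.symm_apply_eq]
    have h := (mem_G0_iff g).1 g.2
    ext i
    fin_cases i <;> simp [Real.exp_log h]
  right_inv x := by
    ext i
    fin_cases i <;> simp
  contMDiff_toFun := by
    have hc : ContMDiff (𝓡 3) (𝓡 3) ∞ fun g : G0 => coords (g : G) :=
      contMDiff_coords.comp contMDiff_subtype_val
    refine fun g => ContMDiffAt.comp
      (g := fun x : EuclideanSpace ℝ (Fin 3) => !₂[Real.log (x 0), x 1, x 2]) g ?_ (hc g)
    refine ContDiffAt.contMDiffAt ?_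
    rw [contDiffAt_piLp]
    intro i
    fin_cases i
    · exact (contDiff_coord 0).contDiffAt.log ((mem_G0_iff g).1 g.2).ne'
    · exact (contDiff_coord 1).contDiffAt
    · exact (contDiff_coord 2).contDiffAt
  contMDiff_invFun := by
    rw [← ContMDiff.subtypeVal_comp_iff]
    refine contMDiff_coords_symm.comp
      (f := fun x : EuclideanSpace ℝ (Fin 3) => !₂[Real.exp (x 0), x 1, x 2])
      (ContDiff.contMDiff ?_)
    rw [contDiff_piLp]
    intro i
    fin_cases i
    · exact (contDiff_coord 0).exp
    · exact contDiff_coord 1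
    · exact contDiff_coord 2

/-- The lifted angle is the integral of an exponential, hence positive; this is why the image lies
in `G₀`. -/
theorem monodromy_kepT_mem (u : L2) : monodromy (kepT u) ∈ G0 := by
  rw [mem_G0_iff, monodromy_kepT, Homeomorph.apply_symm_apply]
  exact total_cexp_pos (VJ (V u))

theorem chi_monodromy_kepT (u : L2) : chi ⟨monodromy (kepT u), monodromy_kepT_mem u⟩ =
    logCoords u := by
  change !₂[Real.log (coords (monodromy (kepT u)) 0), coords (monodromy (kepT u)) 1,
    coords (monodromy (kepT u)) 2] = _
  rw [monodromy_kepT, Homeomorph.apply_symm_apply]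
  rfl

/-! ### Diffeomorphisms -/

/-- Once the first component of `T` is `chi` of the monodromy, `Ψ` is the inverse of `T` precomposed
with `chi`, and `Θ` is `T` itself. -/
theorem exists_diffeomorph {X H : Type*} [NormedAddCommGroup X] [NormedSpace ℝ X]
    [NormedAddCommGroup H] [NormedSpace ℝ H] {μ : X → G}
    {T : X ≃ EuclideanSpace ℝ (Fin 3) × H} (hT : IsSmoothEquiv T)
    (hμ : ∀ q, ∃ h : μ q ∈ G0, chi ⟨μ q, h⟩ = (T q).1) :
    ∃ Ψ : (G0 × H) ≃ₘ⟮(𝓡 3).prod 𝓘(ℝ, H), 𝓘(ℝ, X)⟯ X,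
      (∀ (g : G0) (h : H), μ (Ψ (g, h)) = g) ∧
      Set.range μ = G0 ∧
      ∃ Θ : X ≃ₘ⟮𝓘(ℝ, X), 𝓘(ℝ, EuclideanSpace ℝ (Fin 3) × H)⟯ (EuclideanSpace ℝ (Fin 3) × H),
        ∀ g : G0, Θ '' {q | μ q = g} = {chi g} ×ˢ Set.univ := by
  have key : ∀ (g : G0) q, μ q = g ↔ (T q).1 = chi g := fun g q => by
    obtain ⟨h, h'⟩ := hμ q
    rw [← h']
    exact Subtype.ext_iff.symm.trans (chi.injective.eq_iff (a := ⟨μ q, h⟩) (b := g)).symm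
  have hΨ : ∀ (g : G0) (h : H), μ (T.symm (chi g, h)) = g := fun g h => by
    rw [key, T.apply_symm_apply]
  refine ⟨
    { toEquiv := (chi.toEquiv.prodCongr (Equiv.refl H)).trans T.symm
      contMDiff_toFun := ?_
      contMDiff_invFun := ?_ }, hΨ, ?_,
    { toEquiv := T
      contMDiff_toFun := hT.contDiff.contMDiff
      contMDiff_invFun := hT.contDiff_symm.contMDiff }, fun g => ?_⟩
  · refine hT.contDiff_symm.contMDiff.comp (f := fun x : G0 × H => (chi x.1, x.2)) ?_
    exact (chi.contMDiff.comp contMDiff_fst).prodMk_space contMDiff_snd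
  · have h1 : ContMDiff 𝓘(ℝ, X) (𝓡 3) ∞ fun q => (T q).1 :=
      (contDiff_fst.comp hT.contDiff).contMDiff
    have h2 : ContMDiff 𝓘(ℝ, X) 𝓘(ℝ, H) ∞ fun q => (T q).2 :=
      (contDiff_snd.comp hT.contDiff).contMDiff
    exact (chi.symm.contMDiff.comp h1).prodMk h2
  · refine Subset.antisymm (range_subset_iff.2 fun q => (hμ q).1) fun g hg => ?_
    exact ⟨_, hΨ ⟨g, hg⟩ 0⟩
  · ext x
    constructor
    · rintro ⟨q, hq, rfl⟩
      exact ⟨(key g q).1 hq, mem_univ _⟩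
    · rintro ⟨hx, -⟩
      refine ⟨T.symm x, (key g _).2 ?_, T.apply_symm_apply x⟩
      rw [T.apply_symm_apply]
      exact hx

theorem monodromyInterval_eq {p : ℕ} (q : sobolevInterval p) :
    monodromyInterval q = monodromy (pot p q) := by
  rw [pot_apply, compo_zero]
  rfl

theorem monodromyCircle_eq {p : ℕ} (q : sobolevCircle p) :
    monodromyCircle q = monodromy (pot p (circleIncl p q)) := by
  rw [pot_apply, compo_zero]
  rfl

theorem exists_chi_eq {g : G} {u q : L2} (hg : g = monodromy q) (hq : q = kepT u) :
    ∃ h : g ∈ G0, chi ⟨g, h⟩ = logCoords u := by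
  subst hg hq
  exact ⟨monodromy_kepT_mem u, chi_monodromy_kepT u⟩

end Monodromy

end

/-! ### The theorem, on the interval and on the circle. -/

theorem mainTheorem1
    (H : Type*) [NormedAddCommGroup H] [InnerProductSpace ℝ H] [CompleteSpace H]
    [TopologicalSpace.SeparableSpace H] (hH : ¬ FiniteDimensional ℝ H) (p : ℕ) :
    (∀ q : Monodromy.L2, ∃! g : Monodromy.G, Monodromy.IsMonodromy q g) ∧
    ∃ χ : Monodromy.G0 ≃ₘ⟮𝓡 3, 𝓡 3⟯ EuclideanSpace ℝ (Fin 3),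
      (∃ Ψ : (Monodromy.G0 × H)
            ≃ₘ⟮(𝓡 3).prod 𝓘(ℝ, H), 𝓘(ℝ, Monodromy.sobolevInterval p)⟯
            Monodromy.sobolevInterval p,
        (∀ (g : Monodromy.G0) (h : H), Monodromy.monodromyInterval (Ψ (g, h)) = g) ∧
        Set.range (Monodromy.monodromyInterval (p := p)) = Monodromy.G0 ∧
        ∃ Θ : Monodromy.sobolevInterval p
            ≃ₘ⟮𝓘(ℝ, Monodromy.sobolevInterval p), 𝓘(ℝ, EuclideanSpace ℝ (Fin 3) × H)⟯
            (EuclideanSpace ℝ (Fin 3) × H),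
          ∀ g : Monodromy.G0,
            Θ '' {q | Monodromy.monodromyInterval q = g} = {χ g} ×ˢ Set.univ) ∧
      (∃ Ψ : (Monodromy.G0 × H)
            ≃ₘ⟮(𝓡 3).prod 𝓘(ℝ, H), 𝓘(ℝ, Monodromy.sobolevCircle p)⟯
            Monodromy.sobolevCircle p,
        (∀ (g : Monodromy.G0) (h : H), Monodromy.monodromyCircle (Ψ (g, h)) = g) ∧
        Set.range (Monodromy.monodromyCircle (p := p)) = Monodromy.G0 ∧
        ∃ Θ : Monodromy.sobolevCircle p
            ≃ₘ⟮𝓘(ℝ, Monodromy.sobolevCircle p), 𝓘(ℝ, EuclideanSpace ℝ (Fin 3) × H)⟯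
            (EuclideanSpace ℝ (Fin 3) × H),
          ∀ g : Monodromy.G0,
            Θ '' {q | Monodromy.monodromyCircle q = g} = {χ g} ×ˢ Set.univ) := by
  refine ⟨Monodromy.existsUnique_isMonodromy, Monodromy.chi, ?_, ?_⟩
  · obtain ⟨T, hT, hT'⟩ := Monodromy.exists_theta_interval H hH p
    refine Monodromy.exists_diffeomorph hT fun q => ?_
    obtain ⟨u, hu, hu'⟩ := hT' q
    rw [hu']
    exact Monodromy.exists_chi_eq (Monodromy.monodromyInterval_eq q) hu
  · obtain ⟨T, hT, hT'⟩ := Monodromy.exists_theta_circle H hH p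
    refine Monodromy.exists_diffeomorph hT fun q => ?_
    obtain ⟨u, hu, hu'⟩ := hT' q
    rw [hu']
    exact Monodromy.exists_chi_eq (Monodromy.monodromyCircle_eq q) hu
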